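/- Let $D$ be the space of càdlàg functions $[0,\infty)\to\mathbb R$ with the $\sigma$-algebra generated by the evaluations, and let $(\Omega,\mathcal F,\mathbb P)$ be a probability space carrying a Crump–Mode–Jagers process $Z=(Z(t))_{t\ge0}$ with one ancestor, described as follows. Let $L$ be an integer valued random variable (the number of children born at a birth event), let $\pi$ be the law of $Z$ on $D$, and let $\Pi$ be the law on $\mathbb Z_+\times D^\infty$ of $(L,Z_1,Z_2,\dots)$, where $L,Z_1,Z_2,\dots$ are independent and each $Z_i$ has law $\pi$. Let $\mathcal M$ be a Poisson random measure on $\mathbb R_+\times\mathbb R_+\times(\mathbb Z_+\times D^\infty)$ with mean measure $\mu(dr,du,d\mathbf z)=dr\,du\,\Pi(d\mathbf z)$, $\mathbf z=(\ell,z_1,z_2,\dots)$. Let $b=(b(t))_{t\ge0}$ be a measurable $\mathbb R_+$-valued process (the birth rate of the ancestor) and $\eta\ge0$ a random variable (its lifetime), such that the pair $(b,\eta)$, of arbitrary joint law, is independent of $\mathcal M$. The process $Z$ satisfies, for every $t\ge0$, almost surely, $$Z(t)=\mathbf 1_{\eta>t}+\int_0^t\int_0^{b(r)}\int\sum_{i=1}^{\ell}z_i(t-r)\,\mathcal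 M(dr,du,d\mathbf z).$$ Let $\bar{\mathcal M}=\mathcal M-\mu$, let $F(t)=\mathbb P(\eta\le t)$, and set $$U(t)=\int_0^t\int_0^{b(r)}\int\sum_{i=1}^{\ell}z_i(t-r)\,\bar{\mathcal M}(dr,du,d\mathbf z),\qquad t\ge0 .$$ Assume that $\mathbb E[L^4]<\infty$ and that $\sup_{0<t<T'}\mathbb E[b(t)^4]<\infty$ for every $T'>0$. Fix $T>0$ and let $\alpha\in(0,1]$ and $C_F>0$ be such that $F(t)-F(s)\le C_F|t-s|^{\alpha}$ for all $0\le s<t\le T$. Then, for every $t\in[0,T]$, the integrand defining $U(t)$ is almost surely integrable with respect to both $\mathcal M$ and $\mu$ (so that $U(t)$ is well defined), and there exists a constant $C$ such that for all $0\le s<v<t\le T$ the following two random variables are integrable and (i) $\mathbb E\big[|U(t)-U(s)|^2\big]\le C(t-s)$, (ii) $\mathbb E\big[|U(t)-U(v)|^2\,|U(v)-U(s)|^2\big]\le C(t-s)^{1+\alpha/2}$. -/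

import Mathlib

open MeasureTheory ProbabilityTheory Set Filter Topology
open scoped NNReal ENNReal

noncomputable section

namespace CMJ

/-- Right continuity with left limits, for a function on `[0, ∞)`. -/
def IsCadlag (f : ℝ≥0 → ℝ) : Prop :=
  ∀ t : ℝ≥0, ContinuousWithinAt f (Ici t) t ∧ ∃ l : ℝ, Tendsto f (𝓝[<] t) (𝓝 l)

/-- The path space `D = D([0, ∞), ℝ)`. -/
def Path : Type := {f : ℝ≥0 → ℝ // IsCadlag f}

/-- The σ-algebra on `D` generated by the evaluations (it is the Borel σ-algebra of the
Skorohod topology). -/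
instance : MeasurableSpace Path :=
  MeasurableSpace.comap (fun (z : Path) (t : ℝ≥0) => z.1 t) MeasurableSpace.pi

/-- The mark space `ℕ × D^∞`: a mark is `(ℓ, z_1, z_2, …)`. -/
abbrev Mark : Type := ℕ × (ℕ → Path)

/-- The points `(r, u, 𝐳)` of `ℝ₊ × ℝ₊ × (ℕ × D^∞)`. -/
abbrev Point : Type := ℝ≥0 × ℝ≥0 × Mark

/-- Lebesgue measure on `ℝ₊`. -/
def lebesguePos : Measure ℝ≥0 := Measure.comap ((↑) : ℝ≥0 → ℝ) volume

/-- The law `Π` of `(L, Z_1, Z_2, …)`, where `L, Z_1, Z_2, …` are independent, `L` has law `ν`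
and each `Z_i` has law `π`. -/
def markLaw (ν : Measure ℕ) (π : Measure Path) : Measure Mark :=
  ν.prod (Measure.infinitePi fun _ : ℕ => π)

/-- The mean measure `μ(dr, du, d𝐳) = dr du Π(d𝐳)`. -/
def meanMeasure (ν : Measure ℕ) (π : Measure Path) : Measure Point :=
  lebesguePos.prod (lebesguePos.prod (markLaw ν π))

/-- `M` is a Poisson random measure with (σ-finite) mean measure `μ`: an integer valued random
measure, independently scattered, such that `M(B)` is Poisson with parameter `μ(B)` whenever
`μ(B) < ∞`. -/
structure IsPoissonRandomMeasure {Ω E : Type*} [MeasurableSpace Ω] [MeasurableSpace E]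
    (P : Measure Ω) (μ : Measure E) (M : Ω → Measure E) : Prop where
  measurable : Measurable M
  integer_valued : ∀ᵐ ω ∂P, ∀ B : Set E, MeasurableSet B → ∃ n : ℕ∞, M ω B = (n : ℝ≥0∞)
  poisson : ∀ B : Set E, MeasurableSet B → μ B ≠ ∞ →
    HasLaw (fun ω => M ω B)
      ((poissonMeasure (μ B).toNNReal).map fun n : ℕ => (n : ℝ≥0∞)) P
  independent : ∀ (n : ℕ) (B : Fin n → Set E), (∀ i, MeasurableSet (B i)) →
    (∀ i j, i ≠ j → Disjoint (B i) (B j)) → iIndepFun (fun i ω => M ω (B i)) P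

/-- The integrand `(r, u, 𝐳) ↦ 1_{r ≤ t} 1_{u ≤ β(r)} ∑_{i=1}^ℓ z_i(t - r)`, where `β` is a
realization of the birth rate. -/
def birthIntegrand (β : ℝ≥0 → ℝ≥0) (t : ℝ≥0) (x : Point) : ℝ :=
  if x.1 ≤ t ∧ x.2.1 ≤ β x.1 then
    ∑ i ∈ Finset.range x.2.2.1, (x.2.2.2 i).1 (t - x.1)
  else 0

/-- A Crump-Mode-Jagers process with one ancestor, together with the data that drive it: the
random birth rate `b` of the ancestor, its lifetime `η`, the law `ν` of the number of children
born at a birth event, and the Poisson random measure `M` of the birth events of the ancestor,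
whose marks carry the subpopulations started by the children. The pair `(b, η)`, of arbitrary
joint law, is independent of `M`. The law `π` of the process is also the common law of these
subpopulations. -/
structure IsCMJProcess {Ω : Type*} [mΩ : MeasurableSpace Ω] (P : Measure Ω)
    (ν : Measure ℕ) (π : Measure Path) (b : Ω → ℝ≥0 → ℝ≥0) (η : Ω → ℝ≥0)
    (M : Ω → Measure Point) (Z : Ω → Path) : Prop where
  poisson : IsPoissonRandomMeasure P (meanMeasure ν π) M
  /-- The measurable process `b` and the variable `η` are carried by a σ-algebra `𝒢` that is
  independent of `M`. -/
  independent : ∃ 𝒢 : MeasurableSpace Ω, 𝒢 ≤ mΩ ∧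
    Measurable[𝒢.prod inferInstance] (fun p : Ω × ℝ≥0 => b p.1 p.2) ∧
    Measurable[𝒢] η ∧
    Indep 𝒢 (MeasurableSpace.comap M inferInstance) P
  law : HasLaw Z π P
  equation : ∀ t : ℝ≥0, ∀ᵐ ω ∂P,
    (Z ω).1 t = (if t < η ω then 1 else 0) + ∫ x, birthIntegrand (b ω) t x ∂(M ω)

/-- `U(t) = ∫_0^t ∫_0^{b(r)} ∫ ∑_{i=1}^ℓ z_i(t - r) (M - μ)(dr, du, d𝐳)`, the integral with
respect to the compensated measure. -/
def compensatedIntegral {Ω : Type*} (μ : Measure Point) (b : Ω → ℝ≥0 → ℝ≥0)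
    (M : Ω → Measure Point) (t : ℝ≥0) (ω : Ω) : ℝ :=
  (∫ x, birthIntegrand (b ω) t x ∂(M ω)) - ∫ x, birthIntegrand (b ω) t x ∂μ

/-- Moment condition: `E[L⁴] < ∞` and `sup_{0 < t < T} E[b(t)⁴] < ∞` for every `T > 0`. -/
def FourthMomentCondition {Ω : Type*} [MeasurableSpace Ω] (P : Measure Ω) (ν : Measure ℕ)
    (b : Ω → ℝ≥0 → ℝ≥0) : Prop :=
  (∫⁻ l, (l : ℝ≥0∞) ^ 4 ∂ν) < ∞ ∧
    ∀ T : ℝ≥0, 0 < T → (⨆ t ∈ Ioo 0 T, ∫⁻ ω, (b ω t : ℝ≥0∞) ^ 4 ∂P) < ∞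

/-- The distribution function `F(t) = P(η ≤ t)` of the lifetime. -/
def lifetimeCDF {Ω : Type*} [MeasurableSpace Ω] (P : Measure Ω) (η : Ω → ℝ≥0) (t : ℝ≥0) : ℝ :=
  P.real {ω | η ω ≤ t}

/-- `F(t) - F(s) ≤ C |t - s|^α` for all `0 ≤ s < t ≤ T`, with some constant `C > 0`. -/
def HolderUpTo (F : ℝ≥0 → ℝ) (T : ℝ≥0) (α : ℝ) : Prop :=
  ∃ C : ℝ, 0 < C ∧ ∀ s t : ℝ≥0, s < t → t ≤ T → F t - F s ≤ C * |(t : ℝ) - s| ^ α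

end CMJ

end

noncomputable section

namespace CMJ

/-! ### Moments of the Poisson law -/

/-! The pair (birth rate, lifetime) is independent of the Poisson measure, so it can be frozen. For
a deterministic integrand, integration against `M - μ` is a limit of linear combinations of
independent centred Poisson variables. Hence its second moment is controlled by ∫f², and the mixed
moment of two such squares by ∫f²g² + ∫f²·∫g² (`moments_compInt_le`). For the birth integrand these
quantities become time integrals of moments of a functional φ(r, ·) under the law π of the process,
weighted by the rate. Cauchy–Schwarz and the fourth moments of L and b remove the weights. The
outcome is `HasMomentBounds`, where N(φ) denotes the time-integrated second moment: the squared
integral restricted to an event G of the ancestor costs P(G)^(1/2) N(φ), and the product of two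
squared integrals costs the integrated mixed moments plus N(φ)N(ψ). The drift is carried along with
the compensated part, because the equation for Z contains the full integral.

Since π is also the law of Z, the birth equation bounds each moment of Z by the same moment at
earlier ages, integrated over the birth time, plus a forcing term. Every estimate then follows from
one Grönwall lemma, `exists_gronwall`, whose constant does not depend on the a priori bound that it
requires. For the fourth moments of Z, that bound is supplied by truncation, which passes inside the
integral because `M` is integer valued.

Write h for the length of an interval and d = h^(α/2). There are three recursions for increments.
The fourth moment has forcing P(lifetime ends in the interval) + h, so it is O(d²). The second
moment integrated over birth times is O(h), with no loss of exponent, because by Fubini the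
probability that the lifetime ends in a moving window of length h has time integral at most h; this
gives (i). For the mixed moment over two successive intervals, the term in which the lifetime ends
in both, which would only be of order d², vanishes identically. If it ends in one of them, the cost
is P(G)^(1/2) N = O(d·h). Births during the first interval also cost O(d·h), by Cauchy–Schwarz and
the fourth moment of the second increment, and all older births are recursive. Grönwall yields
O(h·d) = O(h^(1+α/2)), which is (ii). -/

theorem poisson_weight_succ (r : ℝ≥0) (n : ℕ) :
    Real.exp (-r) * (r : ℝ) ^ (n + 1) / ((n + 1).factorial : ℝ) * ((n + 1 : ℕ) : ℝ)
      = r * (Real.exp (-r) * (r : ℝ) ^ n / (n.factorial : ℝ)) := by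
  rw [Nat.factorial_succ]
  push_cast
  have h1 : ((n : ℝ) + 1) ≠ 0 := by positivity
  have h2 : (n.factorial : ℝ) ≠ 0 := by positivity
  field_simp
  ring

theorem integrable_poisson_mul {r : ℝ≥0} {g : ℕ → ℝ}
    (hg : Integrable (fun n => g (n + 1)) (poissonMeasure r)) :
    Integrable (fun n : ℕ => (n : ℝ) * g n) (poissonMeasure r) := by
  rw [integrable_poissonMeasure_iff] at hg ⊢
  rw [← summable_nat_add_iff 1]
  refine (hg.mul_left (r : ℝ)).congr fun n => ?_
  rw [norm_mul, Real.norm_natCast, ← mul_assoc, ← mul_assoc, ← poisson_weight_succ]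

/-- The Chen–Stein identity, an index shift in the Poisson series. It lowers the degree by one, so
the raw moments up to order four follow recursively. -/
theorem integral_poisson_mul {r : ℝ≥0} {g : ℕ → ℝ}
    (hg : Integrable (fun n => g (n + 1)) (poissonMeasure r)) :
    ∫ n : ℕ, (n : ℝ) * g n ∂(poissonMeasure r) = r * ∫ n, g (n + 1) ∂(poissonMeasure r) := by
  have h := hasSum_integral_poissonMeasure (integrable_poisson_mul hg)
  have h' := (hasSum_integral_poissonMeasure hg).mul_left (r : ℝ)
  rw [← hasSum_nat_add_iff' 1] at h
  simp only [Finset.range_one, Finset.sum_singleton, Nat.cast_zero, zero_mul, smul_zero,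
    sub_zero] at h
  refine h.unique (h'.congr_fun fun n => ?_)
  rw [smul_eq_mul, smul_eq_mul, ← mul_assoc, ← mul_assoc, ← poisson_weight_succ]

/-- `f` is integrable, with integral `v`. -/
def HasInt {Ω : Type*} [MeasurableSpace Ω] (P : Measure Ω) (f : Ω → ℝ) (v : ℝ) : Prop :=
  Integrable f P ∧ ∫ ω, f ω ∂P = v

namespace HasInt

variable {Ω : Type*} [MeasurableSpace Ω] {P : Measure Ω} {f g : Ω → ℝ} {u v : ℝ}

theorem add (hf : HasInt P f u) (hg : HasInt P g v) :
    HasInt P (fun ω => f ω + g ω) (u + v) :=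
  ⟨hf.1.add hg.1, by rw [integral_add hf.1 hg.1, hf.2, hg.2]⟩

theorem const_mul (hf : HasInt P f u) (c : ℝ) : HasInt P (fun ω => c * f ω) (c * u) :=
  ⟨hf.1.const_mul c, by rw [integral_const_mul, hf.2]⟩

theorem const [IsProbabilityMeasure P] (c : ℝ) : HasInt P (fun _ => c) c :=
  ⟨integrable_const c, by simp⟩

theorem congr (hf : HasInt P f u) (hfg : ∀ ω, g ω = f ω) (huv : v = u) : HasInt P g v := by
  obtain rfl : g = f := funext hfg
  exact huv ▸ hf

end HasInt

theorem hasInt_poisson_mul {r : ℝ≥0} {g : ℕ → ℝ} {v : ℝ}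
    (hg : HasInt (poissonMeasure r) (fun n => g (n + 1)) v) :
    HasInt (poissonMeasure r) (fun n : ℕ => (n : ℝ) * g n) (r * v) :=
  ⟨integrable_poisson_mul hg.1, by rw [integral_poisson_mul hg.1, hg.2]⟩

theorem integrable_poisson_pow (r : ℝ≥0) (k : ℕ) :
    Integrable (fun n : ℕ => (n : ℝ) ^ k) (poissonMeasure r) := by
  induction k using Nat.strong_induction_on with
  | _ k ih =>
    rcases k with _ | k
    · simp
    · have : Integrable (fun n : ℕ => ((n + 1 : ℕ) : ℝ) ^ k) (poissonMeasure r) := by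
        simp only [Nat.cast_add, Nat.cast_one, add_pow, one_pow, mul_one]
        exact integrable_finsetSum _ fun i hi =>
          (ih i (by simpa using hi)).mul_const _
      refine (integrable_poisson_mul (g := fun n => (n : ℝ) ^ k) this).congr
        (Eventually.of_forall fun n => ?_)
      simp only [pow_succ, mul_comm]

theorem hasInt_poisson_one (r : ℝ≥0) : HasInt (poissonMeasure r) (fun n : ℕ => (n : ℝ)) r :=
  (hasInt_poisson_mul (g := fun _ => 1) (HasInt.const 1)).congr (fun n => by ring) (by ring)

theorem hasInt_poisson_sq (r : ℝ≥0) :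
    HasInt (poissonMeasure r) (fun n : ℕ => (n : ℝ) ^ 2) (r ^ 2 + r) :=
  (hasInt_poisson_mul (g := fun n => (n : ℝ)) (((hasInt_poisson_one r).add
    (HasInt.const 1)).congr (fun n => by push_cast; ring) rfl)).congr
    (fun n => by ring) (by ring)

theorem hasInt_poisson_cube (r : ℝ≥0) :
    HasInt (poissonMeasure r) (fun n : ℕ => (n : ℝ) ^ 3) (r ^ 3 + 3 * r ^ 2 + r) :=
  (hasInt_poisson_mul (g := fun n => (n : ℝ) ^ 2) (((hasInt_poisson_sq r).add
    (((hasInt_poisson_one r).const_mul 2).add (HasInt.const 1))).congr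
    (fun n => by push_cast; ring) rfl)).congr (fun n => by ring) (by ring)

theorem hasInt_poisson_pow_four (r : ℝ≥0) :
    HasInt (poissonMeasure r) (fun n : ℕ => (n : ℝ) ^ 4)
      (r ^ 4 + 6 * r ^ 3 + 7 * r ^ 2 + r) :=
  (hasInt_poisson_mul (g := fun n => (n : ℝ) ^ 3) (((hasInt_poisson_cube r).add
    (((hasInt_poisson_sq r).const_mul 3).add
      (((hasInt_poisson_one r).const_mul 3).add (HasInt.const 1)))).congr
    (fun n => by push_cast; ring) rfl)).congr (fun n => by ring) (by ring)

/-- Centered random variables with the integrability and the moments of a centered Poisson law. -/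
structure IsCenteredPoissonLike {Ω : Type*} [MeasurableSpace Ω] (P : Measure Ω) (X : Ω → ℝ)
    (l : ℝ) : Prop where
  memLp : ∀ p : ℕ, MemLp X p P
  mean : ∫ ω, X ω ∂P = 0
  second : ∫ ω, X ω ^ 2 ∂P = l
  fourth : ∫ ω, X ω ^ 4 ∂P = l + 3 * l ^ 2

theorem isCenteredPoissonLike_poisson (r : ℝ≥0) :
    IsCenteredPoissonLike (poissonMeasure r) (fun n : ℕ => (n : ℝ) - r) r where
  memLp p := by
    refine MemLp.sub ?_ (memLp_const _)
    rcases p.eq_zero_or_pos with rfl | hp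
    · simpa using (integrable_poisson_pow r 1).aestronglyMeasurable
    · rw [← integrable_norm_rpow_iff (by fun_prop) (by simp [hp.ne']) (by simp)]
      simpa using integrable_poisson_pow r p
  mean := (((hasInt_poisson_one r).add (HasInt.const (-r))).congr
    (fun n => by ring) (v := 0) (by ring)).2
  second := (((hasInt_poisson_sq r).add (((hasInt_poisson_one r).const_mul (-2 * r)).add
    (HasInt.const (r ^ 2)))).congr (fun n => by ring) (by ring)).2
  fourth := (((hasInt_poisson_pow_four r).add (((hasInt_poisson_cube r).const_mul (-4 * r)).add
    (((hasInt_poisson_sq r).const_mul (6 * r ^ 2)).add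
      (((hasInt_poisson_one r).const_mul (-4 * r ^ 3)).add (HasInt.const (r ^ 4)))))).congr
    (fun n => by ring) (by ring)).2

/-! ### Moments of linear combinations of independent variables -/

theorem memLp_mul_nat {Ω : Type*} [MeasurableSpace Ω] {P : Measure Ω} {X Y : Ω → ℝ}
    (hX : ∀ p : ℕ, MemLp X p P) (hY : ∀ p : ℕ, MemLp Y p P) (p : ℕ) :
    MemLp (fun ω => X ω * Y ω) p P := by
  have : ENNReal.HolderTriple ((2 * p : ℕ) : ℝ≥0∞) ((2 * p : ℕ) : ℝ≥0∞) (p : ℝ≥0∞) := by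
    constructor
    push_cast
    rw [ENNReal.mul_inv (by simp) (by simp), ← add_mul, ENNReal.inv_two_add_inv_two, one_mul]
  exact (hY (2 * p)).mul (hX (2 * p))

/-- All the moments are carried through a single induction, since the expansion of the mixed fourth
moment consumes the means, the second moments and the covariance of the partial sums. No third
moment is needed: a cube of one variable is always multiplied by an independent centred factor. -/
theorem moments_sum_indep {Ω ι : Type*} [MeasurableSpace Ω] {P : Measure Ω}
    [IsProbabilityMeasure P] {X : ι → Ω → ℝ} (hm : ∀ i, Measurable (X i))
    (hind : iIndepFun X P) {l : ι → ℝ} (hX : ∀ i, IsCenteredPoissonLike P (X i) (l i))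
    (a c : ι → ℝ) (s : Finset ι) :
    (∀ p : ℕ, MemLp (fun ω => ∑ i ∈ s, a i * X i ω) p P) ∧
    (∀ p : ℕ, MemLp (fun ω => ∑ i ∈ s, c i * X i ω) p P) ∧
    (∫ ω, (∑ i ∈ s, a i * X i ω) ∂P = 0) ∧
    (∫ ω, (∑ i ∈ s, c i * X i ω) ∂P = 0) ∧
    (∫ ω, (∑ i ∈ s, a i * X i ω) ^ 2 ∂P = ∑ i ∈ s, a i ^ 2 * l i) ∧
    (∫ ω, (∑ i ∈ s, c i * X i ω) ^ 2 ∂P = ∑ i ∈ s, c i ^ 2 * l i) ∧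
    (∫ ω, (∑ i ∈ s, a i * X i ω) * (∑ i ∈ s, c i * X i ω) ∂P = ∑ i ∈ s, a i * c i * l i) ∧
    (∫ ω, (∑ i ∈ s, a i * X i ω) ^ 2 * (∑ i ∈ s, c i * X i ω) ^ 2 ∂P
      = ∑ i ∈ s, a i ^ 2 * c i ^ 2 * l i + (∑ i ∈ s, a i ^ 2 * l i) * (∑ i ∈ s, c i ^ 2 * l i)
        + 2 * (∑ i ∈ s, a i * c i * l i) ^ 2) := by
  classical
  have hL : ∀ (d : ι → ℝ) (s : Finset ι) (p : ℕ), MemLp (fun ω => ∑ i ∈ s, d i * X i ω) p P :=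
    fun d s p => memLp_finsetSum s fun i _ => ((hX i).memLp p).const_mul (d i)
  refine ⟨hL a s, hL c s, ?_⟩
  induction s using Finset.induction_on with
  | empty => simp
  | insert j s hj ih =>
    obtain ⟨ha0, hc0, ha2, hc2, hac, h4⟩ := ih
    simp only [Finset.sum_insert hj]
    set S : Ω → ℝ := fun ω => ∑ i ∈ s, a i * X i ω with hS
    set R : Ω → ℝ := fun ω => ∑ i ∈ s, c i * X i ω with hR
    set Y := X j with hY
    have hSL : ∀ p : ℕ, MemLp S p P := hL a s
    have hRL : ∀ p : ℕ, MemLp R p P := hL c s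
    have hYL : ∀ p : ℕ, MemLp Y p P := (hX j).memLp
    -- The two sums must be jointly independent of the new variable. The triples (a x, c x, x) are
    -- summed as vectors, and the unneeded coordinates are projected away.
    have hindep : IndepFun (fun ω => (S ω, R ω)) Y P := by
      have h := (hind.comp (fun i x => ((a i * x, c i * x, x) : ℝ × ℝ × ℝ))
        (fun i => by fun_prop)).indepFun_finsetSum_of_notMem
          (fun i => Measurable.comp (by fun_prop) (hm i)) hj
      have h' := h.comp (φ := fun v : ℝ × ℝ × ℝ => (v.1, v.2.1)) (ψ := fun v => v.2.2)
        (by fun_prop) (by fun_prop)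
      convert h' using 1
      funext ω
      simp [hS, hR, Finset.sum_apply, Prod.fst_sum, Prod.snd_sum]
      rfl
    have iP : ∀ m n k : ℕ, Integrable (fun ω => S ω ^ m * R ω ^ n * Y ω ^ k) P := by
      have hp : ∀ {Z : Ω → ℝ}, (∀ p : ℕ, MemLp Z p P) → ∀ n p : ℕ,
          MemLp (fun ω => Z ω ^ n) p P := by
        intro Z hZ n
        induction n with
        | zero => intro p; simpa using memLp_const 1
        | succ n ihn => intro p; simpa only [pow_succ] using memLp_mul_nat ihn hZ p
      intro m n k
      have := memLp_mul_nat (memLp_mul_nat (hp hSL m) (hp hRL n)) (hp hYL k) 1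
      exact memLp_one_iff_integrable.1 (by simpa using this)
    have fP : ∀ m n k : ℕ, ∫ ω, S ω ^ m * R ω ^ n * Y ω ^ k ∂P
        = (∫ ω, S ω ^ m * R ω ^ n ∂P) * ∫ ω, Y ω ^ k ∂P := by
      intro m n k
      have h := hindep.comp (φ := fun v : ℝ × ℝ => v.1 ^ m * v.2 ^ n) (ψ := fun y => y ^ k)
        (by fun_prop) (by fun_prop)
      have e1 := iP m n 0
      have e2 := iP 0 0 k
      simp only [pow_zero, mul_one, one_mul] at e1 e2
      exact h.integral_mul_eq_mul_integral e1.aestronglyMeasurable e2.aestronglyMeasurable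
    have hY1 : ∫ ω, Y ω ^ 1 ∂P = 0 := by simpa using (hX j).mean
    have hY2 : ∫ ω, Y ω ^ 2 ∂P = l j := (hX j).second
    have hY4 : ∫ ω, Y ω ^ 4 ∂P = l j + 3 * l j ^ 2 := (hX j).fourth
    have H : ∀ d : ℝ, ∀ m n k : ℕ, HasInt P (fun ω => d * (S ω ^ m * R ω ^ n * Y ω ^ k))
        (d * ((∫ ω, S ω ^ m * R ω ^ n ∂P) * ∫ ω, Y ω ^ k ∂P)) := fun d m n k =>
      HasInt.const_mul ⟨iP m n k, fP m n k⟩ d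
    have hS1 : ∫ ω, S ω ^ 1 * R ω ^ 0 ∂P = 0 := by simpa using ha0
    have hR1 : ∫ ω, S ω ^ 0 * R ω ^ 1 ∂P = 0 := by simpa using hc0
    have hS2 : ∫ ω, S ω ^ 2 * R ω ^ 0 ∂P = ∑ i ∈ s, a i ^ 2 * l i := by simpa using ha2
    have hR2 : ∫ ω, S ω ^ 0 * R ω ^ 2 ∂P = ∑ i ∈ s, c i ^ 2 * l i := by simpa using hc2
    have hSR : ∫ ω, S ω ^ 1 * R ω ^ 1 ∂P = ∑ i ∈ s, a i * c i * l i := by simpa using hac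
    have h00 : ∫ ω, S ω ^ 0 * R ω ^ 0 ∂P = 1 := by simp
    have hY0 : ∫ ω, Y ω ^ 0 ∂P = 1 := by simp
    have hSR2 : ∫ ω, S ω ^ 2 * R ω ^ 2 ∂P = _ := h4
    refine ⟨?_, ?_, ?_, ?_, ?_, ?_⟩
    · refine (((H (a j) 0 0 1).add (H 1 1 0 0)).congr (fun ω => by ring) ?_).2
      rw [hS1, hY1]; ring
    · refine (((H (c j) 0 0 1).add (H 1 0 1 0)).congr (fun ω => by ring) ?_).2
      rw [hR1, hY1]; ring
    · refine (((H (a j ^ 2) 0 0 2).add ((H (2 * a j) 1 0 1).add (H 1 2 0 0))).congr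
        (fun ω => by ring) ?_).2
      rw [hS1, hY1, hY2, hS2, h00, hY0]; ring
    · refine (((H (c j ^ 2) 0 0 2).add ((H (2 * c j) 0 1 1).add (H 1 0 2 0))).congr
        (fun ω => by ring) ?_).2
      rw [hR1, hY1, hY2, hR2, h00, hY0]; ring
    · refine (((H (a j * c j) 0 0 2).add ((H (a j) 0 1 1).add ((H (c j) 1 0 1).add
        (H 1 1 1 0)))).congr (fun ω => by ring) ?_).2
      rw [hR1, hS1, hY1, hY2, hSR, h00, hY0]; ring
    -- The nine monomials of (a Y + S)²(c Y + R)². Those of odd degree in Y vanish: degree one by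
    -- the mean of Y, degree three by the mean of S or R.
    · refine (((H (a j ^ 2 * c j ^ 2) 0 0 4).add ((H (2 * a j * c j ^ 2) 1 0 3).add
        ((H (2 * a j ^ 2 * c j) 0 1 3).add ((H (2 * a j) 1 2 1).add ((H (2 * c j) 2 1 1).add
        ((H (a j ^ 2) 0 2 2).add ((H (c j ^ 2) 2 0 2).add ((H (4 * a j * c j) 1 1 2).add
        (H 1 2 2 0))))))))).congr (fun ω => by ring) ?_).2
      rw [hR1, hS1, hY1, hY2, hSR, hY4, hS2, hR2, h00, hY0, hSR2]; ring

/-! ### Integrals with respect to a Poisson random measure -/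

theorem enorm_sq_eq_ofReal (x : ℝ) : ‖x‖ₑ ^ 2 = ENNReal.ofReal (x ^ 2) := by
  rw [Real.enorm_eq_ofReal_abs, ← ENNReal.ofReal_pow (abs_nonneg x), sq_abs]

theorem IsCenteredPoissonLike.of_map {Ω Ω' : Type*} [MeasurableSpace Ω] [MeasurableSpace Ω']
    {P : Measure Ω} {X : Ω' → ℝ} {Y : Ω → Ω'} {l : ℝ} (hX : Measurable X) (hY : AEMeasurable Y P)
    (h : IsCenteredPoissonLike (P.map Y) X l) : IsCenteredPoissonLike P (fun ω => X (Y ω)) l where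
  memLp p := (memLp_map_measure_iff hX.aestronglyMeasurable hY).1 (h.memLp p)
  mean := by rw [← h.mean, integral_map hY hX.aestronglyMeasurable]
  second := by
    rw [← h.second, integral_map hY (hX.pow_const 2).aestronglyMeasurable]
  fourth := by
    rw [← h.fourth, integral_map hY (hX.pow_const 4).aestronglyMeasurable]

/-- The integral of `f` with respect to the signed measure `m - μ`. -/
def compInt {E : Type*} [MeasurableSpace E] (μ m : Measure E) (f : E → ℝ) : ℝ :=
  ∫ x, f x ∂m - ∫ x, f x ∂μ

namespace IsPoissonRandomMeasure

variable {Ω E : Type*} [MeasurableSpace Ω] [MeasurableSpace E] {P : Measure Ω} {μ : Measure E}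
  {M : Ω → Measure E}

theorem lintegral_apply_of_ne_top (hM : IsPoissonRandomMeasure P μ M) {B : Set E}
    (hB : MeasurableSet B) (hfin : μ B ≠ ∞) : ∫⁻ ω, M ω B ∂P = μ B := by
  rw [(hM.poisson B hB hfin).lintegral_comp (f := fun x => x) aemeasurable_id,
    lintegral_map (f := fun x => x) measurable_id (by fun_prop)]
  have h := hasInt_poisson_one (μ B).toNNReal
  have e : ∀ n : ℕ, ((n : ℝ≥0∞)) = ENNReal.ofReal (n : ℝ) := fun n => by simp
  simp only [e]
  rw [← ofReal_integral_eq_lintegral_ofReal h.1 (Eventually.of_forall fun n => by positivity), h.2]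
  simp [hfin]

theorem isCenteredPoissonLike (hM : IsPoissonRandomMeasure P μ M) {B : Set E}
    (hB : MeasurableSet B) (hfin : μ B ≠ ∞) :
    IsCenteredPoissonLike P (fun ω => (M ω).real B - μ.real B) (μ.real B) := by
  have hl := hM.poisson B hB hfin
  refine IsCenteredPoissonLike.of_map (X := fun x : ℝ≥0∞ => x.toReal - μ.real B)
    (by fun_prop) hl.aemeasurable ?_
  rw [hl.map_eq]
  have h := isCenteredPoissonLike_poisson (μ B).toNNReal
  have hm : AEMeasurable (fun n : ℕ => (n : ℝ≥0∞)) (poissonMeasure (μ B).toNNReal) := by fun_prop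
  have hs : Measurable fun x : ℝ≥0∞ => x.toReal - μ.real B := by fun_prop
  refine ⟨fun p => ?_, ?_, ?_, ?_⟩
  · rw [memLp_map_measure_iff hs.aestronglyMeasurable hm]
    exact h.memLp p
  · rw [integral_map hm hs.aestronglyMeasurable]
    exact h.mean
  · rw [integral_map hm (hs.pow_const 2).aestronglyMeasurable]
    exact h.second
  · rw [integral_map hm (hs.pow_const 4).aestronglyMeasurable]
    exact h.fourth

theorem iIndepFun_finset (hM : IsPoissonRandomMeasure P μ M) {ι : Type*} [Finite ι]
    {B : ι → Set E} (hB : ∀ i, MeasurableSet (B i)) (hd : ∀ i j, i ≠ j → Disjoint (B i) (B j)) :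
    iIndepFun (fun i ω => M ω (B i)) P := by
  obtain ⟨n, ⟨e⟩⟩ := Finite.exists_equiv_fin ι
  have h := hM.independent n (fun k => B (e.symm k)) (fun k => hB _)
    (fun i j hij => hd _ _ fun h => hij (e.symm.injective h))
  exact iIndepFun.of_precomp (g := e.symm) e.symm.surjective h

theorem integral_simpleFunc_eq {m : Measure E} (H : SimpleFunc E (ℝ × ℝ)) (hH : Integrable H m)
    {F : ℝ × ℝ → ℝ} (hF : F 0 = 0) :
    ∫ x, F (H x) ∂m = ∑ y ∈ H.range, m.real (H ⁻¹' {y}) * F y := by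
  have hi : Integrable (H.map F) m := by
    rw [SimpleFunc.integrable_iff_finMeasSupp] at hH ⊢
    exact hH.map hF
  have := SimpleFunc.map_integral H F hH hF
  rw [SimpleFunc.integral_eq_integral _ hi] at this
  simpa using this

/-- Working with a pair-valued `H` gives both coordinates common level sets. The value 0 is dropped
because its level set may have infinite mass; the other level sets have finite mass by
integrability. -/
theorem compInt_simpleFunc_eq {m : Measure E} (H : SimpleFunc E (ℝ × ℝ)) (hH : Integrable H m)
    (hH' : Integrable H μ) {F : ℝ × ℝ → ℝ} (hF : F 0 = 0) :
    compInt μ m (fun x => F (H x)) =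
      ∑ i : {y // y ∈ H.range.filter (· ≠ 0)},
        F i.1 * (m.real (H ⁻¹' {i.1}) - μ.real (H ⁻¹' {i.1})) := by
  rw [compInt, integral_simpleFunc_eq H hH hF, integral_simpleFunc_eq H hH' hF,
    ← Finset.sum_sub_distrib,
    Finset.sum_coe_sort (H.range.filter (· ≠ 0))
      (fun y => F y * (m.real (H ⁻¹' {y}) - μ.real (H ⁻¹' {y}))), Finset.sum_filter]
  refine Finset.sum_congr rfl fun y _ => ?_
  split_ifs with h
  · ring
  · rw [not_not] at h
    subst h
    simp [hF]

theorem sum_simpleFunc_eq (H : SimpleFunc E (ℝ × ℝ)) (hH : Integrable H μ)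
    {F : ℝ × ℝ → ℝ} (hF : F 0 = 0) (hF0 : ∀ y, 0 ≤ F y) :
    ENNReal.ofReal (∑ i : {y // y ∈ H.range.filter (· ≠ 0)}, F i.1 * μ.real (H ⁻¹' {i.1}))
      = ∫⁻ x, ENNReal.ofReal (F (H x)) ∂μ := by
  have hi : Integrable (fun x => F (H x)) μ := by
    have : Integrable (H.map F) μ := by
      rw [SimpleFunc.integrable_iff_finMeasSupp] at hH ⊢
      exact hH.map hF
    exact this
  rw [← ofReal_integral_eq_lintegral_ofReal hi (Eventually.of_forall fun x => hF0 _),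
    integral_simpleFunc_eq H hH hF,
    Finset.sum_coe_sort (H.range.filter (· ≠ 0)) (fun y => F y * μ.real (H ⁻¹' {y})),
    Finset.sum_filter]
  congr 1
  refine Finset.sum_congr rfl fun y _ => ?_
  split_ifs with h
  · ring
  · rw [not_not] at h
    subst h
    simp [hF]

variable [SigmaFinite μ]

/-- Campbell's formula. The Poisson mean gives it on sets of finite mass, and monotone exhaustion by
the spanning sets gives the rest. -/
theorem bind_eq (hM : IsPoissonRandomMeasure P μ M) : P.bind M = μ := by
  refine Measure.ext fun B hB => ?_
  have hU : B = ⋃ n, B ∩ spanningSets μ n := by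
    rw [← inter_iUnion, iUnion_spanningSets, inter_univ]
  have hmono : Monotone fun n => B ∩ spanningSets μ n := fun i j hij =>
    inter_subset_inter_right _ (monotone_spanningSets μ hij)
  rw [hU, hmono.measure_iUnion, hmono.measure_iUnion]
  refine iSup_congr fun n => ?_
  have hBn : MeasurableSet (B ∩ spanningSets μ n) := hB.inter (measurableSet_spanningSets μ n)
  rw [Measure.bind_apply hBn hM.measurable.aemeasurable, hM.lintegral_apply_of_ne_top hBn]
  exact ((measure_mono inter_subset_right).trans_lt (measure_spanningSets_lt_top μ n)).ne

theorem lintegral_lintegral (hM : IsPoissonRandomMeasure P μ M) {f : E → ℝ≥0∞}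
    (hf : Measurable f) : ∫⁻ ω, ∫⁻ x, f x ∂(M ω) ∂P = ∫⁻ x, f x ∂μ := by
  rw [← Measure.lintegral_bind hM.measurable.aemeasurable hf.aemeasurable, hM.bind_eq]

theorem ae_integrable (hM : IsPoissonRandomMeasure P μ M) {F : Type*} [NormedAddCommGroup F]
    [MeasurableSpace F] [BorelSpace F] [SecondCountableTopology F] {f : E → F}
    (hf : Measurable f) (hint : Integrable f μ) :
    ∀ᵐ ω ∂P, Integrable f (M ω) := by
  have h := hM.lintegral_lintegral hf.enorm
  have hm : Measurable fun ω => ∫⁻ x, ‖f x‖ₑ ∂(M ω) :=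
    (Measure.measurable_lintegral hf.enorm).comp hM.measurable
  filter_upwards [ae_lt_top hm (by rw [h]; exact hint.2.ne)] with ω hω
  exact ⟨hf.aestronglyMeasurable, hω⟩

variable [IsProbabilityMeasure P]

/-- On the disjoint level sets of the pair, `M - μ` takes independent centred Poisson values. The
factor 3 is 1 + 2, after the squared covariance (∫fg)² is bounded by ∫f²·∫g². -/
theorem moments_simpleFunc (hM : IsPoissonRandomMeasure P μ M) (H : SimpleFunc E (ℝ × ℝ))
    (hH : Integrable H μ) :
    ∫⁻ ω, ‖compInt μ (M ω) (fun x => (H x).1)‖ₑ ^ 2 ∂P = ∫⁻ x, ‖(H x).1‖ₑ ^ 2 ∂μ ∧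
    ∫⁻ ω, ‖compInt μ (M ω) (fun x => (H x).1)‖ₑ ^ 2 * ‖compInt μ (M ω) (fun x => (H x).2)‖ₑ ^ 2 ∂P
      ≤ ∫⁻ x, ‖(H x).1‖ₑ ^ 2 * ‖(H x).2‖ₑ ^ 2 ∂μ
        + 3 * ((∫⁻ x, ‖(H x).1‖ₑ ^ 2 ∂μ) * ∫⁻ x, ‖(H x).2‖ₑ ^ 2 ∂μ) := by
  set ι := {y // y ∈ H.range.filter (· ≠ 0)}
  have hBm : ∀ i : ι, MeasurableSet (H ⁻¹' {i.1}) := fun i => H.measurableSet_preimage _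
  have hBfin : ∀ i : ι, μ (H ⁻¹' {i.1}) ≠ ∞ := fun i =>
    (SimpleFunc.measure_preimage_lt_top_of_integrable H hH (Finset.mem_filter.1 i.2).2).ne
  have hind := hM.iIndepFun_finset (B := fun i : ι => H ⁻¹' {i.1}) hBm (fun i j hij =>
    Disjoint.preimage _ (by simpa using fun h => hij (Subtype.ext h)))
  have hind' : iIndepFun (fun (i : ι) ω => (M ω).real (H ⁻¹' {i.1}) - μ.real (H ⁻¹' {i.1})) P :=
    hind.comp (fun i x => x.toReal - μ.real (H ⁻¹' {i.1})) (fun i => by fun_prop)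
  have hms : ∀ i : ι, Measurable fun ω => (M ω).real (H ⁻¹' {i.1}) - μ.real (H ⁻¹' {i.1}) :=
    fun i => ((Measure.measurable_coe (hBm i)).comp hM.measurable).ennreal_toReal.sub_const _
  obtain ⟨hS, hR, -, -, h2, -, -, h4⟩ := moments_sum_indep hms hind'
    (fun i => hM.isCenteredPoissonLike (hBm i) (hBfin i)) (fun i => i.1.1) (fun i => i.1.2)
    Finset.univ
  have hae := hM.ae_integrable H.measurable hH
  have e1 : ∀ᵐ ω ∂P, compInt μ (M ω) (fun x => (H x).1) = ∑ i : ι,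
      i.1.1 * ((M ω).real (H ⁻¹' {i.1}) - μ.real (H ⁻¹' {i.1})) := by
    filter_upwards [hae] with ω hω
    exact compInt_simpleFunc_eq H hω hH (F := Prod.fst) rfl
  have e2 : ∀ᵐ ω ∂P, compInt μ (M ω) (fun x => (H x).2) = ∑ i : ι,
      i.1.2 * ((M ω).real (H ⁻¹' {i.1}) - μ.real (H ⁻¹' {i.1})) := by
    filter_upwards [hae] with ω hω
    exact compInt_simpleFunc_eq H hω hH (F := Prod.snd) rfl
  have q1 := sum_simpleFunc_eq H hH (F := fun y => y.1 ^ 2) (by simp) (fun y => sq_nonneg _)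
  have q2 := sum_simpleFunc_eq H hH (F := fun y => y.2 ^ 2) (by simp) (fun y => sq_nonneg _)
  have q12 := sum_simpleFunc_eq H hH (F := fun y => y.1 ^ 2 * y.2 ^ 2) (by simp)
    (fun y => by positivity)
  constructor
  · simp only [enorm_sq_eq_ofReal]
    rw [← q1, ← h2, ofReal_integral_eq_lintegral_ofReal]
    · refine lintegral_congr_ae ?_
      filter_upwards [e1] with ω hω
      rw [hω]
    · exact (hS 2).integrable_sq
    · exact Eventually.of_forall fun ω => sq_nonneg _
  · simp only [enorm_sq_eq_ofReal, ← ENNReal.ofReal_mul (sq_nonneg _)]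
    rw [← q1, ← q2, ← q12, ← ENNReal.ofReal_mul (Finset.sum_nonneg fun i _ => by positivity),
      show (3 : ℝ≥0∞) = ENNReal.ofReal 3 by simp, ← ENNReal.ofReal_mul (by norm_num),
      ← ENNReal.ofReal_add (Finset.sum_nonneg fun i _ => by positivity)
        (mul_nonneg (by norm_num) (mul_nonneg (Finset.sum_nonneg fun i _ => by positivity)
          (Finset.sum_nonneg fun i _ => by positivity)))]
    calc _ = ENNReal.ofReal (∫ ω, (∑ i : ι,
          i.1.1 * ((M ω).real (H ⁻¹' {i.1}) - μ.real (H ⁻¹' {i.1}))) ^ 2 *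
          (∑ i : ι, i.1.2 * ((M ω).real (H ⁻¹' {i.1}) - μ.real (H ⁻¹' {i.1}))) ^ 2 ∂P) := by
          rw [ofReal_integral_eq_lintegral_ofReal]
          · refine lintegral_congr_ae ?_
            filter_upwards [e1, e2] with ω h h'
            rw [h, h']
          · have := memLp_mul_nat (memLp_mul_nat hS hS) (memLp_mul_nat hR hR) 1
            simp only [← pow_two] at this
            exact memLp_one_iff_integrable.1 (by simpa using this)
          · exact Eventually.of_forall fun ω => by positivity
      _ ≤ _ := by
          rw [h4]
          refine ENNReal.ofReal_le_ofReal ?_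
          -- Cauchy–Schwarz with each coefficient weighted by the square root of the mass of its
          -- cell.
          have cs := Finset.sum_mul_sq_le_sq_mul_sq Finset.univ
            (fun i : ι => i.1.1 * √(μ.real (H ⁻¹' {i.1})))
            (fun i : ι => i.1.2 * √(μ.real (H ⁻¹' {i.1})))
          have hs : ∀ i : ι, √(μ.real (H ⁻¹' {i.1})) * √(μ.real (H ⁻¹' {i.1}))
              = μ.real (H ⁻¹' {i.1}) := fun i => Real.mul_self_sqrt measureReal_nonneg
          have t1 : ∀ i : ι, i.1.1 * √(μ.real (H ⁻¹' {i.1})) * (i.1.2 * √(μ.real (H ⁻¹' {i.1})))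
              = i.1.1 * i.1.2 * μ.real (H ⁻¹' {i.1}) := fun i => by
            rw [mul_mul_mul_comm, hs i]
          have t2 : ∀ (x : ℝ) (i : ι), (x * √(μ.real (H ⁻¹' {i.1}))) ^ 2
              = x ^ 2 * μ.real (H ⁻¹' {i.1}) := fun x i => by
            rw [mul_pow, pow_two (√_), hs i]
          simp only [t1, t2] at cs
          linarith

/-- Simple approximation and Fatou. The approximants are dominated by 2|f|, hence the non-sharp
factors 4 and 16. Integrability makes the compensated integrals converge; the squares need not be
integrable, and the bounds may then be infinite. -/
theorem moments_compInt_le (hM : IsPoissonRandomMeasure P μ M) {f g : E → ℝ} (hf : Measurable f)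
    (hg : Measurable g) (hfi : Integrable f μ) (hgi : Integrable g μ) :
    ∫⁻ ω, ‖compInt μ (M ω) f‖ₑ ^ 2 ∂P ≤ 4 * ∫⁻ x, ‖f x‖ₑ ^ 2 ∂μ ∧
    ∫⁻ ω, ‖compInt μ (M ω) f‖ₑ ^ 2 * ‖compInt μ (M ω) g‖ₑ ^ 2 ∂P
      ≤ 16 * (∫⁻ x, ‖f x‖ₑ ^ 2 * ‖g x‖ₑ ^ 2 ∂μ
        + 3 * ((∫⁻ x, ‖f x‖ₑ ^ 2 ∂μ) * ∫⁻ x, ‖g x‖ₑ ^ 2 ∂μ)) := by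
  classical
  let F : (E → ℝ) → ℕ → SimpleFunc E ℝ := fun f n =>
    if h : Measurable f then SimpleFunc.approxOn f h univ 0 (mem_univ _) n else 0
  have hF : ∀ {f : E → ℝ} (h : Measurable f) n,
      F f n = SimpleFunc.approxOn f h univ 0 (mem_univ _) n := fun h n => dif_pos h
  have hFn : ∀ {f : E → ℝ}, Measurable f → ∀ n x, ‖F f n x‖ ≤ ‖f x‖ + ‖f x‖ := by
    intro f h n x
    rw [hF h]
    exact SimpleFunc.norm_approxOn_zero_le h _ x n
  have hFe : ∀ {f : E → ℝ}, Measurable f → ∀ n x, ‖F f n x‖ₑ ^ 2 ≤ 4 * ‖f x‖ₑ ^ 2 := by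
    intro f h n x
    have h1 : ‖F f n x‖ₑ ≤ 2 * ‖f x‖ₑ := by
      rw [two_mul, ← ofReal_norm, ← ofReal_norm,
        ← ENNReal.ofReal_add (norm_nonneg _) (norm_nonneg _)]
      exact ENNReal.ofReal_le_ofReal (hFn h n x)
    calc _ ≤ (2 * ‖f x‖ₑ) ^ 2 := by gcongr
      _ = _ := by rw [mul_pow]; norm_num
  have hFt : ∀ {f : E → ℝ}, Measurable f → ∀ x, Tendsto (fun n => F f n x) atTop (𝓝 (f x)) := by
    intro f h x
    simp only [hF h]
    exact SimpleFunc.tendsto_approxOn h _ (by simp)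
  have hFi : ∀ {f : E → ℝ} {m : Measure E}, Measurable f → Integrable f m → ∀ n,
      Integrable (F f n) m := by
    intro f m h hi n
    exact (hi.norm.add hi.norm).mono' (F f n).aestronglyMeasurable
      (Eventually.of_forall fun x => hFn h n x)
  have hFI : ∀ {f : E → ℝ} {m : Measure E}, Measurable f → Integrable f m →
      Tendsto (fun n => ∫ x, F f n x ∂m) atTop (𝓝 (∫ x, f x ∂m)) := by
    intro f m h hi
    exact tendsto_integral_of_dominated_convergence _ (fun n => (F f n).aestronglyMeasurable)
      (hi.norm.add hi.norm) (fun n => Eventually.of_forall fun x => hFn h n x)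
      (Eventually.of_forall fun x => hFt h x)
  have hFc : ∀ {f : E → ℝ}, Measurable f → Integrable f μ → ∀ᵐ ω ∂P,
      Tendsto (fun n => ‖compInt μ (M ω) (F f n)‖ₑ ^ 2) atTop
        (𝓝 (‖compInt μ (M ω) f‖ₑ ^ 2)) := by
    intro f h hi
    filter_upwards [hM.ae_integrable h hi] with ω hω
    exact ENNReal.Tendsto.pow ((hFI h hω).sub (hFI h hi)).enorm
  -- Almost surely the compensated integral of a simple function is a finite sum of measurable
  -- terms. The function is paired with itself only to fit the pair-valued formula.
  have hFm : ∀ {f : E → ℝ}, Measurable f → Integrable f μ → ∀ n,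
      AEMeasurable (fun ω => compInt μ (M ω) (F f n)) P := by
    intro f h hi n
    have hp : Integrable ((F f n).pair (F f n)) μ := (hFi h hi n).prodMk (hFi h hi n)
    have hms : Measurable fun ω => ∑ i : {y // y ∈ ((F f n).pair (F f n)).range.filter (· ≠ 0)},
        i.1.1 * ((M ω).real (((F f n).pair (F f n)) ⁻¹' {i.1})
          - μ.real (((F f n).pair (F f n)) ⁻¹' {i.1})) :=
      Finset.measurable_fun_sum _ fun i _ =>
        (((Measure.measurable_coe (SimpleFunc.measurableSet_preimage _ _)).comp
          hM.measurable).ennreal_toReal.sub_const _).const_mul _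
    refine ⟨_, hms, ?_⟩
    filter_upwards [hM.ae_integrable (SimpleFunc.measurable _) hp] with ω hω
    exact compInt_simpleFunc_eq _ hω hp (F := Prod.fst) rfl
  have key := fun n => hM.moments_simpleFunc ((F f n).pair (F g n))
    ((hFi hf hfi n).prodMk (hFi hg hgi n))
  have b2 : ∀ {f : E → ℝ}, Measurable f → ∀ n,
      ∫⁻ x, ‖F f n x‖ₑ ^ 2 ∂μ ≤ 4 * ∫⁻ x, ‖f x‖ₑ ^ 2 ∂μ := by
    intro f h n
    rw [← lintegral_const_mul _ (h.enorm.pow_const 2)]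
    exact lintegral_mono fun x => hFe h n x
  constructor
  · calc _ = ∫⁻ ω, liminf (fun n => ‖compInt μ (M ω) (F f n)‖ₑ ^ 2) atTop ∂P := by
          refine lintegral_congr_ae ?_
          filter_upwards [hFc hf hfi] with ω hω
          exact hω.liminf_eq.symm
      _ ≤ liminf (fun n => ∫⁻ ω, ‖compInt μ (M ω) (F f n)‖ₑ ^ 2 ∂P) atTop :=
          lintegral_liminf_le' fun n => (hFm hf hfi n).enorm.pow_const 2
      _ ≤ _ := by
          refine liminf_le_of_le (by isBoundedDefault) fun b hb => ?_
          obtain ⟨n, hn⟩ := hb.exists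
          exact (hn.trans (key n).1.le).trans (b2 hf n)
  · calc _ = ∫⁻ ω, liminf (fun n => ‖compInt μ (M ω) (F f n)‖ₑ ^ 2 *
            ‖compInt μ (M ω) (F g n)‖ₑ ^ 2) atTop ∂P := by
          refine lintegral_congr_ae ?_
          filter_upwards [hFc hf hfi, hFc hg hgi] with ω hω hω'
          refine (Tendsto.liminf_eq ?_).symm
          exact ENNReal.Tendsto.mul hω (Or.inr (by finiteness)) hω' (Or.inr (by finiteness))
      _ ≤ liminf (fun n => ∫⁻ ω, ‖compInt μ (M ω) (F f n)‖ₑ ^ 2 *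
            ‖compInt μ (M ω) (F g n)‖ₑ ^ 2 ∂P) atTop :=
          lintegral_liminf_le' fun n => ((hFm hf hfi n).enorm.pow_const 2).mul
            ((hFm hg hgi n).enorm.pow_const 2)
      _ ≤ _ := by
          refine liminf_le_of_le (by isBoundedDefault) fun b hb => ?_
          obtain ⟨n, hn⟩ := hb.exists
          refine (hn.trans (key n).2).trans ?_
          have b4 : ∫⁻ x, ‖F f n x‖ₑ ^ 2 * ‖F g n x‖ₑ ^ 2 ∂μ
              ≤ 16 * ∫⁻ x, ‖f x‖ₑ ^ 2 * ‖g x‖ₑ ^ 2 ∂μ := by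
            rw [← lintegral_const_mul _ (by fun_prop)]
            refine lintegral_mono fun x => ?_
            calc _ ≤ (4 * ‖f x‖ₑ ^ 2) * (4 * ‖g x‖ₑ ^ 2) :=
                  mul_le_mul' (hFe hf n x) (hFe hg n x)
              _ = _ := by ring
          calc _ ≤ 16 * ∫⁻ x, ‖f x‖ₑ ^ 2 * ‖g x‖ₑ ^ 2 ∂μ
                + 3 * ((4 * ∫⁻ x, ‖f x‖ₑ ^ 2 ∂μ) * (4 * ∫⁻ x, ‖g x‖ₑ ^ 2 ∂μ)) :=
                add_le_add b4 (mul_le_mul' le_rfl (mul_le_mul' (b2 hf n) (b2 hg n)))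
            _ = _ := by ring

end IsPoissonRandomMeasure

/-! ### Random integrands independent of the Poisson random measure -/

/-- The measures that are finite on each set of a countable measurable partition are the values
of an s-finite kernel. -/
theorem exists_sFinite_kernel_eq {E : Type*} [MeasurableSpace E] {A : ℕ → Set E}
    (hA : ∀ n, MeasurableSet (A n)) (hd : Pairwise (Function.onFun Disjoint A))
    (hU : ⋃ n, A n = univ) :
    ∃ κ : Kernel (Measure E) E, IsSFiniteKernel κ ∧
      ∀ m : Measure E, (∀ n, m (A n) < ∞) → κ m = m := by
  classical
  -- Measures are sorted by the integer part k of their mass on the n-th cell. The restriction to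
  -- that cell, set to zero off this class, is a kernel with total mass at most k + 1.
  let S : ℕ × ℕ → Set (Measure E) := fun q => {m | m (A q.1) ∈ Ico (q.2 : ℝ≥0∞) (q.2 + 1 : ℕ)}
  have hS : ∀ q, MeasurableSet (S q) := fun q =>
    (Measure.measurable_coe (hA q.1)) measurableSet_Ico
  let κ0 : Kernel (Measure E) E := ⟨fun m => m, measurable_id⟩
  let κ : ℕ × ℕ → Kernel (Measure E) E := fun q =>
    Kernel.piecewise (hS q) (κ0.restrict (hA q.1)) 0
  have hκ : ∀ q, IsFiniteKernel (κ q) := fun q => by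
    refine ⟨((q.2 + 1 : ℕ) : ℝ≥0∞), ENNReal.natCast_lt_top _, fun m => ?_⟩
    simp only [κ, Kernel.piecewise_apply]
    split_ifs with h
    · rw [Kernel.restrict_apply, Measure.restrict_apply_univ]
      exact h.2.le
    · simp
  refine ⟨Kernel.sum κ, Kernel.isSFiniteKernel_sum, fun m hm => ?_⟩
  refine Measure.ext fun B hB => ?_
  rw [Kernel.sum_apply' _ _ hB, ENNReal.tsum_prod (f := fun n k => κ (n, k) m B)]
  calc _ = ∑' n, m (B ∩ A n) := by
        refine tsum_congr fun n => ?_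
        obtain ⟨r, hr⟩ : ∃ r : ℝ≥0, (r : ℝ≥0∞) = m (A n) :=
          ⟨_, ENNReal.coe_toNNReal (hm n).ne⟩
        rw [tsum_eq_single ⌊r⌋₊]
        · have : m ∈ S (n, ⌊r⌋₊) := by
            refine ⟨?_, ?_⟩
            · rw [← hr]
              exact_mod_cast Nat.floor_le zero_le
            · rw [← hr]
              exact_mod_cast Nat.lt_floor_add_one r
          simp only [κ, Kernel.piecewise_apply, this, if_true]
          rw [Kernel.restrict_apply, Measure.restrict_apply hB]
          rfl
        · intro k hk
          have : m ∉ S (n, k) := by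
            rintro ⟨h1, h2⟩
            simp only [← hr] at h1 h2
            exact hk (((Nat.floor_eq_iff zero_le).2
              ⟨by exact_mod_cast h1, by exact_mod_cast h2⟩).symm)
          simp only [κ, Kernel.piecewise_apply, this, if_false]
          simp
    _ = m B := by
        rw [← measure_iUnion (fun i j hij => (hd hij).mono inter_subset_right inter_subset_right)
          (fun n => hB.inter (hA n)), ← inter_iUnion, hU, inter_univ]

theorem IndepFun.lintegral_comp {Ω Ω' G : Type*} [MeasurableSpace Ω] [MeasurableSpace Ω']
    [MeasurableSpace G] {P : Measure Ω} [IsProbabilityMeasure P] {X : Ω → Ω'} {Y : Ω → G}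
    (hX : Measurable X) (hY : Measurable Y) (hXY : IndepFun X Y P) {Φ : Ω' × G → ℝ≥0∞}
    (hΦ : Measurable Φ) :
    ∫⁻ ω, Φ (X ω, Y ω) ∂P = ∫⁻ x, ∫⁻ ω, Φ (x, Y ω) ∂P ∂(P.map X) := by
  have h := (indepFun_iff_map_prod_eq_prod_map_map hX.aemeasurable hY.aemeasurable).1 hXY
  have := Measure.isProbabilityMeasure_map (μ := P) hX.aemeasurable
  have := Measure.isProbabilityMeasure_map (μ := P) hY.aemeasurable
  rw [← lintegral_map hΦ (hX.prodMk hY), h, lintegral_prod _ hΦ.aemeasurable]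
  refine lintegral_congr fun x => ?_
  rw [lintegral_map (f := fun y => Φ (x, y)) (hΦ.comp measurable_prodMk_left) hY]

namespace IsPoissonRandomMeasure

variable {Ω Ω' E : Type*} [MeasurableSpace Ω] [MeasurableSpace Ω'] [MeasurableSpace E]
  {P : Measure Ω} {μ : Measure E} {M : Ω → Measure E} {X : Ω → Ω'} {f g : Ω' → E → ℝ}

/-- Joint measurability of (x, m) ↦ ∫ f x dm, needed to freeze X, is obtained for s-finite kernels.
So `M` is replaced by such a kernel evaluated at `M`, which almost surely changes nothing. -/
theorem exists_kernel [SigmaFinite μ] (hM : IsPoissonRandomMeasure P μ M) :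
    ∃ κ : Kernel (Measure E) E, IsSFiniteKernel κ ∧ ∀ᵐ ω ∂P, κ (M ω) = M ω := by
  have hA : ∀ n, MeasurableSet (disjointed (spanningSets μ) n) :=
    MeasurableSet.disjointed fun n => measurableSet_spanningSets μ n
  obtain ⟨κ, hκ, h⟩ := exists_sFinite_kernel_eq hA (disjoint_disjointed _)
    (by rw [iUnion_disjointed, iUnion_spanningSets])
  refine ⟨κ, hκ, ?_⟩
  have : ∀ n, ∀ᵐ ω ∂P, M ω (disjointed (spanningSets μ) n) < ∞ := by
    intro n
    have hfin : μ (disjointed (spanningSets μ) n) ≠ ∞ :=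
      ((measure_mono (disjointed_subset _ n)).trans_lt (measure_spanningSets_lt_top μ n)).ne
    exact ae_lt_top ((Measure.measurable_coe (hA n)).comp hM.measurable)
      (by simpa only [Function.comp_def, hM.lintegral_apply_of_ne_top (hA n) hfin] using hfin)
  filter_upwards [ae_all_iff.2 this] with ω hω
  exact h _ hω

theorem measurable_compInt [SFinite μ] (κ : Kernel (Measure E) E) [IsSFiniteKernel κ]
    (hf : Measurable (Function.uncurry f)) :
    Measurable fun p : Ω' × Measure E => compInt μ (κ p.2) (f p.1) := by
  have h1 : StronglyMeasurable fun p : Ω' × Measure E =>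
      ∫ y, f p.1 y ∂(κ.comap Prod.snd measurable_snd p) :=
    StronglyMeasurable.integral_kernel_prod_right (f := fun (p : Ω' × Measure E) y => f p.1 y)
      (hf.comp (by fun_prop : Measurable fun q : (Ω' × Measure E) × E =>
        (q.1.1, q.2))).stronglyMeasurable
  have h2 : Measurable fun x => ∫ y, f x y ∂μ :=
    (StronglyMeasurable.integral_prod_right hf.stronglyMeasurable).measurable
  exact h1.measurable.sub (h2.comp measurable_fst)

variable [SigmaFinite μ]

theorem aemeasurable_compInt (hM : IsPoissonRandomMeasure P μ M) (hX : Measurable X)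
    (hf : Measurable (Function.uncurry f)) :
    AEMeasurable (fun ω => compInt μ (M ω) (f (X ω))) P := by
  obtain ⟨κ, hκ, hκM⟩ := hM.exists_kernel
  refine ⟨_, (measurable_compInt (μ := μ) κ hf).comp (hX.prodMk hM.measurable), ?_⟩
  filter_upwards [hκM] with ω hω
  simp [hω]

variable [IsProbabilityMeasure P]

theorem ae_integrable_of_indepFun (hM : IsPoissonRandomMeasure P μ M) (hX : Measurable X)
    (hXM : IndepFun X M P) (hf : Measurable (Function.uncurry f))
    (hfi : ∀ᵐ x ∂(P.map X), Integrable (f x) μ) : ∀ᵐ ω ∂P, Integrable (f (X ω)) (M ω) := by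
  obtain ⟨κ, hκ, hκM⟩ := hM.exists_kernel
  have hm : Measurable fun p : Ω' × Measure E => ∫⁻ y, ‖f p.1 y‖ₑ ∂(κ p.2) :=
    Measurable.lintegral_kernel_prod_right (κ := κ.comap Prod.snd measurable_snd)
      (f := fun (p : Ω' × Measure E) y => ‖f p.1 y‖ₑ)
      (hf.comp (by fun_prop : Measurable fun q : (Ω' × Measure E) × E =>
        (q.1.1, q.2))).enorm
  -- The exceptional set is measurable thanks to `κ`, and its sections at frozen x are null, so
  -- independence makes it null.
  set S : Set (Ω' × Measure E) := {p | ∫⁻ y, ‖f p.1 y‖ₑ ∂(κ p.2) = ∞} with hSdef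
  have hS : MeasurableSet S := hm (measurableSet_singleton ∞)
  have hSm : Measurable (indicator S fun _ => (1 : ℝ≥0∞)) := measurable_const.indicator hS
  have key := IndepFun.lintegral_comp hX hM.measurable hXM hSm
  have h0 : ∫⁻ x, ∫⁻ ω, indicator S (fun _ => (1 : ℝ≥0∞)) (x, M ω) ∂P ∂(P.map X) = 0 := by
    rw [← lintegral_zero (μ := P.map X)]
    refine lintegral_congr_ae ?_
    filter_upwards [hfi] with x hx
    rw [← lintegral_zero (μ := P)]
    refine lintegral_congr_ae ?_
    filter_upwards [hM.ae_integrable (hf.comp measurable_prodMk_left) hx, hκM] with ω hω hω'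
    rw [indicator_of_notMem]
    simp only [hSdef, mem_ofPred_eq, hω']
    exact hω.2.ne
  have hSX : Measurable fun ω => indicator S (fun _ => (1 : ℝ≥0∞)) (X ω, M ω) :=
    hSm.comp (hX.prodMk hM.measurable)
  rw [h0, lintegral_eq_zero_iff hSX] at key
  filter_upwards [key, hκM] with ω hω hω'
  refine ⟨(hf.comp measurable_prodMk_left).aestronglyMeasurable, ?_⟩
  by_contra hcon
  have hmem : (X ω, M ω) ∈ S := by
    simp only [hSdef, mem_ofPred_eq, hω']
    exact not_lt_top_iff.1 hcon
  simp [indicator_of_mem hmem] at hω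

/-- The weight depends on X only and comes out of the inner integral once X is frozen. It will be a
lifetime indicator or a squared drift. -/
theorem lintegral_mul_compInt_sq_le (hM : IsPoissonRandomMeasure P μ M) (hX : Measurable X)
    (hXM : IndepFun X M P) (hf : Measurable (Function.uncurry f))
    (hfi : ∀ᵐ x ∂(P.map X), Integrable (f x) μ) {w : Ω' → ℝ≥0∞} (hw : Measurable w) :
    ∫⁻ ω, w (X ω) * ‖compInt μ (M ω) (f (X ω))‖ₑ ^ 2 ∂P
      ≤ 4 * ∫⁻ x, w x * ∫⁻ y, ‖f x y‖ₑ ^ 2 ∂μ ∂(P.map X) := by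
  obtain ⟨κ, hκ, hκM⟩ := hM.exists_kernel
  have hm := measurable_compInt (μ := μ) κ hf
  have hE : Measurable fun x => ∫⁻ y, ‖f x y‖ₑ ^ 2 ∂μ :=
    Measurable.lintegral_prod_right (f := fun x y => ‖f x y‖ₑ ^ 2) (hf.enorm.pow_const 2)
  calc _ = ∫⁻ ω, w (X ω) * ‖compInt μ (κ (M ω)) (f (X ω))‖ₑ ^ 2 ∂P := by
        refine lintegral_congr_ae ?_
        filter_upwards [hκM] with ω hω
        rw [hω]
    _ = ∫⁻ x, ∫⁻ ω, w x * ‖compInt μ (κ (M ω)) (f x)‖ₑ ^ 2 ∂P ∂(P.map X) :=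
        IndepFun.lintegral_comp hX hM.measurable hXM
          (Φ := fun p => w p.1 * ‖compInt μ (κ p.2) (f p.1)‖ₑ ^ 2)
          ((hw.comp measurable_fst).mul (hm.enorm.pow_const 2))
    _ ≤ ∫⁻ x, 4 * (w x * ∫⁻ y, ‖f x y‖ₑ ^ 2 ∂μ) ∂(P.map X) := by
        refine lintegral_mono_ae ?_
        filter_upwards [hfi] with x hx
        have hfx : Measurable (f x) := hf.comp measurable_prodMk_left
        have hmx : Measurable fun ω => ‖compInt μ (κ (M ω)) (f x)‖ₑ ^ 2 :=
          (hm.comp (measurable_const.prodMk hM.measurable)).enorm.pow_const 2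
        rw [lintegral_const_mul _ hmx]
        calc _ = w x * ∫⁻ ω, ‖compInt μ (M ω) (f x)‖ₑ ^ 2 ∂P := by
              congr 1
              refine lintegral_congr_ae ?_
              filter_upwards [hκM] with ω hω
              simp [hω]
          _ ≤ w x * (4 * ∫⁻ y, ‖f x y‖ₑ ^ 2 ∂μ) :=
              mul_le_mul' le_rfl (hM.moments_compInt_le hfx hfx hx hx).1
          _ = _ := by ring
    _ = _ := lintegral_const_mul _ (hw.mul hE)

theorem lintegral_compInt_sq_mul_compInt_sq_le (hM : IsPoissonRandomMeasure P μ M)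
    (hX : Measurable X) (hXM : IndepFun X M P) (hf : Measurable (Function.uncurry f))
    (hg : Measurable (Function.uncurry g))
    (hfi : ∀ᵐ x ∂(P.map X), Integrable (f x) μ) (hgi : ∀ᵐ x ∂(P.map X), Integrable (g x) μ) :
    ∫⁻ ω, ‖compInt μ (M ω) (f (X ω))‖ₑ ^ 2 * ‖compInt μ (M ω) (g (X ω))‖ₑ ^ 2 ∂P
      ≤ 48 * ∫⁻ x, (∫⁻ y, ‖f x y‖ₑ ^ 2 * ‖g x y‖ₑ ^ 2 ∂μ
        + (∫⁻ y, ‖f x y‖ₑ ^ 2 ∂μ) * ∫⁻ y, ‖g x y‖ₑ ^ 2 ∂μ) ∂(P.map X) := by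
  obtain ⟨κ, hκ, hκM⟩ := hM.exists_kernel
  have hm := measurable_compInt (μ := μ) κ hf
  have hm' := measurable_compInt (μ := μ) κ hg
  have hE : Measurable fun x => ∫⁻ y, ‖f x y‖ₑ ^ 2 ∂μ :=
    Measurable.lintegral_prod_right (f := fun x y => ‖f x y‖ₑ ^ 2) (hf.enorm.pow_const 2)
  have hE' : Measurable fun x => ∫⁻ y, ‖g x y‖ₑ ^ 2 ∂μ :=
    Measurable.lintegral_prod_right (f := fun x y => ‖g x y‖ₑ ^ 2) (hg.enorm.pow_const 2)
  have hE'' : Measurable fun x => ∫⁻ y, ‖f x y‖ₑ ^ 2 * ‖g x y‖ₑ ^ 2 ∂μ :=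
    Measurable.lintegral_prod_right (f := fun x y => ‖f x y‖ₑ ^ 2 * ‖g x y‖ₑ ^ 2)
      ((hf.enorm.pow_const 2).mul (hg.enorm.pow_const 2))
  calc _ = ∫⁻ ω, ‖compInt μ (κ (M ω)) (f (X ω))‖ₑ ^ 2
          * ‖compInt μ (κ (M ω)) (g (X ω))‖ₑ ^ 2 ∂P := by
        refine lintegral_congr_ae ?_
        filter_upwards [hκM] with ω hω
        rw [hω]
    _ = ∫⁻ x, ∫⁻ ω, ‖compInt μ (κ (M ω)) (f x)‖ₑ ^ 2
          * ‖compInt μ (κ (M ω)) (g x)‖ₑ ^ 2 ∂P ∂(P.map X) :=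
        IndepFun.lintegral_comp hX hM.measurable hXM
          (Φ := fun p => ‖compInt μ (κ p.2) (f p.1)‖ₑ ^ 2 * ‖compInt μ (κ p.2) (g p.1)‖ₑ ^ 2)
          ((hm.enorm.pow_const 2).mul (hm'.enorm.pow_const 2))
    _ ≤ ∫⁻ x, 48 * (∫⁻ y, ‖f x y‖ₑ ^ 2 * ‖g x y‖ₑ ^ 2 ∂μ
        + (∫⁻ y, ‖f x y‖ₑ ^ 2 ∂μ) * ∫⁻ y, ‖g x y‖ₑ ^ 2 ∂μ) ∂(P.map X) := by
        refine lintegral_mono_ae ?_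
        filter_upwards [hfi, hgi] with x hx hx'
        calc _ = ∫⁻ ω, ‖compInt μ (M ω) (f x)‖ₑ ^ 2 * ‖compInt μ (M ω) (g x)‖ₑ ^ 2 ∂P := by
              refine lintegral_congr_ae ?_
              filter_upwards [hκM] with ω hω
              simp [hω]
          _ ≤ _ := (hM.moments_compInt_le (hf.comp measurable_prodMk_left)
              (hg.comp measurable_prodMk_left) hx hx').2
          _ ≤ 48 * (∫⁻ y, ‖f x y‖ₑ ^ 2 * ‖g x y‖ₑ ^ 2 ∂μ)
              + 48 * ((∫⁻ y, ‖f x y‖ₑ ^ 2 ∂μ) * ∫⁻ y, ‖g x y‖ₑ ^ 2 ∂μ) := by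
              rw [mul_add, ← mul_assoc 16 3]
              refine add_le_add (mul_le_mul' (by norm_num) le_rfl) (mul_le_mul' (by norm_num) le_rfl)
          _ = _ := by ring
    _ = _ := lintegral_const_mul _ (hE''.add (hE.mul hE'))

end IsPoissonRandomMeasure

/-! ### Lebesgue measure on the half-line -/

theorem measurableEmbedding_coe : MeasurableEmbedding ((↑) : ℝ≥0 → ℝ) :=
  MeasurableEmbedding.subtype_coe measurableSet_Ici

theorem lebesguePos_apply (B : Set ℝ≥0) : lebesguePos B = volume (((↑) : ℝ≥0 → ℝ) '' B) :=
  measurableEmbedding_coe.comap_apply _ _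

theorem lebesguePos_le_of_forall_mem_Icc {B : Set ℝ≥0} {a b : ℝ}
    (h : ∀ r ∈ B, (r : ℝ) ∈ Icc a b) : lebesguePos B ≤ ENNReal.ofReal (b - a) := by
  rw [lebesguePos_apply, ← Real.volume_Icc]
  exact measure_mono (by rintro _ ⟨r, hr, rfl⟩; exact h r hr)

theorem lebesguePos_Iic (c : ℝ≥0) : lebesguePos (Iic c) = c := by
  rw [lebesguePos_apply]
  have : ((↑) : ℝ≥0 → ℝ) '' Iic c = Icc 0 (c : ℝ) := by
    ext x
    constructor
    · rintro ⟨r, hr, rfl⟩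
      exact ⟨r.2, by exact_mod_cast hr⟩
    · rintro ⟨h0, h1⟩
      exact ⟨⟨x, h0⟩, by exact_mod_cast h1, rfl⟩
  rw [this, Real.volume_Icc, sub_zero, ENNReal.ofReal_coe_nnreal]

instance : SigmaFinite lebesguePos := by
  refine ⟨⟨⟨fun n => Iic (n : ℝ≥0), fun _ => trivial, fun n => ?_, ?_⟩⟩⟩
  · rw [lebesguePos_Iic]
    exact ENNReal.coe_lt_top
  · refine eq_univ_of_forall fun x => mem_iUnion.2 ?_
    exact exists_nat_ge x

theorem lebesguePos_singleton (c : ℝ≥0) : lebesguePos {c} = 0 := by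
  rw [lebesguePos_apply]
  simp

/-! ### Measurability on the path space -/

theorem measurable_path_eval (t : ℝ≥0) : Measurable fun z : Path => z.1 t :=
  (measurable_pi_apply t).comp (comap_measurable _)

/-- By right continuity, the evaluation at t is the limit of evaluations at grid points lying to the
right of t. For each mesh there are only countably many of these. -/
theorem measurable_eval : Measurable fun p : ℝ≥0 × Path => p.2.1 p.1 := by
  let τ : ℕ → ℝ≥0 → ℝ≥0 := fun n t => (⌊(n + 1 : ℝ≥0) * t⌋₊ + 1) / (n + 1)
  have hτ1 : ∀ n t, t ≤ τ n t := by
    intro n t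
    rw [le_div_iff₀ (by positivity), mul_comm]
    exact (Nat.lt_floor_add_one _).le
  have hτ2 : ∀ n t, τ n t ≤ t + 1 / (n + 1) := by
    intro n t
    have h : (⌊(n + 1 : ℝ≥0) * t⌋₊ : ℝ≥0) ≤ (n + 1) * t := Nat.floor_le zero_le
    have h' : (n + 1 : ℝ≥0) ≠ 0 := by positivity
    rw [div_le_iff₀ (by positivity), add_mul t, div_mul_cancel₀ 1 h', mul_comm t]
    gcongr
  have hτ : ∀ t, Tendsto (fun n => τ n t) atTop (𝓝[≥] t) := by
    intro t
    refine tendsto_nhdsWithin_iff.2 ⟨?_, Eventually.of_forall fun n => hτ1 n t⟩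
    refine tendsto_of_tendsto_of_tendsto_of_le_of_le tendsto_const_nhds ?_
      (fun n => hτ1 n t) (fun n => hτ2 n t)
    have h : Tendsto (fun n : ℕ => 1 / ((n : ℝ≥0) + 1)) atTop (𝓝 0) :=
      tendsto_one_div_add_atTop_nhds_zero_nat
    simpa using h.const_add t
  refine measurable_of_tendsto_metrizable (f := fun n (p : ℝ≥0 × Path) => p.2.1 (τ n p.1)) ?_
    (tendsto_pi_nhds.2 fun p => ((p.2.2 p.1).1.tendsto.comp (hτ p.1)))
  intro n
  have h1 : Measurable fun q : ℕ × Path => q.2.1 ((q.1 + 1) / (n + 1)) :=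
    measurable_from_prod_countable_right fun k =>
      measurable_path_eval (((k : ℝ≥0) + 1) / (n + 1))
  have h2 : Measurable fun p : ℝ≥0 × Path => (⌊(n + 1 : ℝ≥0) * p.1⌋₊, p.2) :=
    (Nat.measurable_floor.comp (measurable_fst.const_mul _)).prodMk measurable_snd
  exact h1.comp h2

/-- The value at time `t - r` of a path started at time `r`, zero before its start. -/
def shiftEval (t r : ℝ≥0) (z : Path) : ℝ := if r ≤ t then z.1 (t - r) else 0

theorem measurable_shiftEval (t : ℝ≥0) : Measurable (Function.uncurry (shiftEval t)) := by
  refine Measurable.ite (measurableSet_le measurable_fst measurable_const) ?_ measurable_const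
  exact measurable_eval.comp ((measurable_const.sub measurable_fst).prodMk measurable_snd)

/-! ### Sums over the children of a birth event -/

/-- The function `(r, u, ℓ, z) ↦ 1_{u ≤ β(r)} ∑_{i < ℓ} φ(r, z_i)`. -/
def markSum (β : ℝ≥0 → ℝ≥0) (φ : ℝ≥0 → Path → ℝ) (x : Point) : ℝ :=
  if x.2.1 ≤ β x.1 then ∑ i ∈ Finset.range x.2.2.1, φ x.1 (x.2.2.2 i) else 0

theorem birthIntegrand_eq_markSum (β : ℝ≥0 → ℝ≥0) (t : ℝ≥0) :
    birthIntegrand β t = markSum β (shiftEval t) := by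
  funext x
  by_cases h1 : x.1 ≤ t <;> by_cases h2 : x.2.1 ≤ β x.1 <;>
    simp [birthIntegrand, markSum, shiftEval, h1, h2]

theorem markSum_sub (β : ℝ≥0 → ℝ≥0) (φ ψ : ℝ≥0 → Path → ℝ) (x : Point) :
    markSum β (φ - ψ) x = markSum β φ x - markSum β ψ x := by
  by_cases h : x.2.1 ≤ β x.1 <;> simp [markSum, h]

theorem measurable_sum_range_mark {φ : ℝ≥0 → Path → ℝ} (hφ : Measurable (Function.uncurry φ)) :
    Measurable fun q : ℝ≥0 × Mark => ∑ i ∈ Finset.range q.2.1, φ q.1 (q.2.2 i) := by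
  have h : Measurable fun q : ℕ × (ℝ≥0 × (ℕ → Path)) =>
      ∑ i ∈ Finset.range q.1, φ q.2.1 (q.2.2 i) := by
    refine measurable_from_prod_countable_right fun k => ?_
    have : ∀ i : ℕ, Measurable fun q : ℝ≥0 × (ℕ → Path) => φ q.1 (q.2 i) := fun i =>
      hφ.comp (measurable_fst.prodMk ((measurable_pi_apply i).comp measurable_snd))
    exact Finset.measurable_fun_sum (Finset.range k) fun i _ => this i
  exact h.comp (measurable_snd.fst.prodMk (measurable_fst.prodMk measurable_snd.snd))

theorem measurable_markSum {Ω' : Type*} [MeasurableSpace Ω'] {β : Ω' → ℝ≥0 → ℝ≥0}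
    (hβ : Measurable (Function.uncurry β)) {φ : ℝ≥0 → Path → ℝ}
    (hφ : Measurable (Function.uncurry φ)) :
    Measurable (Function.uncurry fun ω => markSum (β ω) φ) := by
  refine Measurable.ite ?_ ?_ measurable_const
  · exact measurableSet_le measurable_snd.snd.fst
      (hβ.comp (measurable_fst.prodMk measurable_snd.fst))
  · exact (measurable_sum_range_mark hφ).comp
      (measurable_snd.fst.prodMk measurable_snd.snd.snd)

theorem enorm_sum_sq_le {ι : Type*} (s : Finset ι) (f : ι → ℝ) :
    ‖∑ i ∈ s, f i‖ₑ ^ 2 ≤ (s.card : ℝ≥0∞) * ∑ i ∈ s, ‖f i‖ₑ ^ 2 := by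
  simp only [enorm_sq_eq_ofReal]
  rw [← ENNReal.ofReal_natCast, ← ENNReal.ofReal_sum_of_nonneg (fun i _ => sq_nonneg _),
    ← ENNReal.ofReal_mul (by positivity)]
  exact ENNReal.ofReal_le_ofReal sq_sum_le_card_mul_sum_sq

/-! ### Moments of sums over independent, identically distributed subpopulations -/

section Mark

variable {π : Measure Path} [IsProbabilityMeasure π]

theorem lintegral_infinitePi_eval {h : Path → ℝ≥0∞} (hh : Measurable h) (i : ℕ) :
    ∫⁻ z, h (z i) ∂(Measure.infinitePi fun _ : ℕ => π) = ∫⁻ z, h z ∂π :=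
  (measurePreserving_eval_infinitePi (fun _ : ℕ => π) i).lintegral_comp hh

/-- The first term is the diagonal case and the second is the independent case. Their sum covers
both without distinguishing indices later. -/
theorem lintegral_infinitePi_mul_le {g h : Path → ℝ≥0∞} (hg : Measurable g) (hh : Measurable h)
    (i j : ℕ) :
    ∫⁻ z, g (z i) * h (z j) ∂(Measure.infinitePi fun _ : ℕ => π)
      ≤ ∫⁻ z, g z * h z ∂π + (∫⁻ z, g z ∂π) * ∫⁻ z, h z ∂π := by
  rcases eq_or_ne i j with rfl | hij
  · exact (lintegral_infinitePi_eval (hg.mul hh) i).le.trans le_self_add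
  · have hind := (iIndepFun_infinitePi (P := fun _ : ℕ => π) (X := fun _ z => z)
      (fun _ => measurable_id)).indepFun hij
    have hind' := hind.comp hg hh
    have := lintegral_mul_eq_lintegral_mul_lintegral_of_indepFun
      (hg.comp (measurable_pi_apply i)) (hh.comp (measurable_pi_apply j)) hind'
    simp only [Pi.mul_apply, Function.comp_apply] at this
    rw [this, lintegral_infinitePi_eval hg, lintegral_infinitePi_eval hh]
    exact le_add_self

/-- The factor l would suffice here, and l² in the quadratic analogue. The fourth power is used
throughout so that E[L⁴] is the only constant attached to the offspring law. -/
theorem lintegral_enorm_sum_le {φ : Path → ℝ} (hφ : Measurable φ) (l : ℕ) :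
    ∫⁻ z, ‖∑ i ∈ Finset.range l, φ (z i)‖ₑ ∂(Measure.infinitePi fun _ : ℕ => π)
      ≤ (l : ℝ≥0∞) ^ 4 * ∫⁻ z, ‖φ z‖ₑ ∂π := by
  calc _ ≤ ∫⁻ z, ∑ i ∈ Finset.range l, ‖φ (z i)‖ₑ ∂(Measure.infinitePi fun _ : ℕ => π) :=
        lintegral_mono fun z => enorm_sum_le _ _
    _ = (l : ℝ≥0∞) * ∫⁻ z, ‖φ z‖ₑ ∂π := by
        have hm : ∀ i : ℕ, Measurable fun z : ℕ → Path => ‖φ (z i)‖ₑ :=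
          fun i => hφ.enorm.comp (measurable_pi_apply i)
        rw [lintegral_finsetSum _ fun i _ => hm i]
        simp [lintegral_infinitePi_eval hφ.enorm]
    _ ≤ _ := by
        gcongr
        exact_mod_cast Nat.le_self_pow (by norm_num) l

theorem lintegral_enorm_sum_sq_le {φ : Path → ℝ} (hφ : Measurable φ) (l : ℕ) :
    ∫⁻ z, ‖∑ i ∈ Finset.range l, φ (z i)‖ₑ ^ 2 ∂(Measure.infinitePi fun _ : ℕ => π)
      ≤ (l : ℝ≥0∞) ^ 4 * ∫⁻ z, ‖φ z‖ₑ ^ 2 ∂π := by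
  have hφ2 := hφ.enorm.pow_const 2
  calc _ ≤ ∫⁻ z, l * ∑ i ∈ Finset.range l, ‖φ (z i)‖ₑ ^ 2
          ∂(Measure.infinitePi fun _ : ℕ => π) :=
        lintegral_mono fun z => by simpa using enorm_sum_sq_le (Finset.range l) fun i => φ (z i)
    _ = (l : ℝ≥0∞) ^ 2 * ∫⁻ z, ‖φ z‖ₑ ^ 2 ∂π := by
        have hm : ∀ i : ℕ, Measurable fun z : ℕ → Path => ‖φ (z i)‖ₑ ^ 2 :=
          fun i => hφ2.comp (measurable_pi_apply i)
        rw [lintegral_const_mul' _ _ (by simp), lintegral_finsetSum _ fun i _ => hm i]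
        simp [lintegral_infinitePi_eval hφ2]
        ring
    _ ≤ _ := by
        rcases l.eq_zero_or_pos with rfl | hl
        · simp
        gcongr
        · exact_mod_cast hl
        · norm_num

theorem lintegral_enorm_sum_sq_mul_sq_le {φ ψ : Path → ℝ} (hφ : Measurable φ)
    (hψ : Measurable ψ) (l : ℕ) :
    ∫⁻ z, ‖∑ i ∈ Finset.range l, φ (z i)‖ₑ ^ 2 * ‖∑ i ∈ Finset.range l, ψ (z i)‖ₑ ^ 2
        ∂(Measure.infinitePi fun _ : ℕ => π)
      ≤ (l : ℝ≥0∞) ^ 4 * (∫⁻ z, ‖φ z‖ₑ ^ 2 * ‖ψ z‖ₑ ^ 2 ∂π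
        + (∫⁻ z, ‖φ z‖ₑ ^ 2 ∂π) * ∫⁻ z, ‖ψ z‖ₑ ^ 2 ∂π) := by
  have hφ2 := hφ.enorm.pow_const 2
  have hψ2 := hψ.enorm.pow_const 2
  calc _ ≤ ∫⁻ z, (l : ℝ≥0∞) ^ 2 * ∑ i ∈ Finset.range l, ∑ j ∈ Finset.range l,
          ‖φ (z i)‖ₑ ^ 2 * ‖ψ (z j)‖ₑ ^ 2 ∂(Measure.infinitePi fun _ : ℕ => π) := by
        refine lintegral_mono fun z => ?_
        calc _ ≤ ((l : ℝ≥0∞) * ∑ i ∈ Finset.range l, ‖φ (z i)‖ₑ ^ 2) *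
              ((l : ℝ≥0∞) * ∑ i ∈ Finset.range l, ‖ψ (z i)‖ₑ ^ 2) := by
              refine mul_le_mul' ?_ ?_
              · simpa using enorm_sum_sq_le (Finset.range l) fun i => φ (z i)
              · simpa using enorm_sum_sq_le (Finset.range l) fun i => ψ (z i)
          _ = _ := by
              rw [mul_mul_mul_comm, Finset.sum_mul_sum]
              ring
    _ = (l : ℝ≥0∞) ^ 2 * ∑ i ∈ Finset.range l, ∑ j ∈ Finset.range l,
          ∫⁻ z, ‖φ (z i)‖ₑ ^ 2 * ‖ψ (z j)‖ₑ ^ 2 ∂(Measure.infinitePi fun _ : ℕ => π) := by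
        have hm : ∀ i j : ℕ, Measurable fun z : ℕ → Path => ‖φ (z i)‖ₑ ^ 2 * ‖ψ (z j)‖ₑ ^ 2 :=
          fun i j => (hφ2.comp (measurable_pi_apply i)).mul (hψ2.comp (measurable_pi_apply j))
        rw [lintegral_const_mul' _ _ (by simp), lintegral_finsetSum _ fun i _ =>
          Finset.measurable_fun_sum _ fun j _ => hm i j]
        congr 1
        exact Finset.sum_congr rfl fun i _ => lintegral_finsetSum _ fun j _ => hm i j
    _ ≤ (l : ℝ≥0∞) ^ 2 * ∑ i ∈ Finset.range l, ∑ j ∈ Finset.range l,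
          (∫⁻ z, ‖φ z‖ₑ ^ 2 * ‖ψ z‖ₑ ^ 2 ∂π
            + (∫⁻ z, ‖φ z‖ₑ ^ 2 ∂π) * ∫⁻ z, ‖ψ z‖ₑ ^ 2 ∂π) := by
        gcongr with i _ j _
        exact lintegral_infinitePi_mul_le hφ2 hψ2 i j
    _ = _ := by
        simp only [Finset.sum_const, Finset.card_range, nsmul_eq_mul]
        ring

variable {ν : Measure ℕ}

theorem lintegral_markLaw_le {h : Mark → ℝ≥0∞} (hh : Measurable h) {c : ℝ≥0∞}
    (hc : ∀ l : ℕ, ∫⁻ z, h (l, z) ∂(Measure.infinitePi fun _ : ℕ => π) ≤ (l : ℝ≥0∞) ^ 4 * c) :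
    ∫⁻ y, h y ∂(markLaw ν π) ≤ (∫⁻ l, (l : ℝ≥0∞) ^ 4 ∂ν) * c := by
  rw [markLaw, lintegral_prod _ hh.aemeasurable, ← lintegral_mul_const _ (by fun_prop)]
  exact lintegral_mono hc

variable [IsProbabilityMeasure ν]

instance : IsProbabilityMeasure (markLaw ν π) := by unfold markLaw; infer_instance

instance : SigmaFinite (meanMeasure ν π) := by unfold meanMeasure; infer_instance

/-- Integrating out u, which ranges over [0, β(r)], leaves the weight β(r). -/
theorem lintegral_meanMeasure_ite {β : ℝ≥0 → ℝ≥0} (hβ : Measurable β)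
    {h : ℝ≥0 × Mark → ℝ≥0∞} (hh : Measurable h) :
    ∫⁻ x : Point, (if x.2.1 ≤ β x.1 then h (x.1, x.2.2) else 0) ∂(meanMeasure ν π)
      = ∫⁻ r, β r * ∫⁻ y, h (r, y) ∂(markLaw ν π) ∂lebesguePos := by
  have hm : Measurable fun x : Point => if x.2.1 ≤ β x.1 then h (x.1, x.2.2) else 0 :=
    Measurable.ite (measurableSet_le measurable_snd.fst (hβ.comp measurable_fst))
      (hh.comp (measurable_fst.prodMk measurable_snd.snd)) measurable_const
  rw [meanMeasure, lintegral_prod _ hm.aemeasurable]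
  refine lintegral_congr fun r => ?_
  have hmr : Measurable fun y : ℝ≥0 × Mark => if y.1 ≤ β r then h (r, y.2) else 0 :=
    hm.comp measurable_prodMk_left
  rw [lintegral_prod _ hmr.aemeasurable]
  calc _ = ∫⁻ u, (Iic (β r)).indicator (fun _ => ∫⁻ y, h (r, y) ∂(markLaw ν π)) u
          ∂lebesguePos := by
        refine lintegral_congr fun u => ?_
        by_cases hu : u ≤ β r <;> simp [hu]
    _ = _ := by
        rw [lintegral_indicator_const measurableSet_Iic, lebesguePos_Iic, mul_comm]

variable {β : ℝ≥0 → ℝ≥0} {φ ψ : ℝ≥0 → Path → ℝ}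

theorem lintegral_enorm_markSum_le (hβ : Measurable β) (hφ : Measurable (Function.uncurry φ)) :
    ∫⁻ x, ‖markSum β φ x‖ₑ ∂(meanMeasure ν π)
      ≤ (∫⁻ l, (l : ℝ≥0∞) ^ 4 ∂ν) * ∫⁻ r, β r * ∫⁻ z, ‖φ r z‖ₑ ∂π ∂lebesguePos := by
  have hm := measurable_sum_range_mark hφ
  have hE : Measurable fun r => ∫⁻ z, ‖φ r z‖ₑ ∂π :=
    Measurable.lintegral_prod_right (f := fun r z => ‖φ r z‖ₑ) hφ.enorm
  calc _ = ∫⁻ x : Point, (if x.2.1 ≤ β x.1 then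
          ‖∑ i ∈ Finset.range x.2.2.1, φ x.1 (x.2.2.2 i)‖ₑ else 0) ∂(meanMeasure ν π) := by
        refine lintegral_congr fun x => ?_
        by_cases h : x.2.1 ≤ β x.1 <;> simp [markSum, h]
    _ ≤ ∫⁻ r, (∫⁻ l, (l : ℝ≥0∞) ^ 4 ∂ν) * (β r * ∫⁻ z, ‖φ r z‖ₑ ∂π) ∂lebesguePos := by
        rw [lintegral_meanMeasure_ite hβ hm.enorm]
        refine lintegral_mono fun r => ?_
        rw [mul_left_comm]
        refine mul_le_mul' le_rfl (lintegral_markLaw_le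
          (hm.enorm.comp measurable_prodMk_left) fun l => ?_)
        exact lintegral_enorm_sum_le (hφ.comp measurable_prodMk_left) l
    _ = _ := lintegral_const_mul _ (by fun_prop)

theorem lintegral_enorm_markSum_sq_le (hβ : Measurable β)
    (hφ : Measurable (Function.uncurry φ)) :
    ∫⁻ x, ‖markSum β φ x‖ₑ ^ 2 ∂(meanMeasure ν π)
      ≤ (∫⁻ l, (l : ℝ≥0∞) ^ 4 ∂ν) * ∫⁻ r, β r * ∫⁻ z, ‖φ r z‖ₑ ^ 2 ∂π ∂lebesguePos := by
  have hm := measurable_sum_range_mark hφ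
  have hE : Measurable fun r => ∫⁻ z, ‖φ r z‖ₑ ^ 2 ∂π :=
    Measurable.lintegral_prod_right (f := fun r z => ‖φ r z‖ₑ ^ 2) (hφ.enorm.pow_const 2)
  calc _ = ∫⁻ x : Point, (if x.2.1 ≤ β x.1 then
          ‖∑ i ∈ Finset.range x.2.2.1, φ x.1 (x.2.2.2 i)‖ₑ ^ 2 else 0) ∂(meanMeasure ν π) := by
        refine lintegral_congr fun x => ?_
        by_cases h : x.2.1 ≤ β x.1 <;> simp [markSum, h]
    _ ≤ ∫⁻ r, (∫⁻ l, (l : ℝ≥0∞) ^ 4 ∂ν) * (β r * ∫⁻ z, ‖φ r z‖ₑ ^ 2 ∂π) ∂lebesguePos := by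
        rw [lintegral_meanMeasure_ite hβ (hm.enorm.pow_const 2)]
        refine lintegral_mono fun r => ?_
        rw [mul_left_comm]
        refine mul_le_mul' le_rfl (lintegral_markLaw_le
          ((hm.enorm.pow_const 2).comp measurable_prodMk_left) fun l => ?_)
        exact lintegral_enorm_sum_sq_le (hφ.comp measurable_prodMk_left) l
    _ = _ := lintegral_const_mul _ (by fun_prop)

theorem lintegral_enorm_markSum_sq_mul_sq_le (hβ : Measurable β)
    (hφ : Measurable (Function.uncurry φ)) (hψ : Measurable (Function.uncurry ψ)) :
    ∫⁻ x, ‖markSum β φ x‖ₑ ^ 2 * ‖markSum β ψ x‖ₑ ^ 2 ∂(meanMeasure ν π)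
      ≤ (∫⁻ l, (l : ℝ≥0∞) ^ 4 ∂ν) * ∫⁻ r, β r * (∫⁻ z, ‖φ r z‖ₑ ^ 2 * ‖ψ r z‖ₑ ^ 2 ∂π
        + (∫⁻ z, ‖φ r z‖ₑ ^ 2 ∂π) * ∫⁻ z, ‖ψ r z‖ₑ ^ 2 ∂π) ∂lebesguePos := by
  have hm := (measurable_sum_range_mark hφ).enorm.pow_const 2
  have hm' := (measurable_sum_range_mark hψ).enorm.pow_const 2
  have hE : Measurable fun r => ∫⁻ z, ‖φ r z‖ₑ ^ 2 ∂π :=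
    Measurable.lintegral_prod_right (f := fun r z => ‖φ r z‖ₑ ^ 2) (hφ.enorm.pow_const 2)
  have hE' : Measurable fun r => ∫⁻ z, ‖ψ r z‖ₑ ^ 2 ∂π :=
    Measurable.lintegral_prod_right (f := fun r z => ‖ψ r z‖ₑ ^ 2) (hψ.enorm.pow_const 2)
  have hE'' : Measurable fun r => ∫⁻ z, ‖φ r z‖ₑ ^ 2 * ‖ψ r z‖ₑ ^ 2 ∂π :=
    Measurable.lintegral_prod_right (f := fun r z => ‖φ r z‖ₑ ^ 2 * ‖ψ r z‖ₑ ^ 2)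
      ((hφ.enorm.pow_const 2).mul (hψ.enorm.pow_const 2))
  calc _ = ∫⁻ x : Point, (if x.2.1 ≤ β x.1 then
          (fun q : ℝ≥0 × Mark => ‖∑ i ∈ Finset.range q.2.1, φ q.1 (q.2.2 i)‖ₑ ^ 2 *
            ‖∑ i ∈ Finset.range q.2.1, ψ q.1 (q.2.2 i)‖ₑ ^ 2) (x.1, x.2.2) else 0)
          ∂(meanMeasure ν π) := by
        refine lintegral_congr fun x => ?_
        by_cases h : x.2.1 ≤ β x.1 <;> simp [markSum, h]
    _ ≤ ∫⁻ r, (∫⁻ l, (l : ℝ≥0∞) ^ 4 ∂ν) * (β r * (∫⁻ z, ‖φ r z‖ₑ ^ 2 * ‖ψ r z‖ₑ ^ 2 ∂π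
        + (∫⁻ z, ‖φ r z‖ₑ ^ 2 ∂π) * ∫⁻ z, ‖ψ r z‖ₑ ^ 2 ∂π)) ∂lebesguePos := by
        rw [lintegral_meanMeasure_ite hβ (h := fun q : ℝ≥0 × Mark =>
          ‖∑ i ∈ Finset.range q.2.1, φ q.1 (q.2.2 i)‖ₑ ^ 2 *
            ‖∑ i ∈ Finset.range q.2.1, ψ q.1 (q.2.2 i)‖ₑ ^ 2) (hm.mul hm')]
        refine lintegral_mono fun r => ?_
        rw [mul_left_comm]
        refine mul_le_mul' le_rfl (lintegral_markLaw_le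
          ((hm.mul hm').comp measurable_prodMk_left) fun l => ?_)
        exact lintegral_enorm_sum_sq_mul_sq_le (hφ.comp measurable_prodMk_left)
          (hψ.comp measurable_prodMk_left) l
    _ = _ := lintegral_const_mul _ (by fun_prop)

end Mark

/-! ### Moment bounds for the integrals driven by a random birth rate -/

theorem sq_lintegral_mul_le {α : Type*} [MeasurableSpace α] (m : Measure α) {f g : α → ℝ≥0∞}
    (hf : AEMeasurable f m) (hg : AEMeasurable g m) :
    (∫⁻ x, f x * g x ∂m) ^ 2 ≤ (∫⁻ x, f x ^ 2 ∂m) * ∫⁻ x, g x ^ 2 ∂m := by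
  have h := ENNReal.lintegral_mul_le_Lp_mul_Lq m Real.HolderConjugate.two_two hf hg
  simp only [Pi.mul_apply, ENNReal.rpow_two] at h
  calc _ ≤ ((∫⁻ x, f x ^ 2 ∂m) ^ (1 / 2 : ℝ) * (∫⁻ x, g x ^ 2 ∂m) ^ (1 / 2 : ℝ)) ^ 2 := by gcongr
    _ = _ := by
      rw [mul_pow, ← ENNReal.rpow_two, ← ENNReal.rpow_two, ← ENNReal.rpow_mul,
        ← ENNReal.rpow_mul]
      norm_num

theorem lintegral_mul_le_sqrt {α : Type*} [MeasurableSpace α] (m : Measure α) {f g : α → ℝ≥0∞}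
    (hf : AEMeasurable f m) (hg : AEMeasurable g m) :
    ∫⁻ x, f x * g x ∂m ≤ ((∫⁻ x, f x ^ 2 ∂m) * ∫⁻ x, g x ^ 2 ∂m) ^ (1 / 2 : ℝ) := by
  rw [one_div, ENNReal.le_rpow_inv_iff (by norm_num), ENNReal.rpow_two]
  exact sq_lintegral_mul_le m hf hg

theorem lintegral_const_mul_mul {α : Type*} [MeasurableSpace α] (m : Measure α)
    {f g : α → ℝ≥0∞} (hf : Measurable f) (hg : Measurable g) (c : ℝ≥0∞) :
    ∫⁻ x, c * (f x * g x) ∂m = c * ∫⁻ x, f x * g x ∂m :=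
  lintegral_const_mul c (hf.mul hg)

theorem enorm_add_sq_le (a b : ℝ) : ‖a + b‖ₑ ^ 2 ≤ 2 * (‖a‖ₑ ^ 2 + ‖b‖ₑ ^ 2) := by
  simp only [enorm_sq_eq_ofReal]
  rw [← ENNReal.ofReal_add (sq_nonneg _) (sq_nonneg _), show (2 : ℝ≥0∞) = ENNReal.ofReal 2 by simp,
    ← ENNReal.ofReal_mul (by norm_num)]
  exact ENNReal.ofReal_le_ofReal (by nlinarith [sq_nonneg (a - b)])

/-- The squared size of the integral of `f` with respect to `m - μ` plus that of its integral
with respect to `μ`. -/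
def splitSq {E : Type*} [MeasurableSpace E] (μ m : Measure E) (f : E → ℝ) : ℝ≥0∞ :=
  ‖compInt μ m f‖ₑ ^ 2 + ‖∫ x, f x ∂μ‖ₑ ^ 2

theorem enorm_compInt_sq_le_splitSq {E : Type*} [MeasurableSpace E] (μ m : Measure E)
    (f : E → ℝ) : ‖compInt μ m f‖ₑ ^ 2 ≤ splitSq μ m f := le_self_add

theorem enorm_integral_sq_le_splitSq {E : Type*} [MeasurableSpace E] (μ m : Measure E)
    (f : E → ℝ) : ‖∫ x, f x ∂m‖ₑ ^ 2 ≤ 2 * splitSq μ m f := by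
  have h := enorm_add_sq_le (compInt μ m f) (∫ x, f x ∂μ)
  rwa [compInt, sub_add_cancel] at h

/-- The second moment at time `r` of the functional `φ` of a path. -/
def sqMoment (π : Measure Path) (φ : ℝ≥0 → Path → ℝ) (r : ℝ≥0) : ℝ≥0∞ :=
  ∫⁻ z, ‖φ r z‖ₑ ^ 2 ∂π

/-- The mixed moment at time `r` of the functionals `φ` and `ψ` of a path. -/
def mixedMoment (π : Measure Path) (φ ψ : ℝ≥0 → Path → ℝ) (r : ℝ≥0) : ℝ≥0∞ :=
  ∫⁻ z, ‖φ r z‖ₑ ^ 2 * ‖ψ r z‖ₑ ^ 2 ∂π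

/-- The measurable functionals of a path that vanish after time `T` and have a second moment that
is integrable in time. -/
structure IsAdmissible (π : Measure Path) (T : ℝ≥0) (φ : ℝ≥0 → Path → ℝ) : Prop where
  measurable : Measurable (Function.uncurry φ)
  eq_zero : ∀ r, T < r → ∀ z, φ r z = 0
  finite : ∫⁻ r, sqMoment π φ r ∂lebesguePos ≠ ∞

/-- The moment bounds, with constant `C`, for the integrals over the birth events. -/
structure HasMomentBounds {Ω Ω' : Type*} [MeasurableSpace Ω] [MeasurableSpace Ω'] (P : Measure Ω)
    (μ : Measure Point) (π : Measure Path) (X : Ω → Ω') (β : Ω' → ℝ≥0 → ℝ≥0)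
    (M : Ω → Measure Point) (T C : ℝ≥0) : Prop where
  ae_integrable : ∀ φ, IsAdmissible π T φ → ∀ᵐ ω ∂P,
    Integrable (markSum (β (X ω)) φ) (M ω) ∧ Integrable (markSum (β (X ω)) φ) μ
  aemeasurable_compInt : ∀ φ, IsAdmissible π T φ →
    AEMeasurable (fun ω => compInt μ (M ω) (markSum (β (X ω)) φ)) P
  aemeasurable_splitSq : ∀ φ, IsAdmissible π T φ →
    AEMeasurable (fun ω => splitSq μ (M ω) (markSum (β (X ω)) φ)) P
  splitSq_le : ∀ φ, IsAdmissible π T φ → ∀ G : Set Ω', MeasurableSet G →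
    ∫⁻ ω, G.indicator 1 (X ω) * splitSq μ (M ω) (markSum (β (X ω)) φ) ∂P
      ≤ C * (P.map X G) ^ (1 / 2 : ℝ) * ∫⁻ r, sqMoment π φ r ∂lebesguePos
  splitSq_mul_le : ∀ φ ψ, IsAdmissible π T φ → IsAdmissible π T ψ →
    ∫⁻ ω, splitSq μ (M ω) (markSum (β (X ω)) φ) * splitSq μ (M ω) (markSum (β (X ω)) ψ) ∂P
      ≤ C * (∫⁻ r, mixedMoment π φ ψ r ∂lebesguePos
        + ∫⁻ r, sqMoment π φ r * sqMoment π ψ r ∂lebesguePos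
        + (∫⁻ r, sqMoment π φ r ∂lebesguePos) * ∫⁻ r, sqMoment π ψ r ∂lebesguePos)

/-! ### Averaging over the law of the birth rate -/

section

variable {π : Measure Path} [IsProbabilityMeasure π] {φ ψ : ℝ≥0 → Path → ℝ}

theorem measurable_sqMoment (hφ : Measurable (Function.uncurry φ)) :
    Measurable (sqMoment π φ) :=
  Measurable.lintegral_prod_right (f := fun r z => ‖φ r z‖ₑ ^ 2) (hφ.enorm.pow_const 2)

theorem measurable_mixedMoment (hφ : Measurable (Function.uncurry φ))
    (hψ : Measurable (Function.uncurry ψ)) : Measurable (mixedMoment π φ ψ) :=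
  Measurable.lintegral_prod_right (f := fun r z => ‖φ r z‖ₑ ^ 2 * ‖ψ r z‖ₑ ^ 2)
    ((hφ.enorm.pow_const 2).mul (hψ.enorm.pow_const 2))

/-- The integral of the second moments against `β + β²`. -/
def weightedSq {Ω' : Type*} (π : Measure Path) (β : Ω' → ℝ≥0 → ℝ≥0) (φ : ℝ≥0 → Path → ℝ)
    (x : Ω') : ℝ≥0∞ :=
  ∫⁻ r, ((β x r : ℝ≥0∞) + (β x r : ℝ≥0∞) ^ 2) * sqMoment π φ r ∂lebesguePos

variable {Ω' : Type*} [MeasurableSpace Ω'] {β : Ω' → ℝ≥0 → ℝ≥0} {ρ : Measure Ω'}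
  [IsProbabilityMeasure ρ] {T B : ℝ≥0}

theorem measurable_weight (hβ : Measurable (Function.uncurry β)) :
    Measurable (Function.uncurry fun x r => (β x r : ℝ≥0∞) + (β x r : ℝ≥0∞) ^ 2) := by
  have : Measurable fun p : Ω' × ℝ≥0 => (β p.1 p.2 : ℝ≥0∞) := hβ.coe_nnreal_ennreal
  exact this.add (this.pow_const 2)

theorem measurable_weightedSq (hβ : Measurable (Function.uncurry β))
    (hφ : Measurable (Function.uncurry φ)) : Measurable (weightedSq π β φ) :=
  Measurable.lintegral_prod_right
    (f := fun x r => ((β x r : ℝ≥0∞) + (β x r : ℝ≥0∞) ^ 2) * sqMoment π φ r)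
    ((measurable_weight hβ).mul ((measurable_sqMoment hφ).comp measurable_snd))

theorem lintegral_mul_weightedSq (hβ : Measurable (Function.uncurry β))
    (hφ : Measurable (Function.uncurry φ)) {g : Ω' → ℝ≥0∞} (hg : Measurable g) :
    ∫⁻ x, g x * weightedSq π β φ x ∂ρ = ∫⁻ r, sqMoment π φ r *
      ∫⁻ x, g x * ((β x r : ℝ≥0∞) + (β x r : ℝ≥0∞) ^ 2) ∂ρ ∂lebesguePos := by
  have hw := measurable_weight hβ
  have hs := measurable_sqMoment (π := π) hφ
  have hwx : ∀ x, Measurable fun r => (β x r : ℝ≥0∞) + (β x r : ℝ≥0∞) ^ 2 :=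
    fun x => hw.comp measurable_prodMk_left
  have hwr : ∀ r, Measurable fun x => (β x r : ℝ≥0∞) + (β x r : ℝ≥0∞) ^ 2 :=
    fun r => hw.comp measurable_prodMk_right
  calc _ = ∫⁻ x, ∫⁻ r, g x * (((β x r : ℝ≥0∞) + (β x r : ℝ≥0∞) ^ 2) * sqMoment π φ r)
          ∂lebesguePos ∂ρ := by
        refine lintegral_congr fun x => ?_
        rw [weightedSq, lintegral_const_mul_mul _ (hwx x) hs]
    _ = ∫⁻ r, ∫⁻ x, g x * (((β x r : ℝ≥0∞) + (β x r : ℝ≥0∞) ^ 2) * sqMoment π φ r)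
          ∂ρ ∂lebesguePos := by
        refine lintegral_lintegral_swap (Measurable.aemeasurable ?_)
        exact (hg.comp measurable_fst).mul (hw.mul (hs.comp measurable_snd))
    _ = _ := by
        refine lintegral_congr fun r => ?_
        rw [← lintegral_const_mul_mul _ hg (hwr r)]
        refine lintegral_congr fun x => ?_
        ring

/-- After Fubini, Cauchy–Schwarz at each time separates the event from the weight β + β². Since β
and the lifetime may be dependent, this costs a square root of the probability, and it requires the
fourth moment of β. -/
theorem lintegral_indicator_mul_weightedSq_le (hβ : Measurable (Function.uncurry β))
    (hφ : IsAdmissible π T φ)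
    (hB : ∀ᵐ r ∂lebesguePos, r ≤ T →
      ∫⁻ x, ((β x r : ℝ≥0∞) + (β x r : ℝ≥0∞) ^ 2) ^ 2 ∂ρ ≤ B) {G : Set Ω'}
    (hG : MeasurableSet G) :
    ∫⁻ x, G.indicator 1 x * weightedSq π β φ x ∂ρ
      ≤ (B : ℝ≥0∞) ^ (1 / 2 : ℝ) * ρ G ^ (1 / 2 : ℝ) * ∫⁻ r, sqMoment π φ r ∂lebesguePos := by
  have hG1 : Measurable (G.indicator (1 : Ω' → ℝ≥0∞)) := measurable_one.indicator hG
  rw [lintegral_mul_weightedSq hβ hφ.measurable hG1,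
    ← lintegral_const_mul _ (measurable_sqMoment hφ.measurable)]
  refine lintegral_mono_ae ?_
  filter_upwards [hB] with r hr
  rcases le_or_gt r T with hrT | hrT
  · rw [mul_comm (sqMoment π φ r)]
    refine mul_le_mul' ?_ le_rfl
    have hw : Measurable fun x => (β x r : ℝ≥0∞) + (β x r : ℝ≥0∞) ^ 2 :=
      (measurable_weight hβ).comp measurable_prodMk_right
    calc _ ≤ ((∫⁻ x, G.indicator 1 x ^ 2 ∂ρ) *
          ∫⁻ x, ((β x r : ℝ≥0∞) + (β x r : ℝ≥0∞) ^ 2) ^ 2 ∂ρ) ^ (1 / 2 : ℝ) :=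
          lintegral_mul_le_sqrt ρ hG1.aemeasurable hw.aemeasurable
      _ ≤ (ρ G * B) ^ (1 / 2 : ℝ) := by
          gcongr
          · refine le_of_eq ?_
            rw [← lintegral_indicator_one hG]
            refine lintegral_congr fun x => ?_
            by_cases hx : x ∈ G <;> simp [hx]
          · exact hr hrT
      _ = _ := by rw [ENNReal.mul_rpow_of_nonneg _ _ (by norm_num), mul_comm]
  · simp [sqMoment, hφ.eq_zero r hrT]

/-- Fubini in both time variables; by Cauchy–Schwarz, the expected product of the weights at two
times is at most `B`. -/
theorem lintegral_weightedSq_mul_le (hβ : Measurable (Function.uncurry β))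
    (hφ : IsAdmissible π T φ) (hψ : IsAdmissible π T ψ)
    (hB : ∀ᵐ r ∂lebesguePos, r ≤ T →
      ∫⁻ x, ((β x r : ℝ≥0∞) + (β x r : ℝ≥0∞) ^ 2) ^ 2 ∂ρ ≤ B) :
    ∫⁻ x, weightedSq π β φ x * weightedSq π β ψ x ∂ρ
      ≤ B * ((∫⁻ r, sqMoment π φ r ∂lebesguePos) * ∫⁻ r, sqMoment π ψ r ∂lebesguePos) := by
  have hw : ∀ r, Measurable fun x => (β x r : ℝ≥0∞) + (β x r : ℝ≥0∞) ^ 2 := fun r =>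
    (measurable_weight hβ).comp measurable_prodMk_right
  rw [lintegral_mul_weightedSq hβ hψ.measurable (measurable_weightedSq hβ hφ.measurable),
    ← mul_assoc, ← lintegral_const_mul _ (measurable_sqMoment hψ.measurable)]
  refine lintegral_mono_ae ?_
  filter_upwards [hB] with r hr
  rcases le_or_gt r T with hrT | hrT
  · rw [mul_comm (sqMoment π ψ r)]
    refine mul_le_mul' ?_ le_rfl
    calc _ = ∫⁻ x, ((β x r : ℝ≥0∞) + (β x r : ℝ≥0∞) ^ 2) * weightedSq π β φ x ∂ρ := by
          simp only [mul_comm]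
      _ = ∫⁻ q, sqMoment π φ q * ∫⁻ x, ((β x r : ℝ≥0∞) + (β x r : ℝ≥0∞) ^ 2) *
            ((β x q : ℝ≥0∞) + (β x q : ℝ≥0∞) ^ 2) ∂ρ ∂lebesguePos :=
          lintegral_mul_weightedSq hβ hφ.measurable (hw r)
      _ ≤ ∫⁻ q, B * sqMoment π φ q ∂lebesguePos := by
          refine lintegral_mono_ae ?_
          filter_upwards [hB] with q hq
          rcases le_or_gt q T with hqT | hqT
          · rw [mul_comm]
            refine mul_le_mul' ?_ le_rfl
            calc _ ≤ _ := lintegral_mul_le_sqrt ρ (hw r).aemeasurable (hw q).aemeasurable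
              _ ≤ ((B : ℝ≥0∞) * B) ^ (1 / 2 : ℝ) := by
                  gcongr
                  · exact hr hrT
                  · exact hq hqT
              _ = B := by
                  rw [← pow_two, ← ENNReal.rpow_two, ← ENNReal.rpow_mul]
                  norm_num
          · simp [sqMoment, hφ.eq_zero q hqT]
      _ = _ := lintegral_const_mul _ (measurable_sqMoment hφ.measurable)
  · simp [sqMoment, hψ.eq_zero r hrT]

variable {ν : Measure ℕ} [IsProbabilityMeasure ν]

theorem lintegral_enorm_markSum_sq_le_weightedSq (hβ : Measurable (Function.uncurry β))
    (hφ : Measurable (Function.uncurry φ)) (x : Ω') :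
    ∫⁻ y, ‖markSum (β x) φ y‖ₑ ^ 2 ∂(meanMeasure ν π)
      ≤ (∫⁻ l, (l : ℝ≥0∞) ^ 4 ∂ν) * weightedSq π β φ x := by
  refine (lintegral_enorm_markSum_sq_le (hβ.comp measurable_prodMk_left) hφ).trans ?_
  refine mul_le_mul' le_rfl (lintegral_mono fun r => ?_)
  exact mul_le_mul' le_self_add le_rfl

/-- Cauchy–Schwarz over [0, T] produces the factor `T` and the weight β². This is why `weightedSq`
uses β + β²: the first power serves the compensated part and the square serves the drift. -/
theorem sq_lintegral_enorm_markSum_le_weightedSq (hβ : Measurable (Function.uncurry β))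
    (hφ : IsAdmissible π T φ) (x : Ω') :
    (∫⁻ y, ‖markSum (β x) φ y‖ₑ ∂(meanMeasure ν π)) ^ 2
      ≤ (∫⁻ l, (l : ℝ≥0∞) ^ 4 ∂ν) ^ 2 * T * weightedSq π β φ x := by
  have hβx : Measurable (β x) := hβ.comp measurable_prodMk_left
  have hE : Measurable fun r => ∫⁻ z, ‖φ r z‖ₑ ∂π :=
    Measurable.lintegral_prod_right (f := fun r z => ‖φ r z‖ₑ) hφ.measurable.enorm
  calc _ ≤ ((∫⁻ l, (l : ℝ≥0∞) ^ 4 ∂ν) *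
          ∫⁻ r, β x r * ∫⁻ z, ‖φ r z‖ₑ ∂π ∂lebesguePos) ^ 2 := by
        gcongr
        exact lintegral_enorm_markSum_le hβx hφ.measurable
    _ = (∫⁻ l, (l : ℝ≥0∞) ^ 4 ∂ν) ^ 2 * (∫⁻ r, (Iic T).indicator 1 r *
          (β x r * ∫⁻ z, ‖φ r z‖ₑ ∂π) ∂lebesguePos) ^ 2 := by
        rw [mul_pow]
        congr 2
        refine lintegral_congr fun r => ?_
        rcases le_or_gt r T with hrT | hrT
        · simp [hrT]
        · simp [hφ.eq_zero r hrT]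
    _ ≤ (∫⁻ l, (l : ℝ≥0∞) ^ 4 ∂ν) ^ 2 * ((∫⁻ r, (Iic T).indicator 1 r ^ 2 ∂lebesguePos) *
          ∫⁻ r, (β x r * ∫⁻ z, ‖φ r z‖ₑ ∂π) ^ 2 ∂lebesguePos) := by
        refine mul_le_mul' le_rfl (sq_lintegral_mul_le _ ?_ ?_)
        · exact (measurable_one.indicator measurableSet_Iic).aemeasurable
        · fun_prop
    _ ≤ (∫⁻ l, (l : ℝ≥0∞) ^ 4 ∂ν) ^ 2 * (T * weightedSq π β φ x) := by
        refine mul_le_mul' le_rfl (mul_le_mul' (le_of_eq ?_) (lintegral_mono fun r => ?_))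
        · rw [← lebesguePos_Iic, ← lintegral_indicator_one measurableSet_Iic]
          refine lintegral_congr fun r => ?_
          by_cases hr : r ≤ T <;> simp [hr]
        · simp only
          rw [mul_pow]
          refine mul_le_mul' le_add_self ?_
          have h := sq_lintegral_mul_le π (f := fun z => ‖φ r z‖ₑ) (g := fun _ => 1)
            (hφ.measurable.comp measurable_prodMk_left).enorm.aemeasurable aemeasurable_const
          simpa [sqMoment] using h
    _ = _ := by ring

theorem enorm_integral_markSum_sq_le_weightedSq (hβ : Measurable (Function.uncurry β))
    (hφ : IsAdmissible π T φ) (x : Ω') :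
    ‖∫ y, markSum (β x) φ y ∂(meanMeasure ν π)‖ₑ ^ 2
      ≤ (∫⁻ l, (l : ℝ≥0∞) ^ 4 ∂ν) ^ 2 * T * weightedSq π β φ x := by
  refine le_trans ?_ (sq_lintegral_enorm_markSum_le_weightedSq hβ hφ x)
  gcongr
  exact enorm_integral_le_lintegral_enorm _

end

/-- This isolates all that is needed from Poisson calculus. The remaining estimates concern only
moments of functionals of a single path. -/
theorem exists_hasMomentBounds {Ω Ω' : Type*} [MeasurableSpace Ω] [MeasurableSpace Ω']
    {P : Measure Ω} [IsProbabilityMeasure P] {π : Measure Path} [IsProbabilityMeasure π]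
    {ν : Measure ℕ} [IsProbabilityMeasure ν] {X : Ω → Ω'} {β : Ω' → ℝ≥0 → ℝ≥0}
    {M : Ω → Measure Point} (hM : IsPoissonRandomMeasure P (meanMeasure ν π) M)
    (hX : Measurable X) (hXM : IndepFun X M P) (hβ : Measurable (Function.uncurry β))
    (hν : ∫⁻ l, (l : ℝ≥0∞) ^ 4 ∂ν ≠ ∞) {T B : ℝ≥0}
    (hB : ∀ᵐ r ∂lebesguePos, r ≤ T →
      ∫⁻ x, ((β x r : ℝ≥0∞) + (β x r : ℝ≥0∞) ^ 2) ^ 2 ∂(P.map X) ≤ B) :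
    ∃ C : ℝ≥0, HasMomentBounds P (meanMeasure ν π) π X β M T C := by
  have hρ := Measure.isProbabilityMeasure_map (μ := P) hX.aemeasurable
  obtain ⟨k, hk⟩ : ∃ k : ℝ≥0, (k : ℝ≥0∞) = ∫⁻ l, (l : ℝ≥0∞) ^ 4 ∂ν :=
    ⟨_, ENNReal.coe_toNNReal hν⟩
  set b : ℝ≥0∞ := (B : ℝ≥0∞) ^ (1 / 2 : ℝ) with hb
  have hbfin : b ≠ ∞ := ENNReal.rpow_ne_top_of_nonneg (by norm_num) (by simp)
  have hWm : ∀ {φ}, IsAdmissible π T φ → Measurable (weightedSq π β φ) := fun hφ =>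
    measurable_weightedSq hβ hφ.measurable
  have hF : ∀ {φ}, IsAdmissible π T φ →
      Measurable (Function.uncurry fun x => markSum (β x) φ) := fun hφ =>
    measurable_markSum hβ hφ.measurable
  have hμint : ∀ {φ}, IsAdmissible π T φ →
      ∀ᵐ x ∂(P.map X), Integrable (markSum (β x) φ) (meanMeasure ν π) := by
    intro φ hφ
    have h := lintegral_indicator_mul_weightedSq_le hβ hφ hB MeasurableSet.univ
    simp only [indicator_univ, Pi.one_apply, one_mul, measure_univ, ENNReal.one_rpow,
      mul_one] at h
    have hlt := ae_lt_top (hWm hφ) (h.trans_lt (ENNReal.mul_lt_top hbfin.lt_top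
      hφ.finite.lt_top)).ne
    filter_upwards [hlt] with x hx
    refine ⟨((hF hφ).comp measurable_prodMk_left).aestronglyMeasurable, ?_⟩
    have h2 := sq_lintegral_enorm_markSum_le_weightedSq (ν := ν) hβ hφ x
    rw [← hk] at h2
    have h3 : (∫⁻ y, ‖markSum (β x) φ y‖ₑ ∂(meanMeasure ν π)) ^ 2 < ∞ :=
      h2.trans_lt (ENNReal.mul_lt_top (by finiteness) hx)
    exact (ENNReal.pow_lt_top_iff.1 h3).resolve_right (by norm_num)
  -- One constant for the quadratic term (k) and for the squared drift (k²T).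
  set c : ℝ≥0∞ := k + k ^ 2 * T with hc
  have hcfin : c ≠ ∞ := by finiteness
  have hsq : ∀ {φ}, IsAdmissible π T φ → ∀ x,
      ∫⁻ y, ‖markSum (β x) φ y‖ₑ ^ 2 ∂(meanMeasure ν π) ≤ c * weightedSq π β φ x := by
    intro φ hφ x
    refine (lintegral_enorm_markSum_sq_le_weightedSq hβ hφ.measurable x).trans ?_
    rw [← hk]
    exact mul_le_mul' le_self_add le_rfl
  have hdr : ∀ {φ}, IsAdmissible π T φ → ∀ x,
      ‖∫ y, markSum (β x) φ y ∂(meanMeasure ν π)‖ₑ ^ 2 ≤ c * weightedSq π β φ x := by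
    intro φ hφ x
    refine (enorm_integral_markSum_sq_le_weightedSq hβ hφ x).trans ?_
    rw [← hk]
    exact mul_le_mul' le_add_self le_rfl
  have hdm : ∀ {φ}, IsAdmissible π T φ →
      Measurable fun x => ‖∫ y, markSum (β x) φ y ∂(meanMeasure ν π)‖ₑ ^ 2 := by
    intro φ hφ
    exact (StronglyMeasurable.integral_prod_right
      (hF hφ).stronglyMeasurable).measurable.enorm.pow_const 2
  have hCm : ∀ {φ}, IsAdmissible π T φ → AEMeasurable
      (fun ω => ‖compInt (meanMeasure ν π) (M ω) (markSum (β (X ω)) φ)‖ₑ ^ 2) P := by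
    intro φ hφ
    exact (hM.aemeasurable_compInt hX (hF hφ)).enorm.pow_const 2
  have hWW : ∀ {φ ψ}, IsAdmissible π T φ → IsAdmissible π T ψ →
      ∫⁻ x, (c * weightedSq π β φ x) * (c * weightedSq π β ψ x) ∂(P.map X) ≤ c ^ 2 * B *
        ((∫⁻ r, sqMoment π φ r ∂lebesguePos) * ∫⁻ r, sqMoment π ψ r ∂lebesguePos) := by
    intro φ ψ hφ hψ
    calc _ = c ^ 2 * ∫⁻ x, weightedSq π β φ x * weightedSq π β ψ x ∂(P.map X) := by
          rw [← lintegral_const_mul_mul _ (hWm hφ) (hWm hψ)]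
          exact lintegral_congr fun x => by ring
      _ ≤ _ := by
          rw [mul_assoc]
          exact mul_le_mul' le_rfl (lintegral_weightedSq_mul_le hβ hφ hψ hB)
  -- Here 5 = 4 + 1 collects the compensated part and the drift in the single bound, and 57 = 48 + 4
  -- + 4 + 1 the four terms of the product bound. The sum serves both.
  have hCfin : 5 * c * b + 48 * k * b + 57 * c ^ 2 * B ≠ ∞ := by finiteness
  refine ⟨(5 * c * b + 48 * k * b + 57 * c ^ 2 * B).toNNReal, ?_,
    fun φ hφ => hM.aemeasurable_compInt hX (hF hφ),
    fun φ hφ => (hCm hφ).add ((hdm hφ).comp hX).aemeasurable, ?_, ?_⟩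
  · intro φ hφ
    have h1 := hM.ae_integrable_of_indepFun hX hXM (hF hφ) (hμint hφ)
    filter_upwards [h1, ae_of_ae_map hX.aemeasurable (hμint hφ)] with ω h h'
    exact ⟨h, h'⟩
  · intro φ hφ G hG
    rw [ENNReal.coe_toNNReal hCfin]
    have hG1 : Measurable (G.indicator (1 : Ω' → ℝ≥0∞)) := measurable_one.indicator hG
    calc _ = ∫⁻ ω, G.indicator 1 (X ω) *
              ‖compInt (meanMeasure ν π) (M ω) (markSum (β (X ω)) φ)‖ₑ ^ 2 ∂P
            + ∫⁻ x, G.indicator 1 x *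
              ‖∫ y, markSum (β x) φ y ∂(meanMeasure ν π)‖ₑ ^ 2 ∂(P.map X) := by
          rw [lintegral_map (f := fun x => G.indicator 1 x *
              ‖∫ y, markSum (β x) φ y ∂(meanMeasure ν π)‖ₑ ^ 2) (hG1.mul (hdm hφ)) hX]
          have m1 : AEMeasurable (fun ω => G.indicator 1 (X ω) *
              ‖compInt (meanMeasure ν π) (M ω) (markSum (β (X ω)) φ)‖ₑ ^ 2) P :=
            (hG1.comp hX).aemeasurable.mul (hCm hφ)
          rw [← lintegral_add_left' m1]
          exact lintegral_congr fun ω => mul_add _ _ _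
      _ ≤ 4 * ∫⁻ x, G.indicator 1 x * (c * weightedSq π β φ x) ∂(P.map X)
            + ∫⁻ x, G.indicator 1 x * (c * weightedSq π β φ x) ∂(P.map X) := by
          refine add_le_add ?_ (lintegral_mono fun x => mul_le_mul' le_rfl (hdr hφ x))
          refine (hM.lintegral_mul_compInt_sq_le hX hXM (hF hφ) (hμint hφ) hG1).trans ?_
          exact mul_le_mul' le_rfl (lintegral_mono fun x => mul_le_mul' le_rfl (hsq hφ x))
      _ = 5 * c * ∫⁻ x, G.indicator 1 x * weightedSq π β φ x ∂(P.map X) := by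
          have : ∫⁻ x, G.indicator 1 x * (c * weightedSq π β φ x) ∂(P.map X)
              = c * ∫⁻ x, G.indicator 1 x * weightedSq π β φ x ∂(P.map X) := by
            rw [← lintegral_const_mul_mul _ hG1 (hWm hφ)]
            exact lintegral_congr fun x => by ring
          rw [this]
          ring
      _ ≤ 5 * c * (b * (P.map X G) ^ (1 / 2 : ℝ) * ∫⁻ r, sqMoment π φ r ∂lebesguePos) :=
          mul_le_mul' le_rfl (lintegral_indicator_mul_weightedSq_le hβ hφ hB hG)
      _ = 5 * c * b * (P.map X G) ^ (1 / 2 : ℝ) * ∫⁻ r, sqMoment π φ r ∂lebesguePos := by ring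
      _ ≤ _ := by
          gcongr
          rw [add_assoc]
          exact le_self_add
  · intro φ ψ hφ hψ
    rw [ENNReal.coe_toNNReal hCfin]
    set μ := meanMeasure ν π
    set Nφ := ∫⁻ r, sqMoment π φ r ∂lebesguePos
    set Nψ := ∫⁻ r, sqMoment π ψ r ∂lebesguePos
    set Q := ∫⁻ r, mixedMoment π φ ψ r ∂lebesguePos
      + ∫⁻ r, sqMoment π φ r * sqMoment π ψ r ∂lebesguePos
    have hQm : Measurable fun r => mixedMoment π φ ψ r + sqMoment π φ r * sqMoment π ψ r :=
      (measurable_mixedMoment hφ.measurable hψ.measurable).add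
        ((measurable_sqMoment hφ.measurable).mul (measurable_sqMoment hψ.measurable))
    have hβm : Measurable fun p : Ω' × ℝ≥0 => (β p.1 p.2 : ℝ≥0∞) := hβ.coe_nnreal_ennreal
    -- This term carries the weight β alone, whose mean is at most `b`, the square root of `B`, by
    -- Cauchy–Schwarz.
    have hQ : ∫⁻ x, ∫⁻ r, β x r * (mixedMoment π φ ψ r + sqMoment π φ r * sqMoment π ψ r)
        ∂lebesguePos ∂(P.map X) ≤ b * Q := by
      rw [lintegral_lintegral_swap ((hβm.mul (hQm.comp measurable_snd)).aemeasurable)]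
      have : Q = ∫⁻ r, mixedMoment π φ ψ r + sqMoment π φ r * sqMoment π ψ r ∂lebesguePos :=
        (lintegral_add_left (measurable_mixedMoment hφ.measurable hψ.measurable) _).symm
      rw [this, ← lintegral_const_mul _ hQm]
      refine lintegral_mono_ae ?_
      filter_upwards [hB] with r hr
      rcases le_or_gt r T with hrT | hrT
      · have hβr : Measurable fun x => (β x r : ℝ≥0∞) := hβm.comp measurable_prodMk_right
        rw [lintegral_mul_const _ hβr]
        refine mul_le_mul' ?_ le_rfl
        have h := lintegral_mul_le_sqrt (P.map X) (f := fun _ => 1)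
          (g := fun x => (β x r : ℝ≥0∞) + (β x r : ℝ≥0∞) ^ 2) aemeasurable_const
          ((measurable_weight hβ).comp measurable_prodMk_right).aemeasurable
        simp only [one_mul, one_pow, lintegral_one, measure_univ] at h
        refine (lintegral_mono fun x => ?_).trans (h.trans ?_)
        · exact le_self_add
        · rw [hb]
          gcongr
          exact hr hrT
      · simp [mixedMoment, sqMoment, hφ.eq_zero r hrT]
    calc _ = ∫⁻ ω, (‖compInt μ (M ω) (markSum (β (X ω)) φ)‖ₑ ^ 2 *
                ‖compInt μ (M ω) (markSum (β (X ω)) ψ)‖ₑ ^ 2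
              + ‖∫ y, markSum (β (X ω)) ψ y ∂μ‖ₑ ^ 2 *
                ‖compInt μ (M ω) (markSum (β (X ω)) φ)‖ₑ ^ 2
              + (‖∫ y, markSum (β (X ω)) φ y ∂μ‖ₑ ^ 2 *
                ‖compInt μ (M ω) (markSum (β (X ω)) ψ)‖ₑ ^ 2
              + ‖∫ y, markSum (β (X ω)) φ y ∂μ‖ₑ ^ 2 *
                ‖∫ y, markSum (β (X ω)) ψ y ∂μ‖ₑ ^ 2)) ∂P := by
          refine lintegral_congr fun ω => ?_
          simp only [splitSq]
          ring
      _ = ∫⁻ ω, ‖compInt μ (M ω) (markSum (β (X ω)) φ)‖ₑ ^ 2 *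
                ‖compInt μ (M ω) (markSum (β (X ω)) ψ)‖ₑ ^ 2 ∂P
              + ∫⁻ ω, ‖∫ y, markSum (β (X ω)) ψ y ∂μ‖ₑ ^ 2 *
                ‖compInt μ (M ω) (markSum (β (X ω)) φ)‖ₑ ^ 2 ∂P
              + (∫⁻ ω, ‖∫ y, markSum (β (X ω)) φ y ∂μ‖ₑ ^ 2 *
                ‖compInt μ (M ω) (markSum (β (X ω)) ψ)‖ₑ ^ 2 ∂P
              + ∫⁻ ω, ‖∫ y, markSum (β (X ω)) φ y ∂μ‖ₑ ^ 2 *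
                ‖∫ y, markSum (β (X ω)) ψ y ∂μ‖ₑ ^ 2 ∂P) := by
          have m1 : AEMeasurable (fun ω => ‖compInt μ (M ω) (markSum (β (X ω)) φ)‖ₑ ^ 2 *
              ‖compInt μ (M ω) (markSum (β (X ω)) ψ)‖ₑ ^ 2) P := (hCm hφ).mul (hCm hψ)
          have m2 : AEMeasurable (fun ω => ‖∫ y, markSum (β (X ω)) ψ y ∂μ‖ₑ ^ 2 *
              ‖compInt μ (M ω) (markSum (β (X ω)) φ)‖ₑ ^ 2) P :=
            ((hdm hψ).comp hX).aemeasurable.mul (hCm hφ)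
          have m3 : AEMeasurable (fun ω => ‖∫ y, markSum (β (X ω)) φ y ∂μ‖ₑ ^ 2 *
              ‖compInt μ (M ω) (markSum (β (X ω)) ψ)‖ₑ ^ 2) P :=
            ((hdm hφ).comp hX).aemeasurable.mul (hCm hψ)
          rw [lintegral_add_left' (f := fun ω => _ + _) (m1.add m2),
            lintegral_add_left' m1, lintegral_add_left' m3]
      _ ≤ 48 * (k * (b * Q) + c ^ 2 * B * (Nφ * Nψ)) + 4 * (c ^ 2 * B * (Nφ * Nψ))
            + (4 * (c ^ 2 * B * (Nφ * Nψ)) + c ^ 2 * B * (Nφ * Nψ)) := by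
          refine add_le_add (add_le_add ?_ ?_) (add_le_add ?_ ?_)
          · refine (hM.lintegral_compInt_sq_mul_compInt_sq_le hX hXM (hF hφ) (hF hψ) (hμint hφ)
              (hμint hψ)).trans (mul_le_mul' le_rfl ?_)
            calc _ ≤ ∫⁻ x, (k * ∫⁻ r, β x r *
                    (mixedMoment π φ ψ r + sqMoment π φ r * sqMoment π ψ r) ∂lebesguePos
                  + (c * weightedSq π β φ x) * (c * weightedSq π β ψ x)) ∂(P.map X) := by
                  refine lintegral_mono fun x => add_le_add ?_
                    (mul_le_mul' (hsq hφ x) (hsq hψ x))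
                  rw [hk]
                  exact lintegral_enorm_markSum_sq_mul_sq_le (hβ.comp measurable_prodMk_left)
                    hφ.measurable hψ.measurable
              _ = k * ∫⁻ x, ∫⁻ r, β x r *
                    (mixedMoment π φ ψ r + sqMoment π φ r * sqMoment π ψ r)
                      ∂lebesguePos ∂(P.map X)
                  + ∫⁻ x, (c * weightedSq π β φ x) * (c * weightedSq π β ψ x) ∂(P.map X) := by
                  have m1 : Measurable fun x =>
                      (c * weightedSq π β φ x) * (c * weightedSq π β ψ x) :=
                    ((hWm hφ).const_mul c).mul ((hWm hψ).const_mul c)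
                  rw [lintegral_add_right _ m1,
                    lintegral_const_mul' _ _ ENNReal.coe_ne_top]
              _ ≤ _ := add_le_add (mul_le_mul' le_rfl hQ) (hWW hφ hψ)
          -- In the cross terms the squared drift is a function of X and plays the role of the
          -- weight.
          · refine (hM.lintegral_mul_compInt_sq_le hX hXM (hF hφ) (hμint hφ) (hdm hψ)).trans
              (mul_le_mul' le_rfl ?_)
            refine le_trans (lintegral_mono fun x => ?_) (hWW hφ hψ)
            rw [mul_comm]
            exact mul_le_mul' (hsq hφ x) (hdr hψ x)
          · refine (hM.lintegral_mul_compInt_sq_le hX hXM (hF hψ) (hμint hψ) (hdm hφ)).trans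
              (mul_le_mul' le_rfl ?_)
            refine le_trans (lintegral_mono fun x => ?_) (hWW hφ hψ)
            exact mul_le_mul' (hdr hφ x) (hsq hψ x)
          · rw [← lintegral_map (f := fun x => ‖∫ y, markSum (β x) φ y ∂μ‖ₑ ^ 2 *
                ‖∫ y, markSum (β x) ψ y ∂μ‖ₑ ^ 2) ((hdm hφ).mul (hdm hψ)) hX]
            refine le_trans (lintegral_mono fun x => ?_) (hWW hφ hψ)
            exact mul_le_mul' (hdr hφ x) (hdr hψ x)
      _ = (48 * k * b) * Q + (57 * c ^ 2 * B) * (Nφ * Nψ) := by ring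
      _ ≤ (5 * c * b + 48 * k * b + 57 * c ^ 2 * B) * Q
            + (5 * c * b + 48 * k * b + 57 * c ^ 2 * B) * (Nφ * Nψ) := by
          refine add_le_add (mul_le_mul' ?_ le_rfl) (mul_le_mul' le_add_self le_rfl)
          exact le_add_self.trans le_self_add
      _ = _ := by ring

/-! ### A Grönwall inequality -/

theorem lintegral_exp_le {K : ℝ} (hK : 0 < K) (t : ℝ≥0) :
    ∫⁻ r in Iic t, ENNReal.ofReal (Real.exp (K * (t - r : ℝ≥0))) ∂lebesguePos
      ≤ ENNReal.ofReal (Real.exp (K * t) / K) := by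
  have hc : Continuous fun x : ℝ => Real.exp (K * (t - x)) := by fun_prop
  calc _ = ∫⁻ r : ℝ≥0, (Icc 0 (t : ℝ)).indicator
          (fun x => ENNReal.ofReal (Real.exp (K * (t - x)))) (r : ℝ) ∂lebesguePos := by
        rw [← lintegral_indicator measurableSet_Iic]
        refine lintegral_congr fun r => ?_
        by_cases hr : r ≤ t
        · have h' : (r : ℝ) ∈ Icc 0 (t : ℝ) := ⟨r.2, by exact_mod_cast hr⟩
          rw [indicator_of_mem (show r ∈ Iic t from hr), indicator_of_mem h', NNReal.coe_sub hr]
        · have h' : (r : ℝ) ∉ Icc 0 (t : ℝ) := fun h => hr (by exact_mod_cast h.2)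
          rw [indicator_of_notMem (show r ∉ Iic t from hr), indicator_of_notMem h']
    _ = ∫⁻ x, (Icc 0 (t : ℝ)).indicator
          (fun x => ENNReal.ofReal (Real.exp (K * (t - x)))) x ∂(lebesguePos.map (↑)) :=
        (measurableEmbedding_coe.lintegral_map _).symm
    _ ≤ ∫⁻ x, (Icc 0 (t : ℝ)).indicator
          (fun x => ENNReal.ofReal (Real.exp (K * (t - x)))) x := by
        rw [lebesguePos, measurableEmbedding_coe.map_comap]
        exact lintegral_mono' Measure.restrict_le_self le_rfl
    _ = ENNReal.ofReal (∫ x in (0 : ℝ)..t, Real.exp (K * (t - x))) := by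
        rw [lintegral_indicator measurableSet_Icc,
          intervalIntegral.integral_of_le (NNReal.coe_nonneg t),
          ← integral_Icc_eq_integral_Ioc, ofReal_integral_eq_lintegral_ofReal]
        · exact hc.continuousOn.integrableOn_Icc
        · exact Eventually.of_forall fun x => (Real.exp_pos _).le
    _ ≤ _ := by
        refine ENNReal.ofReal_le_ofReal ?_
        rw [intervalIntegral.integral_comp_sub_left (fun y => Real.exp (K * y)) (t : ℝ),
          intervalIntegral.integral_comp_mul_left _ hK.ne', integral_exp]
        simp only [sub_self, sub_zero, mul_zero, Real.exp_zero, smul_eq_mul]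
        rw [inv_mul_eq_div]
        gcongr
        linarith

/-- A bounded function dominated by a constant plus a multiple of its time integral is bounded in
terms of this constant. -/
theorem exists_gronwall (C T : ℝ≥0) : ∃ D : ℝ≥0, ∀ (u : ℝ≥0 → ℝ≥0∞) (T' : ℝ≥0) (A : ℝ≥0∞)
    (K : ℝ≥0), T' ≤ T → (∀ t ≤ T', u t ≤ K) →
    (∀ t ≤ T', u t ≤ A + C * ∫⁻ r in Iic t, u (t - r) ∂lebesguePos) →
    ∀ t ≤ T', u t ≤ D * A := by
  -- With this rate, convolution with the exponential e^(Lt) contributes a factor at most C/L ≤ 1/2.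
  set L : ℝ≥0 := 2 * C + 1 with hL
  have hL0 : (0 : ℝ) < L := by positivity
  let e : ℝ≥0 → ℝ≥0∞ := fun t => ENNReal.ofReal (Real.exp (L * t))
  have he1 : ∀ t, 1 ≤ e t := fun t => by
    rw [← ENNReal.ofReal_one]
    exact ENNReal.ofReal_le_ofReal (Real.one_le_exp (by positivity))
  have hint : ∀ t, C * ∫⁻ r in Iic t, e (t - r) ∂lebesguePos ≤ 2⁻¹ * e t := by
    intro t
    refine (mul_le_mul' le_rfl (lintegral_exp_le hL0 t)).trans ?_
    rw [← ENNReal.ofReal_coe_nnreal, ← ENNReal.ofReal_mul (NNReal.coe_nonneg C),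
      show (2⁻¹ : ℝ≥0∞) = ENNReal.ofReal 2⁻¹ by
        rw [ENNReal.ofReal_inv_of_pos (by norm_num)]; simp,
      ← ENNReal.ofReal_mul (by norm_num)]
    refine ENNReal.ofReal_le_ofReal ?_
    rw [mul_div_assoc', div_le_iff₀ hL0]
    have h1 := Real.exp_pos ((L : ℝ) * t)
    have h2 : (L : ℝ) = 2 * C + 1 := by rw [hL]; push_cast; ring
    nlinarith
  refine ⟨2 * (e T).toNNReal, fun u T' A K hT' hK hu t ht => ?_⟩
  -- Each use of the inequality halves the contribution of the a priori bound `K`, since A + (2A +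
  -- x)/2 = 2A + x/2. It disappears in the limit. Only monotonicity of the integral is applied to
  -- `u`, so `u` need not be measurable.
  have key : ∀ n : ℕ, ∀ t ≤ T', u t ≤ (2 * A + K * (2⁻¹) ^ n) * e t := by
    intro n
    induction n with
    | zero =>
      intro t ht
      calc u t ≤ K * 1 := by rw [mul_one]; exact hK t ht
        _ ≤ _ := mul_le_mul' (by simp) (he1 t)
    | succ n ih =>
      intro t ht
      calc u t ≤ A + C * ∫⁻ r in Iic t, u (t - r) ∂lebesguePos := hu t ht
        _ ≤ A + C * ∫⁻ r in Iic t, (2 * A + K * (2⁻¹) ^ n) * e (t - r) ∂lebesguePos := by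
            gcongr with r
            exact ih _ (tsub_le_self.trans ht)
        _ = A + (2 * A + K * (2⁻¹) ^ n) * (C * ∫⁻ r in Iic t, e (t - r) ∂lebesguePos) := by
            rw [lintegral_const_mul _ (by fun_prop)]
            ring
        _ ≤ A * e t + (2 * A + K * (2⁻¹) ^ n) * (2⁻¹ * e t) := by
            refine add_le_add ?_ (mul_le_mul' le_rfl (hint t))
            exact le_mul_of_one_le_right zero_le (he1 t)
        _ = _ := by
            have h2 : (2 : ℝ≥0∞) * 2⁻¹ = 1 := ENNReal.mul_inv_cancel (by simp) (by simp)
            have : (2 * A + K * (2⁻¹) ^ n) * (2⁻¹ * e t)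
                = (2 * 2⁻¹) * A * e t + K * (2⁻¹) ^ (n + 1) * e t := by ring
            rw [this, h2]
            ring
  have hlim : Tendsto (fun n : ℕ => (2 * A + K * (2⁻¹ : ℝ≥0∞) ^ n) * e t) atTop
      (𝓝 ((2 * A + K * 0) * e t)) := by
    refine ENNReal.Tendsto.mul_const ?_ (Or.inr ENNReal.ofReal_ne_top)
    refine tendsto_const_nhds.add (ENNReal.Tendsto.const_mul ?_ (Or.inr ENNReal.coe_ne_top))
    exact ENNReal.tendsto_pow_atTop_nhds_zero_of_lt_one (by simp)
  have := ge_of_tendsto' hlim fun n => key n t ht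
  refine this.trans ?_
  rw [mul_zero, add_zero, ENNReal.coe_mul, ENNReal.coe_toNNReal ENNReal.ofReal_ne_top,
    mul_right_comm, ENNReal.coe_ofNat]
  have hmono : e t ≤ e T := by
    refine ENNReal.ofReal_le_ofReal (Real.exp_le_exp.2 ?_)
    gcongr
    exact_mod_cast ht.trans hT'
  gcongr

/-! ### Truncation -/

/-- Either no mass lies where |f| > K and nothing is truncated, or that set has mass at least 1 and
the right side already reaches K. The function f need not be integrable. -/
theorem min_enorm_integral_le {E : Type*} [MeasurableSpace E] {m : Measure E}
    (hm : ∀ B : Set E, MeasurableSet B → ∃ n : ℕ∞, m B = (n : ℝ≥0∞)) {f : E → ℝ}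
    (hf : Measurable f) (K : ℝ≥0∞) :
    min ‖∫ x, f x ∂m‖ₑ K ≤ ∫⁻ x, min ‖f x‖ₑ K ∂m := by
  have hS : MeasurableSet {x | K < ‖f x‖ₑ} := measurableSet_lt measurable_const hf.enorm
  obtain ⟨n, hn⟩ := hm _ hS
  rcases eq_or_ne n 0 with rfl | hn0
  · refine (min_le_left _ _).trans ((enorm_integral_le_lintegral_enorm _).trans (le_of_eq ?_))
    have h0 : ∀ᵐ x ∂m, ‖f x‖ₑ ≤ K := by
      rw [ae_iff]
      simpa using hn
    refine lintegral_congr_ae ?_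
    filter_upwards [h0] with x hx
    rw [min_eq_left hx]
  · refine (min_le_right _ _).trans ?_
    calc K ≤ K * m {x | K < ‖f x‖ₑ} := by
          refine le_mul_of_one_le_right zero_le ?_
          rw [hn]
          exact_mod_cast Order.one_le_iff_pos.2 (pos_iff_ne_zero.2 hn0)
      _ = ∫⁻ x in {x | K < ‖f x‖ₑ}, K ∂m := by rw [setLIntegral_const]
      _ ≤ ∫⁻ x in {x | K < ‖f x‖ₑ}, min ‖f x‖ₑ K ∂m := by
          refine setLIntegral_mono' hS fun x hx => ?_
          exact le_min (le_of_lt hx) le_rfl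
      _ ≤ _ := setLIntegral_le_lintegral _ _

theorem min_abs_sum_le {ι : Type*} (s : Finset ι) (f : ι → ℝ) {K : ℝ} (hK : 0 ≤ K) :
    min |∑ i ∈ s, f i| K ≤ ∑ i ∈ s, min |f i| K := by
  classical
  induction s using Finset.induction_on with
  | empty => simp [hK]
  | insert i s hi ih =>
    rw [Finset.sum_insert hi, Finset.sum_insert hi]
    have h0 : 0 ≤ ∑ i ∈ s, min |f i| K := Finset.sum_nonneg fun i _ => le_min (abs_nonneg _) hK
    have h1 := abs_add_le (f i) (∑ i ∈ s, f i)
    rcases le_total |f i| K with h | h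
    · rw [min_eq_left h]
      rcases le_total |∑ i ∈ s, f i| K with h' | h'
      · rw [min_eq_left h'] at ih
        exact (min_le_left _ _).trans (by linarith)
      · rw [min_eq_right h'] at ih
        exact (min_le_right _ _).trans (by linarith [abs_nonneg (f i)])
    · rw [min_eq_right h]
      exact (min_le_right _ _).trans (by linarith)

/-- The functional `|φ|` truncated at level `K`. -/
def trunc (K : ℕ) (φ : ℝ≥0 → Path → ℝ) (r : ℝ≥0) (z : Path) : ℝ := min |φ r z| K

theorem measurable_trunc (K : ℕ) {φ : ℝ≥0 → Path → ℝ} (hφ : Measurable (Function.uncurry φ)) :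
    Measurable (Function.uncurry (trunc K φ)) := by
  have : Measurable fun p : ℝ≥0 × Path => |φ p.1 p.2| := hφ.norm
  exact this.min measurable_const

theorem markSum_trunc_nonneg (K : ℕ) (β : ℝ≥0 → ℝ≥0) (φ : ℝ≥0 → Path → ℝ) (x : Point) :
    0 ≤ markSum β (trunc K φ) x := by
  unfold markSum trunc
  split_ifs
  · exact Finset.sum_nonneg fun i _ => le_min (abs_nonneg _) (by positivity)
  · exact le_rfl

theorem min_enorm_markSum_le (K : ℕ) (β : ℝ≥0 → ℝ≥0) (φ : ℝ≥0 → Path → ℝ) (x : Point) :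
    min ‖markSum β φ x‖ₑ K ≤ ENNReal.ofReal (markSum β (trunc K φ) x) := by
  rw [Real.enorm_eq_ofReal_abs, ← ENNReal.ofReal_natCast, ← ENNReal.ofReal_min]
  refine ENNReal.ofReal_le_ofReal ?_
  by_cases h : x.2.1 ≤ β x.1
  · simp only [markSum, h, if_true, trunc]
    exact min_abs_sum_le _ _ (by positivity)
  · simp [markSum, h]

/-- Integrability is required of the truncated functional only: that of the original integrand
depends on moments of Z that are not yet available. -/
theorem min_enorm_integral_markSum_le {m : Measure Point}
    (hm : ∀ B : Set Point, MeasurableSet B → ∃ n : ℕ∞, m B = (n : ℝ≥0∞)) (K : ℕ)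
    {β : ℝ≥0 → ℝ≥0} (hβ : Measurable β) {φ : ℝ≥0 → Path → ℝ}
    (hφ : Measurable (Function.uncurry φ))
    (hint : Integrable (markSum β (trunc K φ)) m) :
    min ‖∫ x, markSum β φ x ∂m‖ₑ K ≤ ‖∫ x, markSum β (trunc K φ) x ∂m‖ₑ := by
  have hf : Measurable (markSum β φ) :=
    (measurable_markSum (β := fun _ : Unit => β) (hβ.comp measurable_snd) hφ).comp
      (measurable_const.prodMk measurable_id : Measurable fun x : Point => (Unit.unit, x))
  refine (min_enorm_integral_le hm hf K).trans ?_
  refine (lintegral_mono fun x => min_enorm_markSum_le K β φ x).trans (le_of_eq ?_)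
  rw [← ofReal_integral_eq_lintegral_ofReal hint
    (Eventually.of_forall fun x => markSum_trunc_nonneg K β φ x),
    Real.enorm_of_nonneg (integral_nonneg fun x => markSum_trunc_nonneg K β φ x)]

/-! ### A priori fourth moments -/

theorem ennreal_add_sq_le (a b : ℝ≥0∞) : (a + b) ^ 2 ≤ 2 * (a ^ 2 + b ^ 2) := by
  have h := ENNReal.rpow_add_le_mul_rpow_add_rpow a b (p := 2) (by norm_num)
  have e : (2 : ℝ) - 1 = 1 := by norm_num
  simpa only [ENNReal.rpow_two, e, ENNReal.rpow_one] using h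

/-- The path-valued variable `Z` has law `π` and solves the birth equation driven by `M`, with
random birth rate `β(X)` and lifetime `η(X)` of the ancestor. -/
structure SolvesBirthEquation {Ω Ω' : Type*} [MeasurableSpace Ω] (P : Measure Ω)
    (π : Measure Path) (X : Ω → Ω') (β : Ω' → ℝ≥0 → ℝ≥0) (η : Ω' → ℝ≥0)
    (M : Ω → Measure Point) (Z : Ω → Path) : Prop where
  law : HasLaw Z π P
  equation : ∀ t : ℝ≥0, ∀ᵐ ω ∂P, (Z ω).1 t = (if t < η (X ω) then 1 else 0)
    + ∫ x, markSum (β (X ω)) (shiftEval t) x ∂(M ω)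

section

variable {π : Measure Path} [IsProbabilityMeasure π] {φ ψ : ℝ≥0 → Path → ℝ} {T : ℝ≥0}

theorem sqMoment_sq_le (hφ : Measurable (Function.uncurry φ)) (r : ℝ≥0) :
    sqMoment π φ r ^ 2 ≤ mixedMoment π φ φ r := by
  have h := sq_lintegral_mul_le π (f := fun z => ‖φ r z‖ₑ ^ 2) (g := fun _ => 1)
    ((hφ.comp measurable_prodMk_left).enorm.pow_const 2).aemeasurable aemeasurable_const
  simpa [sqMoment, mixedMoment, pow_two] using h

theorem lintegral_sqMoment_le_of_le (hT : ∀ r, T < r → ∀ z, φ r z = 0) {K : ℝ≥0∞}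
    (hK : ∀ r ≤ T, sqMoment π φ r ≤ K) : ∫⁻ r, sqMoment π φ r ∂lebesguePos ≤ K * T := by
  rw [← lebesguePos_Iic, ← lintegral_indicator_const measurableSet_Iic]
  refine lintegral_mono fun r => ?_
  rcases le_or_gt r T with hr | hr
  · rw [indicator_of_mem (show r ∈ Iic T from hr)]
    exact hK r hr
  · simp [sqMoment, hT r hr]

theorem isAdmissible_of_sqMoment_le (hφ : Measurable (Function.uncurry φ))
    (hT : ∀ r, T < r → ∀ z, φ r z = 0) {K : ℝ≥0∞} (hK : ∀ r ≤ T, sqMoment π φ r ≤ K)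
    (hKfin : K ≠ ∞) : IsAdmissible π T φ :=
  ⟨hφ, hT, ((lintegral_sqMoment_le_of_le hT hK).trans_lt
    (ENNReal.mul_lt_top hKfin.lt_top ENNReal.coe_lt_top)).ne⟩

theorem sq_lintegral_sqMoment_le (hφ : IsAdmissible π T φ) :
    (∫⁻ r, sqMoment π φ r ∂lebesguePos) ^ 2 ≤ T * ∫⁻ r, mixedMoment π φ φ r ∂lebesguePos := by
  calc _ = (∫⁻ r, (Iic T).indicator 1 r * sqMoment π φ r ∂lebesguePos) ^ 2 := by
        congr 1
        refine lintegral_congr fun r => ?_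
        rcases le_or_gt r T with hr | hr
        · simp [hr]
        · simp [sqMoment, hφ.eq_zero r hr]
    _ ≤ (∫⁻ r, (Iic T).indicator 1 r ^ 2 ∂lebesguePos) * ∫⁻ r, sqMoment π φ r ^ 2 ∂lebesguePos :=
        sq_lintegral_mul_le _ (measurable_one.indicator measurableSet_Iic).aemeasurable
          (measurable_sqMoment hφ.measurable).aemeasurable
    _ ≤ _ := by
        refine mul_le_mul' (le_of_eq ?_) (lintegral_mono fun r => sqMoment_sq_le hφ.measurable r)
        rw [← lebesguePos_Iic, ← lintegral_indicator_one measurableSet_Iic]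
        refine lintegral_congr fun r => ?_
        by_cases hr : r ≤ T <;> simp [hr]

theorem isAdmissible_trunc (n : ℕ) (hφ : Measurable (Function.uncurry φ))
    (hT : ∀ r, T < r → ∀ z, φ r z = 0) : IsAdmissible π T (trunc n φ) := by
  refine isAdmissible_of_sqMoment_le (measurable_trunc n hφ) (fun r hr z => ?_)
    (K := (n : ℝ≥0∞) ^ 2) (fun r _ => ?_) (by finiteness)
  · simp [trunc, hT r hr z]
  · calc sqMoment π (trunc n φ) r ≤ ∫⁻ _, (n : ℝ≥0∞) ^ 2 ∂π := by
          refine lintegral_mono fun z => ?_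
          have h0 : 0 ≤ trunc n φ r z := le_min (abs_nonneg _) (by positivity)
          have h1 : ‖trunc n φ r z‖ₑ ≤ n := by
            rw [Real.enorm_of_nonneg h0, ← ENNReal.ofReal_natCast]
            exact ENNReal.ofReal_le_ofReal (min_le_right _ _)
          gcongr
      _ = _ := by simp

theorem IsAdmissible.sub (hφ : IsAdmissible π T φ) (hψ : IsAdmissible π T ψ) :
    IsAdmissible π T (φ - ψ) := by
  have hsq : ∀ r, sqMoment π (φ - ψ) r ≤ 2 * (sqMoment π φ r + sqMoment π ψ r) := by
    intro r
    have hm : Measurable fun z => ‖φ r z‖ₑ ^ 2 :=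
      (hφ.measurable.comp measurable_prodMk_left).enorm.pow_const 2
    rw [sqMoment, sqMoment, sqMoment, ← lintegral_add_left hm,
      ← lintegral_const_mul' _ _ (by simp)]
    refine lintegral_mono fun z => ?_
    have := enorm_add_sq_le (φ r z) (-ψ r z)
    rwa [enorm_neg, ← sub_eq_add_neg] at this
  refine ⟨hφ.measurable.sub hψ.measurable, fun r hr z => ?_, ?_⟩
  · simp [hφ.eq_zero r hr z, hψ.eq_zero r hr z]
  · refine ((lintegral_mono hsq).trans_lt ?_).ne
    rw [lintegral_const_mul' _ _ (by simp), lintegral_add_left (measurable_sqMoment hφ.measurable)]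
    exact ENNReal.mul_lt_top (by simp) (ENNReal.add_lt_top.2 ⟨hφ.finite.lt_top, hψ.finite.lt_top⟩)

theorem shiftEval_eq_zero {t r : ℝ≥0} (h : t < r) (z : Path) : shiftEval t r z = 0 := by
  simp [shiftEval, h]

theorem mixedMoment_trunc_shiftEval (n : ℕ) (t r : ℝ≥0) :
    mixedMoment π (trunc n (shiftEval t)) (trunc n (shiftEval t)) r
      = (Iic t).indicator (fun r => ∫⁻ z : Path, (min ‖z.1 (t - r)‖ₑ n) ^ 4 ∂π) r := by
  rcases le_or_gt r t with hr | hr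
  · rw [indicator_of_mem (show r ∈ Iic t from hr), mixedMoment]
    refine lintegral_congr fun z => ?_
    have h0 : 0 ≤ trunc n (shiftEval t) r z := le_min (abs_nonneg _) (by positivity)
    have h1 : ‖trunc n (shiftEval t) r z‖ₑ = min ‖z.1 (t - r)‖ₑ n := by
      rw [Real.enorm_of_nonneg h0, Real.enorm_eq_ofReal_abs, ← ENNReal.ofReal_natCast,
        ← ENNReal.ofReal_min]
      simp [trunc, shiftEval, hr]
    rw [h1, ← pow_add]
  · rw [indicator_of_notMem (show r ∉ Iic t from not_le.2 hr), mixedMoment]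
    simp [trunc, shiftEval_eq_zero hr]

end

section

variable {Ω Ω' : Type*} [MeasurableSpace Ω] [MeasurableSpace Ω'] {P : Measure Ω}
  [IsProbabilityMeasure P] {μ : Measure Point} {π : Measure Path} [IsProbabilityMeasure π]
  {X : Ω → Ω'} {β : Ω' → ℝ≥0 → ℝ≥0} {η : Ω' → ℝ≥0} {M : Ω → Measure Point} {Z : Ω → Path}
  {T C : ℝ≥0} {φ ψ : ℝ≥0 → Path → ℝ}

omit [IsProbabilityMeasure P] in
-- On the diagonal every term reduces to the fourth moment: the squared second moment by Jensen, and
-- the squared time integral by Cauchy–Schwarz over [0, T].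
theorem HasMomentBounds.lintegral_splitSq_sq_le (H : HasMomentBounds P μ π X β M T C)
    (hφ : IsAdmissible π T φ) :
    ∫⁻ ω, splitSq μ (M ω) (markSum (β (X ω)) φ) ^ 2 ∂P
      ≤ (C * (2 + T) : ℝ≥0) * ∫⁻ r, mixedMoment π φ φ r ∂lebesguePos := by
  simp only [pow_two]
  refine (H.splitSq_mul_le φ φ hφ hφ).trans ?_
  rw [ENNReal.coe_mul, mul_assoc]
  refine mul_le_mul' le_rfl ?_
  calc _ ≤ ∫⁻ r, mixedMoment π φ φ r ∂lebesguePos + ∫⁻ r, mixedMoment π φ φ r ∂lebesguePos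
        + T * ∫⁻ r, mixedMoment π φ φ r ∂lebesguePos := by
        refine add_le_add (add_le_add le_rfl (lintegral_mono fun r => ?_)) ?_
        · rw [← pow_two]
          exact sqMoment_sq_le hφ.measurable r
        · rw [← pow_two]
          exact sq_lintegral_sqMoment_le hφ
    _ = _ := by
        push_cast
        ring

omit [IsProbabilityMeasure π] in
theorem HasMomentBounds.lintegral_splitSq_le (H : HasMomentBounds P μ π X β M T C)
    (hX : AEMeasurable X P) (hφ : IsAdmissible π T φ) :
    ∫⁻ ω, splitSq μ (M ω) (markSum (β (X ω)) φ) ∂P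
      ≤ C * ∫⁻ r, sqMoment π φ r ∂lebesguePos := by
  have := Measure.isProbabilityMeasure_map (μ := P) hX
  simpa using H.splitSq_le φ hφ univ MeasurableSet.univ

theorem SolvesBirthEquation.lintegral_min_pow_four_le
    (S : SolvesBirthEquation P π X β η M Z) (H : HasMomentBounds P μ π X β M T C)
    (hβ : Measurable (Function.uncurry β))
    (hM : ∀ᵐ ω ∂P, ∀ B : Set Point, MeasurableSet B → ∃ n : ℕ∞, M ω B = (n : ℝ≥0∞))
    (n : ℕ) {t : ℝ≥0} (ht : t ≤ T) :
    ∫⁻ z : Path, (min ‖z.1 t‖ₑ n) ^ 4 ∂π ≤ 8 + (32 * (C * (2 + T)) : ℝ≥0) *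
      ∫⁻ r in Iic t, ∫⁻ z : Path, (min ‖z.1 (t - r)‖ₑ n) ^ 4 ∂π ∂lebesguePos := by
  have hadm : IsAdmissible π T (trunc n (shiftEval t)) :=
    isAdmissible_trunc n (measurable_shiftEval t) fun r hr z =>
      shiftEval_eq_zero (ht.trans_lt hr) z
  have hm : Measurable fun z : Path => (min ‖z.1 t‖ₑ n) ^ 4 :=
    ((measurable_path_eval t).enorm.min measurable_const).pow_const 4
  rw [← S.law.lintegral_comp hm.aemeasurable]
  -- With Y the size of the truncated integral, (1 + Y)⁴ ≤ 8(1 + Y⁴) and Y⁴ ≤ 4 `splitSq`².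
  calc _ ≤ ∫⁻ ω, (8 + 32 * splitSq μ (M ω) (markSum (β (X ω)) (trunc n (shiftEval t))) ^ 2)
          ∂P := by
        refine lintegral_mono_ae ?_
        filter_upwards [S.equation t, hM, H.ae_integrable _ hadm] with ω h1 h2 h3
        set Y := ‖∫ x, markSum (β (X ω)) (trunc n (shiftEval t)) x ∂(M ω)‖ₑ with hY
        have hmin := min_enorm_integral_markSum_le h2 n (hβ.comp measurable_prodMk_left)
          (measurable_shiftEval t) h3.1
        have hle : min ‖(Z ω).1 t‖ₑ n ≤ 1 + Y := by
          rw [h1]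
          have hind : ‖(if t < η (X ω) then 1 else 0 : ℝ)‖ₑ ≤ 1 := by split_ifs <;> simp
          have hadd := enorm_add_le (if t < η (X ω) then 1 else 0 : ℝ)
            (∫ x, markSum (β (X ω)) (shiftEval t) x ∂(M ω))
          rcases min_le_iff.1 hmin with h | h
          · exact (min_le_left _ _).trans (hadd.trans (add_le_add hind h))
          · exact (min_le_right _ _).trans (h.trans le_add_self)
        have hY2 : Y ^ 2 ≤ 2 * splitSq μ (M ω) (markSum (β (X ω)) (trunc n (shiftEval t))) :=
          enorm_integral_sq_le_splitSq μ (M ω) _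
        calc _ ≤ (1 + Y) ^ 4 := by gcongr
          _ = ((1 + Y) ^ 2) ^ 2 := by ring
          _ ≤ (2 * (1 ^ 2 + Y ^ 2)) ^ 2 := by
              gcongr
              exact ennreal_add_sq_le 1 Y
          _ = 4 * (1 + Y ^ 2) ^ 2 := by ring
          _ ≤ 4 * (2 * (1 ^ 2 + (Y ^ 2) ^ 2)) := by
              gcongr
              exact ennreal_add_sq_le 1 _
          _ ≤ 4 * (2 * (1 ^ 2 + (2 * splitSq μ (M ω)
                (markSum (β (X ω)) (trunc n (shiftEval t)))) ^ 2)) := by gcongr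
          _ = _ := by ring
    _ = 8 + 32 * ∫⁻ ω, splitSq μ (M ω) (markSum (β (X ω)) (trunc n (shiftEval t))) ^ 2 ∂P := by
        rw [lintegral_add_left measurable_const, lintegral_const_mul' _ _ (by simp)]
        simp
    _ ≤ 8 + 32 * ((C * (2 + T) : ℝ≥0) * ∫⁻ r,
          mixedMoment π (trunc n (shiftEval t)) (trunc n (shiftEval t)) r ∂lebesguePos) := by
        gcongr
        exact H.lintegral_splitSq_sq_le hadm
    _ = _ := by
        simp only [mixedMoment_trunc_shiftEval]
        rw [lintegral_indicator measurableSet_Iic]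
        push_cast
        ring

/-- The moment truncated at n is at most n⁴, so Grönwall applies to it. The resulting constant is
free of n, and Fatou removes the truncation. -/
theorem SolvesBirthEquation.exists_fourth_moment_le
    (S : SolvesBirthEquation P π X β η M Z) (H : HasMomentBounds P μ π X β M T C)
    (hβ : Measurable (Function.uncurry β))
    (hM : ∀ᵐ ω ∂P, ∀ B : Set Point, MeasurableSet B → ∃ n : ℕ∞, M ω B = (n : ℝ≥0∞)) :
    ∃ A : ℝ≥0, ∀ t ≤ T, ∫⁻ z : Path, ‖z.1 t‖ₑ ^ 4 ∂π ≤ A := by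
  obtain ⟨D, hD⟩ := exists_gronwall (32 * (C * (2 + T))) T
  refine ⟨D * 8, fun t ht => ?_⟩
  have hn : ∀ n : ℕ, ∫⁻ z : Path, (min ‖z.1 t‖ₑ n) ^ 4 ∂π ≤ D * 8 := by
    intro n
    refine hD (fun t => ∫⁻ z : Path, (min ‖z.1 t‖ₑ n) ^ 4 ∂π) T 8 ((n : ℝ≥0) ^ 4) le_rfl
      (fun t ht => ?_) (fun t ht => S.lintegral_min_pow_four_le H hβ hM n ht) t ht
    calc _ ≤ ∫⁻ _ : Path, (n : ℝ≥0∞) ^ 4 ∂π := by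
          refine lintegral_mono fun z => ?_
          gcongr
          exact min_le_right _ _
      _ = _ := by simp
  have hlim : ∀ z : Path, Tendsto (fun n : ℕ => (min ‖z.1 t‖ₑ n) ^ 4) atTop
      (𝓝 (‖z.1 t‖ₑ ^ 4)) := by
    intro z
    obtain ⟨m, hm⟩ := ENNReal.exists_nat_gt (enorm_ne_top (x := z.1 t))
    refine tendsto_atTop_of_eventually_const (i₀ := m) fun n hn => ?_
    rw [min_eq_left (hm.le.trans (by exact_mod_cast hn))]
  calc _ = ∫⁻ z : Path, liminf (fun n : ℕ => (min ‖z.1 t‖ₑ n) ^ 4) atTop ∂π :=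
        lintegral_congr fun z => (hlim z).liminf_eq.symm
    _ ≤ liminf (fun n : ℕ => ∫⁻ z : Path, (min ‖z.1 t‖ₑ n) ^ 4 ∂π) atTop :=
        lintegral_liminf_le fun n =>
          ((measurable_path_eval t).enorm.min measurable_const).pow_const 4
    _ ≤ _ := by
        refine liminf_le_of_le (by isBoundedDefault) fun b hb => ?_
        obtain ⟨n, hb⟩ := hb.exists
        push_cast
        exact hb.trans (hn n)

end

/-! ### Moments of increments -/

/-- The increment over `[s, t]` of a path born at time `r`. -/
def shiftIncr (s t : ℝ≥0) : ℝ≥0 → Path → ℝ := shiftEval t - shiftEval s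

/-- The event that the lifetime ends in `(s, t]`. -/
def lifetimeIn {Ω' : Type*} (η : Ω' → ℝ≥0) (s t : ℝ≥0) : Set Ω' := {x | s < η x ∧ η x ≤ t}

theorem measurableSet_lifetimeIn {Ω' : Type*} [MeasurableSpace Ω'] {η : Ω' → ℝ≥0}
    (hη : Measurable η) (s t : ℝ≥0) : MeasurableSet (lifetimeIn η s t) :=
  (measurableSet_Ioc : MeasurableSet (Ioc s t)).preimage hη

theorem measurable_shiftIncr (s t : ℝ≥0) : Measurable (Function.uncurry (shiftIncr s t)) :=
  (measurable_shiftEval t).sub (measurable_shiftEval s)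

theorem shiftIncr_of_le {s h r : ℝ≥0} (hr : r ≤ s) (z : Path) :
    shiftIncr s (s + h) r z = z.1 (s - r + h) - z.1 (s - r) := by
  simp [shiftIncr, shiftEval, hr, hr.trans (le_self_add : s ≤ s + h), tsub_add_eq_add_tsub hr]

theorem shiftIncr_of_lt {s t r : ℝ≥0} (hr : s < r) (hrt : r ≤ t) (z : Path) :
    shiftIncr s t r z = z.1 (t - r) := by
  simp [shiftIncr, shiftEval, hrt, hr.not_ge]

theorem shiftIncr_eq_zero {s t r : ℝ≥0} (hst : s ≤ t) (hr : t < r) (z : Path) :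
    shiftIncr s t r z = 0 := by
  simp [shiftIncr, shiftEval_eq_zero hr, shiftEval_eq_zero (hst.trans_lt hr)]

/-- Births are classified by date. Those before a give the recursive term, those within the interval
give a term proportional to its length, and those afterwards give nothing. -/
theorem lintegral_le_of_Iic_of_Ioc {F G : ℝ≥0 → ℝ≥0∞} {a h : ℝ≥0} {c : ℝ≥0∞}
    (h1 : ∀ r ≤ a, F r ≤ G r) (h2 : ∀ r, a < r → r ≤ a + h → F r ≤ c)
    (h3 : ∀ r, a + h < r → F r = 0) :
    ∫⁻ r, F r ∂lebesguePos ≤ ∫⁻ r in Iic a, G r ∂lebesguePos + c * h := by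
  calc _ ≤ ∫⁻ r, ((Iic a).indicator G r + (Ioc a (a + h)).indicator (fun _ => c) r)
          ∂lebesguePos := by
        refine lintegral_mono fun r => ?_
        rcases le_or_gt r a with hr | hr
        · rw [indicator_of_mem (show r ∈ Iic a from hr)]
          exact (h1 r hr).trans le_self_add
        · rcases le_or_gt r (a + h) with hr' | hr'
          · rw [indicator_of_mem (show r ∈ Ioc a (a + h) from ⟨hr, hr'⟩)]
            exact (h2 r hr hr').trans le_add_self
          · rw [h3 r hr']
            exact zero_le
    _ = ∫⁻ r in Iic a, G r ∂lebesguePos + c * lebesguePos (Ioc a (a + h)) := by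
        rw [lintegral_add_right _ (measurable_const.indicator measurableSet_Ioc),
          lintegral_indicator measurableSet_Iic, lintegral_indicator_const measurableSet_Ioc]
    _ ≤ _ := by
        gcongr
        refine (lebesguePos_le_of_forall_mem_Icc (a := a) (b := a + h) fun r hr => ?_).trans ?_
        · exact ⟨by exact_mod_cast hr.1.le, by exact_mod_cast hr.2⟩
        · simp

/-- The fourth moment of the increments of the paths over intervals of length `h`. -/
def incrFourth (π : Measure Path) (h s : ℝ≥0) : ℝ≥0∞ := ∫⁻ z, ‖z.1 (s + h) - z.1 s‖ₑ ^ 4 ∂π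

/-- The second moment of the increments of the paths over intervals of length `h`. -/
def incrSq (π : Measure Path) (h s : ℝ≥0) : ℝ≥0∞ := ∫⁻ z, ‖z.1 (s + h) - z.1 s‖ₑ ^ 2 ∂π

/-- The mixed moment of the increments of the paths over successive intervals of lengths `h₁`
and `h₂`. -/
def incrMixed (π : Measure Path) (h₁ h₂ s : ℝ≥0) : ℝ≥0∞ :=
  ∫⁻ z, ‖z.1 (s + h₁ + h₂) - z.1 (s + h₁)‖ₑ ^ 2 * ‖z.1 (s + h₁) - z.1 s‖ₑ ^ 2 ∂π

theorem enorm_sub_sq_le (a b : ℝ) : ‖a - b‖ₑ ^ 2 ≤ 2 * (‖a‖ₑ ^ 2 + ‖b‖ₑ ^ 2) := by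
  simpa only [sub_eq_add_neg, enorm_neg] using enorm_add_sq_le a (-b)

theorem enorm_sub_pow_four_le (a b : ℝ) : ‖a - b‖ₑ ^ 4 ≤ 8 * (‖a‖ₑ ^ 4 + ‖b‖ₑ ^ 4) := by
  calc _ = (‖a - b‖ₑ ^ 2) ^ 2 := by ring
    _ ≤ (2 * (‖a‖ₑ ^ 2 + ‖b‖ₑ ^ 2)) ^ 2 := by
        gcongr
        exact enorm_sub_sq_le a b
    _ = 4 * (‖a‖ₑ ^ 2 + ‖b‖ₑ ^ 2) ^ 2 := by ring
    _ ≤ 4 * (2 * ((‖a‖ₑ ^ 2) ^ 2 + (‖b‖ₑ ^ 2) ^ 2)) := by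
        gcongr
        exact ennreal_add_sq_le _ _
    _ = _ := by ring

/-- The factor 1 + a replaces √a to avoid roots of constants. -/
theorem ennreal_le_of_sq_le {x : ℝ≥0∞} {a d : ℝ≥0} (h : x ^ 2 ≤ a * (d : ℝ≥0∞) ^ 2) :
    x ≤ ((1 + a) * d : ℝ≥0) := by
  have h1 : a ≤ (1 + a) ^ 2 := by
    calc a ≤ 1 + a := le_add_self
      _ ≤ (1 + a) ^ 2 := le_self_pow₀ le_self_add (by norm_num)
  have h2 : x ^ 2 ≤ (((1 + a) * d : ℝ≥0) : ℝ≥0∞) ^ 2 := by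
    refine h.trans ?_
    rw [ENNReal.coe_mul, mul_pow]
    gcongr
    exact_mod_cast h1
  exact (ENNReal.pow_le_pow_left_iff two_ne_zero).1 h2

theorem ennreal_sq_le_one_add (x : ℝ≥0∞) : x ^ 2 ≤ 1 + x ^ 4 := by
  rcases le_total x 1 with h | h
  · exact (pow_le_one₀ zero_le h).trans le_self_add
  · exact (pow_le_pow_right₀ h (by norm_num)).trans le_add_self

section

variable {π : Measure Path} [IsProbabilityMeasure π] {T A : ℝ≥0}

theorem lintegral_sq_le (hA : ∀ t ≤ T, ∫⁻ z : Path, ‖z.1 t‖ₑ ^ 4 ∂π ≤ A) {t : ℝ≥0} (ht : t ≤ T) :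
    ∫⁻ z : Path, ‖z.1 t‖ₑ ^ 2 ∂π ≤ (1 + A : ℝ≥0) := by
  calc _ ≤ ∫⁻ z : Path, (1 + ‖z.1 t‖ₑ ^ 4) ∂π := lintegral_mono fun z => ennreal_sq_le_one_add _
    _ ≤ _ := by
        rw [lintegral_add_left measurable_const]
        push_cast
        gcongr
        · simp
        · exact hA t ht

theorem isAdmissible_shiftEval (hA : ∀ t ≤ T, ∫⁻ z : Path, ‖z.1 t‖ₑ ^ 4 ∂π ≤ A) {t : ℝ≥0}
    (ht : t ≤ T) : IsAdmissible π T (shiftEval t) := by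
  refine isAdmissible_of_sqMoment_le (measurable_shiftEval t)
    (fun r hr => shiftEval_eq_zero (ht.trans_lt hr)) (K := (1 + A : ℝ≥0)) (fun r _ => ?_)
    ENNReal.coe_ne_top
  rcases le_or_gt r t with hr | hr
  · simpa [sqMoment, shiftEval, hr] using lintegral_sq_le hA (tsub_le_self.trans ht)
  · simp [sqMoment, shiftEval_eq_zero hr]

theorem isAdmissible_shiftIncr (hA : ∀ t ≤ T, ∫⁻ z : Path, ‖z.1 t‖ₑ ^ 4 ∂π ≤ A) {s t : ℝ≥0}
    (hst : s ≤ t) (ht : t ≤ T) : IsAdmissible π T (shiftIncr s t) :=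
  (isAdmissible_shiftEval hA ht).sub (isAdmissible_shiftEval hA (hst.trans ht))

omit [IsProbabilityMeasure π] in
theorem incrFourth_le (hA : ∀ t ≤ T, ∫⁻ z : Path, ‖z.1 t‖ₑ ^ 4 ∂π ≤ A) {h s : ℝ≥0}
    (hs : s + h ≤ T) : incrFourth π h s ≤ (16 * A : ℝ≥0) := by
  calc _ ≤ ∫⁻ z : Path, 8 * (‖z.1 (s + h)‖ₑ ^ 4 + ‖z.1 s‖ₑ ^ 4) ∂π :=
        lintegral_mono fun z => enorm_sub_pow_four_le _ _
    _ ≤ 8 * ((A : ℝ≥0∞) + A) := by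
        rw [lintegral_const_mul' _ _ (by simp),
          lintegral_add_left ((measurable_path_eval _).enorm.pow_const 4)]
        gcongr
        · exact hA _ hs
        · exact hA _ (le_self_add.trans hs)
    _ = _ := by
        push_cast
        ring

theorem lintegral_mixedMoment_shiftIncr_self_le
    (hA : ∀ t ≤ T, ∫⁻ z : Path, ‖z.1 t‖ₑ ^ 4 ∂π ≤ A) {h s : ℝ≥0} (hs : s + h ≤ T) :
    ∫⁻ r, mixedMoment π (shiftIncr s (s + h)) (shiftIncr s (s + h)) r ∂lebesguePos
      ≤ ∫⁻ r in Iic s, incrFourth π h (s - r) ∂lebesguePos + A * h := by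
  refine lintegral_le_of_Iic_of_Ioc (fun r hr => le_of_eq ?_) (fun r hr hr' => ?_) fun r hr => ?_
  · refine lintegral_congr fun z => ?_
    rw [shiftIncr_of_le hr, ← pow_add]
  · refine le_trans (le_of_eq ?_) (hA (s + h - r) (tsub_le_self.trans hs))
    refine lintegral_congr fun z => ?_
    rw [shiftIncr_of_lt hr hr', ← pow_add]
  · simp [mixedMoment, shiftIncr_eq_zero le_self_add hr]

theorem lintegral_sqMoment_shiftIncr_le
    (hA : ∀ t ≤ T, ∫⁻ z : Path, ‖z.1 t‖ₑ ^ 4 ∂π ≤ A) {h s : ℝ≥0} (hs : s + h ≤ T) :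
    ∫⁻ r, sqMoment π (shiftIncr s (s + h)) r ∂lebesguePos
      ≤ ∫⁻ r in Iic s, incrSq π h (s - r) ∂lebesguePos + (1 + A : ℝ≥0) * h := by
  refine lintegral_le_of_Iic_of_Ioc (fun r hr => le_of_eq ?_) (fun r hr hr' => ?_) fun r hr => ?_
  · refine lintegral_congr fun z => ?_
    rw [shiftIncr_of_le hr]
  · refine le_trans (le_of_eq ?_) (lintegral_sq_le hA (t := s + h - r) (tsub_le_self.trans hs))
    refine lintegral_congr fun z => ?_
    rw [shiftIncr_of_lt hr hr']
  · simp [sqMoment, shiftIncr_eq_zero le_self_add hr]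

theorem sqMoment_shiftIncr_le_of_incrFourth_le {h s r d a : ℝ≥0}
    (hd : ∀ s, s + h ≤ T → incrFourth π h s ≤ a * (d : ℝ≥0∞) ^ 2) (hs : s + h ≤ T) (hr : r ≤ s) :
    sqMoment π (shiftIncr s (s + h)) r ≤ ((1 + a) * d : ℝ≥0) := by
  refine ennreal_le_of_sq_le ((sqMoment_sq_le (measurable_shiftIncr _ _) r).trans ?_)
  refine le_trans (le_of_eq ?_) (hd (s - r) ((add_le_add tsub_le_self le_rfl).trans hs))
  refine lintegral_congr fun z => ?_
  rw [shiftIncr_of_le hr, ← pow_add]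

/-- A child born during the first interval enters the first increment with its whole value, which is
not small. Cauchy–Schwarz pairs that value with the fourth moment of the second increment, giving
order d, over a birth window of length h₁. Later births miss the first increment. -/
theorem lintegral_mixedMoment_shiftIncr_le
    (hA : ∀ t ≤ T, ∫⁻ z : Path, ‖z.1 t‖ₑ ^ 4 ∂π ≤ A) {h₁ h₂ s d a : ℝ≥0}
    (hd : ∀ s, s + h₂ ≤ T → incrFourth π h₂ s ≤ a * (d : ℝ≥0∞) ^ 2) (hs : s + h₁ + h₂ ≤ T) :
    ∫⁻ r, mixedMoment π (shiftIncr (s + h₁) (s + h₁ + h₂)) (shiftIncr s (s + h₁)) r ∂lebesguePos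
      ≤ ∫⁻ r in Iic s, incrMixed π h₁ h₂ (s - r) ∂lebesguePos
        + ((1 + a * A) * d : ℝ≥0) * h₁ := by
  refine lintegral_le_of_Iic_of_Ioc (fun r hr => le_of_eq ?_) (fun r hr hr' => ?_) fun r hr => ?_
  · refine lintegral_congr fun z => ?_
    rw [shiftIncr_of_le hr, shiftIncr_of_le (hr.trans le_self_add), tsub_add_eq_add_tsub hr]
  · refine ennreal_le_of_sq_le ?_
    have h1 : ∀ z, shiftIncr (s + h₁) (s + h₁ + h₂) r z
        = z.1 (s + h₁ - r + h₂) - z.1 (s + h₁ - r) := shiftIncr_of_le hr'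
    have h2 : ∀ z, shiftIncr s (s + h₁) r z = z.1 (s + h₁ - r) := shiftIncr_of_lt hr hr'
    have hle : s + h₁ - r + h₂ ≤ T := (add_le_add tsub_le_self le_rfl).trans hs
    have hm := sq_lintegral_mul_le π
      (f := fun z => ‖shiftIncr (s + h₁) (s + h₁ + h₂) r z‖ₑ ^ 2)
      (g := fun z => ‖shiftIncr s (s + h₁) r z‖ₑ ^ 2)
      (((measurable_shiftIncr _ _).comp measurable_prodMk_left).enorm.pow_const 2).aemeasurable
      (((measurable_shiftIncr _ _).comp measurable_prodMk_left).enorm.pow_const 2).aemeasurable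
    simp only [h1, h2, ← pow_mul] at hm
    simp only [mixedMoment, h1, h2]
    refine hm.trans ((mul_le_mul' (hd _ hle) (hA _ (le_self_add.trans hle))).trans (le_of_eq ?_))
    push_cast
    ring
  · simp [mixedMoment, shiftIncr_eq_zero le_self_add hr]

omit [IsProbabilityMeasure π] in
-- A crude bound of order d², used only as the a priori finite bound in the Grönwall argument for
-- mixed moments.
theorem incrMixed_le_of_incrFourth_le {h₁ h₂ s : ℝ≥0} :
    incrMixed π h₁ h₂ s ≤ incrFourth π h₂ (s + h₁) + incrFourth π h₁ s := by
  have hm : Measurable fun z : Path => ‖z.1 (s + h₁ + h₂) - z.1 (s + h₁)‖ₑ ^ 4 :=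
    ((measurable_path_eval _).sub (measurable_path_eval _)).enorm.pow_const 4
  rw [incrMixed, incrFourth, incrFourth, ← lintegral_add_left hm]
  refine lintegral_mono fun z => ?_
  rcases le_total ‖z.1 (s + h₁ + h₂) - z.1 (s + h₁)‖ₑ ‖z.1 (s + h₁) - z.1 s‖ₑ with h | h
  · refine le_trans ?_ le_add_self
    rw [show 4 = 2 + 2 from rfl, pow_add ‖z.1 (s + h₁) - z.1 s‖ₑ]
    gcongr
  · refine le_trans ?_ le_self_add
    rw [show 4 = 2 + 2 from rfl, pow_add]
    gcongr

end

/-! ### Recursive inequalities for the increments of the process -/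

section

variable {Ω Ω' : Type*} [MeasurableSpace Ω] [MeasurableSpace Ω'] {P : Measure Ω}
  {μ : Measure Point} {π : Measure Path} [IsProbabilityMeasure π]
  {X : Ω → Ω'} {β : Ω' → ℝ≥0 → ℝ≥0} {η : Ω' → ℝ≥0} {M : Ω → Measure Point} {Z : Ω → Path}
  {T C A : ℝ≥0}

/-- The split square of the integral of the increment over `[s, t]`. -/
abbrev splitIncr (μ : Measure Point) (X : Ω → Ω') (β : Ω' → ℝ≥0 → ℝ≥0) (M : Ω → Measure Point)
    (s t : ℝ≥0) (ω : Ω) : ℝ≥0∞ :=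
  splitSq μ (M ω) (markSum (β (X ω)) (shiftIncr s t))

/-- Subtracting the equation at two times leaves the ancestor's death indicator and the integral of
the increments of its descendants. -/
theorem SolvesBirthEquation.enorm_sub_sq_le (S : SolvesBirthEquation P π X β η M Z)
    (H : HasMomentBounds P μ π X β M T C)
    (hA : ∀ t ≤ T, ∫⁻ z : Path, ‖z.1 t‖ₑ ^ 4 ∂π ≤ A) {s t : ℝ≥0} (hst : s ≤ t) (ht : t ≤ T) :
    ∀ᵐ ω ∂P, ‖(Z ω).1 t - (Z ω).1 s‖ₑ ^ 2
      ≤ 2 * (lifetimeIn η s t).indicator 1 (X ω) + 4 * splitIncr μ X β M s t ω := by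
  filter_upwards [S.equation s, S.equation t,
    H.ae_integrable _ (isAdmissible_shiftEval hA ht),
    H.ae_integrable _ (isAdmissible_shiftEval hA (hst.trans ht))] with ω hs' ht' hit his
  have hint : ∫ x, markSum (β (X ω)) (shiftIncr s t) x ∂(M ω)
      = ∫ x, markSum (β (X ω)) (shiftEval t) x ∂(M ω)
        - ∫ x, markSum (β (X ω)) (shiftEval s) x ∂(M ω) := by
    rw [← integral_sub hit.1 his.1]
    exact integral_congr_ae (ae_of_all _ fun x => markSum_sub _ _ _ x)
  have hdecomp : (Z ω).1 t - (Z ω).1 s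
      = ((if t < η (X ω) then 1 else 0 : ℝ) - if s < η (X ω) then 1 else 0)
        + ∫ x, markSum (β (X ω)) (shiftIncr s t) x ∂(M ω) := by
    rw [hs', ht', hint]
    ring
  have hind : ‖(if t < η (X ω) then 1 else 0 : ℝ) - if s < η (X ω) then 1 else 0‖ₑ ^ 2
      ≤ (lifetimeIn η s t).indicator 1 (X ω) := by
    by_cases h1 : t < η (X ω)
    · simp [h1, hst.trans_lt h1]
    · by_cases h2 : s < η (X ω)
      · have : X ω ∈ lifetimeIn η s t := ⟨h2, not_lt.1 h1⟩
        simp [h1, h2, this]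
      · simp [h1, h2]
  calc _ ≤ 2 * (_ + _) := by
        rw [hdecomp]
        exact enorm_add_sq_le _ _
    _ ≤ 2 * ((lifetimeIn η s t).indicator 1 (X ω) + 2 * splitIncr μ X β M s t ω) := by
        gcongr
        exact enorm_integral_sq_le_splitSq μ (M ω) _
    _ = _ := by ring

theorem SolvesBirthEquation.incrFourth_le (S : SolvesBirthEquation P π X β η M Z)
    (H : HasMomentBounds P μ π X β M T C) (hX : Measurable X) (hη : Measurable η)
    (hA : ∀ t ≤ T, ∫⁻ z : Path, ‖z.1 t‖ₑ ^ 4 ∂π ≤ A) {h s : ℝ≥0} (hs : s + h ≤ T) :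
    incrFourth π h s ≤ 8 * P.map X (lifetimeIn η s (s + h)) + (32 * (C * (2 + T)) : ℝ≥0) *
      (∫⁻ r in Iic s, incrFourth π h (s - r) ∂lebesguePos + A * h) := by
  have hG := measurableSet_lifetimeIn hη s (s + h)
  have hG1 : Measurable ((lifetimeIn η s (s + h)).indicator (1 : Ω' → ℝ≥0∞)) :=
    measurable_one.indicator hG
  have hGX : Measurable fun ω => (lifetimeIn η s (s + h)).indicator (1 : Ω' → ℝ≥0∞) (X ω) :=
    hG1.comp hX
  have hm : Measurable fun z : Path => ‖z.1 (s + h) - z.1 s‖ₑ ^ 4 :=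
    ((measurable_path_eval _).sub (measurable_path_eval _)).enorm.pow_const 4
  have hadm := isAdmissible_shiftIncr hA (le_self_add : s ≤ s + h) hs
  rw [incrFourth, ← S.law.lintegral_comp hm.aemeasurable]
  calc _ ≤ ∫⁻ ω, (8 * (lifetimeIn η s (s + h)).indicator 1 (X ω)
          + 32 * splitIncr μ X β M s (s + h) ω ^ 2) ∂P := by
        refine lintegral_mono_ae ?_
        filter_upwards [S.enorm_sub_sq_le H hA le_self_add hs] with ω hω
        calc _ = (‖(Z ω).1 (s + h) - (Z ω).1 s‖ₑ ^ 2) ^ 2 := by ring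
          _ ≤ (2 * (lifetimeIn η s (s + h)).indicator 1 (X ω)
              + 4 * splitIncr μ X β M s (s + h) ω) ^ 2 := by gcongr
          _ ≤ 2 * ((2 * (lifetimeIn η s (s + h)).indicator 1 (X ω)) ^ 2
              + (4 * splitIncr μ X β M s (s + h) ω) ^ 2) := ennreal_add_sq_le _ _
          _ = 8 * (lifetimeIn η s (s + h)).indicator 1 (X ω) ^ 2
              + 32 * splitIncr μ X β M s (s + h) ω ^ 2 := by ring
          _ = _ := by
              congr 2
              by_cases hx : X ω ∈ lifetimeIn η s (s + h) <;> simp [hx]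
    _ = 8 * P.map X (lifetimeIn η s (s + h))
          + 32 * ∫⁻ ω, splitIncr μ X β M s (s + h) ω ^ 2 ∂P := by
        rw [lintegral_add_left (hGX.const_mul 8), lintegral_const_mul' _ _ (by simp),
          lintegral_const_mul' _ _ (by simp), ← lintegral_map hG1 hX, lintegral_indicator_one hG]
    _ ≤ 8 * P.map X (lifetimeIn η s (s + h)) + 32 * ((C * (2 + T) : ℝ≥0) *
          (∫⁻ r in Iic s, incrFourth π h (s - r) ∂lebesguePos + A * h)) := by
        gcongr
        exact (H.lintegral_splitSq_sq_le hadm).trans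
          (mul_le_mul' le_rfl (lintegral_mixedMoment_shiftIncr_self_le hA hs))
    _ = _ := by
        push_cast
        ring

theorem SolvesBirthEquation.incrSq_le [IsProbabilityMeasure P]
    (S : SolvesBirthEquation P π X β η M Z)
    (H : HasMomentBounds P μ π X β M T C) (hX : Measurable X) (hη : Measurable η)
    (hA : ∀ t ≤ T, ∫⁻ z : Path, ‖z.1 t‖ₑ ^ 4 ∂π ≤ A) {h s : ℝ≥0} (hs : s + h ≤ T) :
    incrSq π h s ≤ 2 * P.map X (lifetimeIn η s (s + h))
      + (4 * C : ℝ≥0) * ∫⁻ r, sqMoment π (shiftIncr s (s + h)) r ∂lebesguePos := by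
  have hG := measurableSet_lifetimeIn hη s (s + h)
  have hG1 : Measurable ((lifetimeIn η s (s + h)).indicator (1 : Ω' → ℝ≥0∞)) :=
    measurable_one.indicator hG
  have hGX : Measurable fun ω => (lifetimeIn η s (s + h)).indicator (1 : Ω' → ℝ≥0∞) (X ω) :=
    hG1.comp hX
  have hm : Measurable fun z : Path => ‖z.1 (s + h) - z.1 s‖ₑ ^ 2 :=
    ((measurable_path_eval _).sub (measurable_path_eval _)).enorm.pow_const 2
  have hadm := isAdmissible_shiftIncr hA (le_self_add : s ≤ s + h) hs
  rw [incrSq, ← S.law.lintegral_comp hm.aemeasurable]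
  calc _ ≤ ∫⁻ ω, (2 * (lifetimeIn η s (s + h)).indicator 1 (X ω)
          + 4 * splitIncr μ X β M s (s + h) ω) ∂P :=
        lintegral_mono_ae (S.enorm_sub_sq_le H hA le_self_add hs)
    _ = 2 * P.map X (lifetimeIn η s (s + h)) + 4 * ∫⁻ ω, splitIncr μ X β M s (s + h) ω ∂P := by
        rw [lintegral_add_left (hGX.const_mul 2), lintegral_const_mul' _ _ (by simp),
          lintegral_const_mul' _ _ (by simp), ← lintegral_map hG1 hX, lintegral_indicator_one hG]
    _ ≤ 2 * P.map X (lifetimeIn η s (s + h))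
          + 4 * (C * ∫⁻ r, sqMoment π (shiftIncr s (s + h)) r ∂lebesguePos) := by
        gcongr
        exact H.lintegral_splitSq_le hX.aemeasurable hadm
    _ = _ := by
        push_cast
        ring

/-- Grönwall in s with h fixed, on [0, T - h] so that both endpoints stay below T. The death
probability and the term of order h are both absorbed into d². -/
theorem SolvesBirthEquation.exists_incrFourth_le (S : SolvesBirthEquation P π X β η M Z)
    (H : HasMomentBounds P μ π X β M T C) (hX : Measurable X) (hη : Measurable η)
    (hA : ∀ t ≤ T, ∫⁻ z : Path, ‖z.1 t‖ₑ ^ 4 ∂π ≤ A) (K : ℝ≥0) :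
    ∃ D : ℝ≥0, ∀ h d : ℝ≥0, h ≤ K * d ^ 2 →
      (∀ s, s + h ≤ T → P.map X (lifetimeIn η s (s + h)) ≤ K * (d : ℝ≥0∞) ^ 2) →
      ∀ s, s + h ≤ T → incrFourth π h s ≤ D * (d : ℝ≥0∞) ^ 2 := by
  obtain ⟨D, hD⟩ := exists_gronwall (32 * (C * (2 + T))) T
  refine ⟨D * (8 * K + 32 * (C * (2 + T)) * (A * K)), fun h d hh hp s hs => ?_⟩
  have hhT : h ≤ T := le_add_self.trans hs
  have hadd : ∀ t ≤ T - h, t + h ≤ T := fun t ht => by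
    calc t + h ≤ T - h + h := by gcongr
      _ = T := tsub_add_cancel_of_le hhT
  have key := hD (incrFourth π h) (T - h)
    ((8 * K + 32 * (C * (2 + T)) * (A * K) : ℝ≥0) * (d : ℝ≥0∞) ^ 2) (16 * A) tsub_le_self
    (fun t ht => CMJ.incrFourth_le hA (hadd t ht))
    (fun t ht => (S.incrFourth_le H hX hη hA (hadd t ht)).trans ?_) s (le_tsub_of_add_le_right hs)
  · refine key.trans (le_of_eq ?_)
    push_cast
    ring
  · have hh' : (h : ℝ≥0∞) ≤ K * (d : ℝ≥0∞) ^ 2 := by exact_mod_cast hh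
    calc _ ≤ 8 * (K * (d : ℝ≥0∞) ^ 2) + (32 * (C * (2 + T)) : ℝ≥0) *
          (∫⁻ r in Iic t, incrFourth π h (t - r) ∂lebesguePos + A * (K * (d : ℝ≥0∞) ^ 2)) := by
          gcongr
          exact hp t (hadd t ht)
      _ = _ := by
          push_cast
          ring

end

/-! ### Increments over successive intervals -/

/-- By Fubini: for a given lifetime, the admissible r form a set of length at most h. No regularity
of the lifetime law enters, which is why the exponent is 1 instead of α. -/
theorem lintegral_measure_lifetimeIn_le {Ω' : Type*} [MeasurableSpace Ω'] (ρ : Measure Ω')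
    [IsProbabilityMeasure ρ] {η : Ω' → ℝ≥0} (hη : Measurable η) (h s : ℝ≥0) :
    ∫⁻ r in Iic s, ρ (lifetimeIn η (s - r) (s - r + h)) ∂lebesguePos ≤ h := by
  have hmeas : MeasurableSet {p : ℝ≥0 × Ω' | s - p.1 < η p.2 ∧ η p.2 ≤ s - p.1 + h} := by
    have h1 : Measurable fun p : ℝ≥0 × Ω' => s - p.1 := by fun_prop
    have h2 : Measurable fun p : ℝ≥0 × Ω' => η p.2 := hη.comp measurable_snd
    have h3 : MeasurableSet {p : ℝ≥0 × Ω' | η p.2 ≤ s - p.1 + h} :=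
      measurableSet_le h2 (h1.add_const h)
    exact (measurableSet_lt h1 h2).inter h3
  calc _ = ((lebesguePos.restrict (Iic s)).prod ρ)
          {p : ℝ≥0 × Ω' | s - p.1 < η p.2 ∧ η p.2 ≤ s - p.1 + h} :=
        (Measure.prod_apply hmeas).symm
    _ = ∫⁻ x, (lebesguePos.restrict (Iic s)) {r | s - r < η x ∧ η x ≤ s - r + h} ∂ρ :=
        Measure.prod_apply_symm hmeas
    _ ≤ ∫⁻ _, (h : ℝ≥0∞) ∂ρ := by
        refine lintegral_mono fun x => ?_
        have hx : MeasurableSet {r | s - r < η x ∧ η x ≤ s - r + h} := measurable_prodMk_right hmeas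
        rw [Measure.restrict_apply hx]
        refine (lebesguePos_le_of_forall_mem_Icc (a := s - η x) (b := s - η x + h) ?_).trans ?_
        · rintro r ⟨⟨h1, h2⟩, hr⟩
          have hr' : r ≤ s := hr
          rw [← NNReal.coe_lt_coe, NNReal.coe_sub hr'] at h1
          rw [← NNReal.coe_le_coe, NNReal.coe_add, NNReal.coe_sub hr'] at h2
          constructor <;> linarith
        · simp
    _ = h := by simp

section

variable {Ω Ω' : Type*} [MeasurableSpace Ω] [MeasurableSpace Ω'] {P : Measure Ω}
  {μ : Measure Point} {π : Measure Path} [IsProbabilityMeasure π]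
  {X : Ω → Ω'} {β : Ω' → ℝ≥0 → ℝ≥0} {η : Ω' → ℝ≥0} {M : Ω → Measure Point} {Z : Ω → Path}
  {T C A : ℝ≥0}

/-- The recursion is run on the second moment already integrated over birth times. At a fixed age
the forcing would be a death probability, in general only of order h^α; after integration it is of
order h. -/
theorem SolvesBirthEquation.exists_lintegral_sqMoment_le [IsProbabilityMeasure P]
    (S : SolvesBirthEquation P π X β η M Z)
    (H : HasMomentBounds P μ π X β M T C) (hX : Measurable X) (hη : Measurable η)
    (hA : ∀ t ≤ T, ∫⁻ z : Path, ‖z.1 t‖ₑ ^ 4 ∂π ≤ A) :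
    ∃ D : ℝ≥0, ∀ h s : ℝ≥0, s + h ≤ T →
      ∫⁻ r, sqMoment π (shiftIncr s (s + h)) r ∂lebesguePos ≤ D * h := by
  obtain ⟨D, hD⟩ := exists_gronwall (4 * C) T
  refine ⟨D * (2 + (1 + A)), fun h s hs => ?_⟩
  have := Measure.isProbabilityMeasure_map (μ := P) hX.aemeasurable
  have hhT : h ≤ T := le_add_self.trans hs
  have hadd : ∀ t ≤ T - h, t + h ≤ T := fun t ht => by
    calc t + h ≤ T - h + h := by gcongr
      _ = T := tsub_add_cancel_of_le hhT
  let N : ℝ≥0 → ℝ≥0∞ := fun s => ∫⁻ r, sqMoment π (shiftIncr s (s + h)) r ∂lebesguePos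
  have hbdd : ∀ t ≤ T - h, N t ≤ ((2 * ((1 + A) + (1 + A))) * T : ℝ≥0) := by
    intro t ht
    rw [ENNReal.coe_mul]
    refine lintegral_sqMoment_le_of_le
      (fun r hr => shiftIncr_eq_zero le_self_add ((hadd t ht).trans_lt hr)) fun r _ => ?_
    have hle : ∀ u ≤ T, sqMoment π (shiftEval u) r ≤ (1 + A : ℝ≥0) := by
      intro u hu
      rcases le_or_gt r u with hr | hr
      · simpa [sqMoment, shiftEval, hr] using lintegral_sq_le hA (tsub_le_self.trans hu)
      · simp [sqMoment, shiftEval_eq_zero hr]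
    have hm : Measurable fun z => ‖shiftEval (t + h) r z‖ₑ ^ 2 :=
      ((measurable_shiftEval _).comp measurable_prodMk_left).enorm.pow_const 2
    calc _ ≤ ∫⁻ z, 2 * (‖shiftEval (t + h) r z‖ₑ ^ 2 + ‖shiftEval t r z‖ₑ ^ 2) ∂π :=
          lintegral_mono fun z => CMJ.enorm_sub_sq_le _ _
      _ = 2 * (sqMoment π (shiftEval (t + h)) r + sqMoment π (shiftEval t) r) := by
          rw [lintegral_const_mul' _ _ (by simp), lintegral_add_left hm]
          rfl
      _ ≤ _ := by
          push_cast at hle ⊢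
          gcongr
          · exact hle _ (hadd t ht)
          · exact hle _ (le_self_add.trans (hadd t ht))
  have key := hD N (T - h) ((2 + (1 + A) : ℝ≥0) * h) _ tsub_le_self hbdd (fun t ht => ?_) s
    (le_tsub_of_add_le_right hs)
  · refine key.trans (le_of_eq ?_)
    push_cast
    ring
  · have hlife : Measurable fun r => P.map X (lifetimeIn η (t - r) (t - r + h)) := by
      have h1 : Measurable fun p : ℝ≥0 × Ω' => t - p.1 := by fun_prop
      have h2 : Measurable fun p : ℝ≥0 × Ω' => η p.2 := hη.comp measurable_snd
      have h3 : MeasurableSet {p : ℝ≥0 × Ω' | η p.2 ≤ t - p.1 + h} :=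
        measurableSet_le h2 (h1.add_const h)
      exact measurable_measure_prodMk_left ((measurableSet_lt h1 h2).inter h3)
    calc N t ≤ ∫⁻ r in Iic t, incrSq π h (t - r) ∂lebesguePos + (1 + A : ℝ≥0) * h :=
          lintegral_sqMoment_shiftIncr_le hA (hadd t ht)
      _ ≤ ∫⁻ r in Iic t, (2 * P.map X (lifetimeIn η (t - r) (t - r + h))
            + (4 * C : ℝ≥0) * N (t - r)) ∂lebesguePos + (1 + A : ℝ≥0) * h := by
          gcongr with r
          exact S.incrSq_le H hX hη hA (hadd _ (tsub_le_self.trans ht))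
      _ = 2 * ∫⁻ r in Iic t, P.map X (lifetimeIn η (t - r) (t - r + h)) ∂lebesguePos
            + (4 * C : ℝ≥0) * ∫⁻ r in Iic t, N (t - r) ∂lebesguePos + (1 + A : ℝ≥0) * h := by
          rw [lintegral_add_left (hlife.const_mul 2), lintegral_const_mul' _ _ (by simp),
            lintegral_const_mul' _ _ ENNReal.coe_ne_top]
      _ ≤ 2 * h + (4 * C : ℝ≥0) * ∫⁻ r in Iic t, N (t - r) ∂lebesguePos
            + (1 + A : ℝ≥0) * h := by
          gcongr
          exact lintegral_measure_lifetimeIn_le _ hη h t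
      _ = _ := by
          push_cast
          ring

/-- The moments of the increments over `[s, s + h₁]` and `[s + h₁, s + h₁ + h₂]` are controlled by
the modulus `d`, as well as the probability that the lifetime ends in either of them. -/
structure IncrementControl (ρ : Measure Ω') (π : Measure Path) (η : Ω' → ℝ≥0)
    (T K h₁ h₂ d : ℝ≥0) : Prop where
  measure_le₁ : ∀ s, s + h₁ ≤ T → ρ (lifetimeIn η s (s + h₁)) ≤ K * (d : ℝ≥0∞) ^ 2
  measure_le₂ : ∀ s, s + h₂ ≤ T → ρ (lifetimeIn η s (s + h₂)) ≤ K * (d : ℝ≥0∞) ^ 2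
  length_le₂ : h₂ ≤ K * d ^ 2
  modulus_le : d ≤ K
  incrFourth_le₁ : ∀ s, s + h₁ ≤ T → incrFourth π h₁ s ≤ K * (d : ℝ≥0∞) ^ 2
  incrFourth_le₂ : ∀ s, s + h₂ ≤ T → incrFourth π h₂ s ≤ K * (d : ℝ≥0∞) ^ 2
  lintegral_sqMoment_le₁ : ∀ s, s + h₁ ≤ T →
    ∫⁻ r, sqMoment π (shiftIncr s (s + h₁)) r ∂lebesguePos ≤ K * (h₁ : ℝ≥0∞)
  lintegral_sqMoment_le₂ : ∀ s, s + h₂ ≤ T →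
    ∫⁻ r, sqMoment π (shiftIncr s (s + h₂)) r ∂lebesguePos ≤ K * (h₂ : ℝ≥0∞)

/-- The mixed term is recursive up to O(d·h₁). In the integrated product of second moments, the
second increment is bounded uniformly by O(d) and the first is integrated to O(h₁). The product of
the two time integrals is O(h₂·h₁). -/
theorem IncrementControl.lintegral_splitIncr_mul_le {h₁ h₂ d K : ℝ≥0}
    (I : IncrementControl (P.map X) π η T K h₁ h₂ d) (H : HasMomentBounds P μ π X β M T C)
    (hA : ∀ t ≤ T, ∫⁻ z : Path, ‖z.1 t‖ₑ ^ 4 ∂π ≤ A) {s : ℝ≥0} (hs : s + h₁ + h₂ ≤ T) :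
    ∫⁻ ω, splitIncr μ X β M (s + h₁) (s + h₁ + h₂) ω * splitIncr μ X β M s (s + h₁) ω ∂P
      ≤ (C * ((1 + K * A) + (1 + K) * K + K ^ 4) : ℝ≥0) * (h₁ * d)
        + C * ∫⁻ r in Iic s, incrMixed π h₁ h₂ (s - r) ∂lebesguePos := by
  have hs1 : s + h₁ ≤ T := le_self_add.trans hs
  have hcross : ∫⁻ r, sqMoment π (shiftIncr (s + h₁) (s + h₁ + h₂)) r *
      sqMoment π (shiftIncr s (s + h₁)) r ∂lebesguePos ≤ ((1 + K) * d : ℝ≥0) * (K * h₁) := by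
    calc _ ≤ ∫⁻ r, ((1 + K) * d : ℝ≥0) * sqMoment π (shiftIncr s (s + h₁)) r ∂lebesguePos := by
          refine lintegral_mono fun r => ?_
          rcases le_or_gt r (s + h₁) with hr | hr
          · refine mul_le_mul' ?_ le_rfl
            exact sqMoment_shiftIncr_le_of_incrFourth_le I.incrFourth_le₂ hs hr
          · simp [sqMoment, shiftIncr_eq_zero le_self_add hr]
      _ ≤ _ := by
          rw [lintegral_const_mul' _ _ ENNReal.coe_ne_top]
          exact mul_le_mul' le_rfl (I.lintegral_sqMoment_le₁ s hs1)
  -- Only one power of d is needed, so the other is traded for its upper bound `K`.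
  have hh₂ : (h₂ : ℝ≥0∞) ≤ (K ^ 2 * d : ℝ≥0) := by
    refine ENNReal.coe_le_coe.2 (I.length_le₂.trans ?_)
    calc K * d ^ 2 = K * d * d := by ring
      _ ≤ K * K * d := by
          gcongr
          exact I.modulus_le
      _ = _ := by ring
  calc _ ≤ C * ((∫⁻ r in Iic s, incrMixed π h₁ h₂ (s - r) ∂lebesguePos
            + ((1 + K * A) * d : ℝ≥0) * h₁) + ((1 + K) * d : ℝ≥0) * (K * h₁)
            + (K * (K ^ 2 * d : ℝ≥0)) * (K * h₁)) := by
        refine (H.splitSq_mul_le _ _ (isAdmissible_shiftIncr hA le_self_add hs)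
          (isAdmissible_shiftIncr hA le_self_add hs1)).trans (mul_le_mul' le_rfl
          (add_le_add (add_le_add ?_ hcross) (mul_le_mul' ?_ (I.lintegral_sqMoment_le₁ s hs1))))
        · exact lintegral_mixedMoment_shiftIncr_le hA I.incrFourth_le₂ hs
        · exact (I.lintegral_sqMoment_le₂ _ hs).trans (mul_le_mul' le_rfl hh₂)
    _ = _ := by
        push_cast
        ring

theorem lintegral_indicator_mul_splitIncr_le {K h d : ℝ≥0} {s : ℝ≥0} {G : Set Ω'}
    (H : HasMomentBounds P μ π X β M T C)
    (hA : ∀ t ≤ T, ∫⁻ z : Path, ‖z.1 t‖ₑ ^ 4 ∂π ≤ A) (hs : s + h ≤ T) (hG : MeasurableSet G)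
    (hGle : P.map X G ≤ K * (d : ℝ≥0∞) ^ 2)
    (hN : ∫⁻ r, sqMoment π (shiftIncr s (s + h)) r ∂lebesguePos ≤ K * (h : ℝ≥0∞)) :
    ∫⁻ ω, G.indicator 1 (X ω) * splitIncr μ X β M s (s + h) ω ∂P
      ≤ (C * (1 + K) * K : ℝ≥0) * (h * d) := by
  have hsqrt : P.map X G ^ (1 / 2 : ℝ) ≤ ((1 + K) * d : ℝ≥0) := by
    refine ennreal_le_of_sq_le (le_trans (le_of_eq ?_) hGle)
    rw [← ENNReal.rpow_two, ← ENNReal.rpow_mul]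
    norm_num
  calc _ ≤ C * ((1 + K) * d : ℝ≥0) * (K * (h : ℝ≥0∞)) :=
        (H.splitSq_le _ (isAdmissible_shiftIncr hA le_self_add hs) G hG).trans
          (mul_le_mul' (mul_le_mul' le_rfl hsqrt) hN)
    _ = _ := by
        push_cast
        ring

/-- Both squared increments are a death indicator plus a split square. In their product the
indicators multiply to zero because the lifetime cannot end in two disjoint intervals. The cross
terms carry a factor P(G)^(1/2) = O(d) and a time-integrated second moment O(h). -/
theorem IncrementControl.incrMixed_le {h₁ h₂ d K : ℝ≥0}
    (I : IncrementControl (P.map X) π η T K h₁ h₂ d) (S : SolvesBirthEquation P π X β η M Z)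
    (H : HasMomentBounds P μ π X β M T C) (hX : Measurable X) (hη : Measurable η)
    (hA : ∀ t ≤ T, ∫⁻ z : Path, ‖z.1 t‖ₑ ^ 4 ∂π ≤ A) {s : ℝ≥0} (hs : s + h₁ + h₂ ≤ T) :
    incrMixed π h₁ h₂ s ≤ (8 * (C * (1 + K) * K) : ℝ≥0) * ((h₁ + h₂ : ℝ≥0) * d)
      + 16 * ∫⁻ ω, splitIncr μ X β M (s + h₁) (s + h₁ + h₂) ω * splitIncr μ X β M s (s + h₁) ω
        ∂P := by
  have hs1 : s + h₁ ≤ T := le_self_add.trans hs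
  set G₁ := lifetimeIn η s (s + h₁) with hG₁
  set G₂ := lifetimeIn η (s + h₁) (s + h₁ + h₂) with hG₂
  have hm₁ : MeasurableSet G₁ := measurableSet_lifetimeIn hη _ _
  have hm₂ : MeasurableSet G₂ := measurableSet_lifetimeIn hη _ _
  have hS₁ : AEMeasurable (splitIncr μ X β M s (s + h₁)) P :=
    H.aemeasurable_splitSq _ (isAdmissible_shiftIncr hA le_self_add hs1)
  have hS₂ : AEMeasurable (splitIncr μ X β M (s + h₁) (s + h₁ + h₂)) P :=
    H.aemeasurable_splitSq _ (isAdmissible_shiftIncr hA le_self_add hs)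
  have hdisj : ∀ x, (G₂.indicator 1 x : ℝ≥0∞) * G₁.indicator 1 x = 0 := by
    intro x
    by_cases hx : x ∈ G₂
    · have : x ∉ G₁ := fun hx' => (hx.1.trans_le hx'.2).false
      simp [this]
    · simp [hx]
  have hm : Measurable fun z : Path => ‖z.1 (s + h₁ + h₂) - z.1 (s + h₁)‖ₑ ^ 2
      * ‖z.1 (s + h₁) - z.1 s‖ₑ ^ 2 :=
    (((measurable_path_eval _).sub (measurable_path_eval _)).enorm.pow_const 2).mul
      (((measurable_path_eval _).sub (measurable_path_eval _)).enorm.pow_const 2)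
  rw [incrMixed, ← S.law.lintegral_comp hm.aemeasurable]
  have hi₁ : Measurable fun ω => G₁.indicator (1 : Ω' → ℝ≥0∞) (X ω) :=
    (measurable_one.indicator hm₁).comp hX
  have hi₂ : Measurable fun ω => G₂.indicator (1 : Ω' → ℝ≥0∞) (X ω) :=
    (measurable_one.indicator hm₂).comp hX
  have hb₁ : ∫⁻ ω, G₂.indicator 1 (X ω) * splitIncr μ X β M s (s + h₁) ω ∂P
      ≤ (C * (1 + K) * K : ℝ≥0) * (h₁ * d) :=
    lintegral_indicator_mul_splitIncr_le H hA hs1 hm₂ (I.measure_le₂ _ hs)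
      (I.lintegral_sqMoment_le₁ _ hs1)
  have hb₂ : ∫⁻ ω, G₁.indicator 1 (X ω) * splitIncr μ X β M (s + h₁) (s + h₁ + h₂) ω ∂P
      ≤ (C * (1 + K) * K : ℝ≥0) * (h₂ * d) :=
    lintegral_indicator_mul_splitIncr_le H hA hs hm₁ (I.measure_le₁ _ hs1)
      (I.lintegral_sqMoment_le₂ _ hs)
  calc _ ≤ ∫⁻ ω, (8 * (G₂.indicator 1 (X ω) * splitIncr μ X β M s (s + h₁) ω)
          + (8 * (G₁.indicator 1 (X ω) * splitIncr μ X β M (s + h₁) (s + h₁ + h₂) ω)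
          + 16 * (splitIncr μ X β M (s + h₁) (s + h₁ + h₂) ω
            * splitIncr μ X β M s (s + h₁) ω))) ∂P := by
        refine lintegral_mono_ae ?_
        filter_upwards [S.enorm_sub_sq_le H hA (le_self_add : s ≤ s + h₁) hs1,
          S.enorm_sub_sq_le H hA (le_self_add : s + h₁ ≤ s + h₁ + h₂) hs] with ω h1 h2
        refine (mul_le_mul' h2 h1).trans (le_of_eq ?_)
        calc _ = 4 * (G₂.indicator 1 (X ω) * G₁.indicator 1 (X ω))
              + (8 * (G₂.indicator 1 (X ω) * splitIncr μ X β M s (s + h₁) ω)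
              + (8 * (G₁.indicator 1 (X ω) * splitIncr μ X β M (s + h₁) (s + h₁ + h₂) ω)
              + 16 * (splitIncr μ X β M (s + h₁) (s + h₁ + h₂) ω
                * splitIncr μ X β M s (s + h₁) ω))) := by ring
          _ = _ := by rw [hdisj, mul_zero, zero_add]
    _ = 8 * ∫⁻ ω, G₂.indicator 1 (X ω) * splitIncr μ X β M s (s + h₁) ω ∂P
          + (8 * ∫⁻ ω, G₁.indicator 1 (X ω) * splitIncr μ X β M (s + h₁) (s + h₁ + h₂) ω ∂P
          + 16 * ∫⁻ ω, splitIncr μ X β M (s + h₁) (s + h₁ + h₂) ω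
            * splitIncr μ X β M s (s + h₁) ω ∂P) := by
        have hp₁ : AEMeasurable (fun ω => 8 *
            (G₂.indicator 1 (X ω) * splitIncr μ X β M s (s + h₁) ω)) P :=
          (hi₂.aemeasurable.mul hS₁).const_mul 8
        have hp₂ : AEMeasurable (fun ω => 8 *
            (G₁.indicator 1 (X ω) * splitIncr μ X β M (s + h₁) (s + h₁ + h₂) ω)) P :=
          (hi₁.aemeasurable.mul hS₂).const_mul 8
        rw [lintegral_add_left' hp₁, lintegral_add_left' hp₂,
          lintegral_const_mul' _ _ (by simp), lintegral_const_mul' _ _ (by simp),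
          lintegral_const_mul' _ _ (by simp)]
    _ ≤ 8 * ((C * (1 + K) * K : ℝ≥0) * (h₁ * d)) + (8 * ((C * (1 + K) * K : ℝ≥0) * (h₂ * d))
          + 16 * ∫⁻ ω, splitIncr μ X β M (s + h₁) (s + h₁ + h₂) ω
            * splitIncr μ X β M s (s + h₁) ω ∂P) := by gcongr
    _ = _ := by
        push_cast
        ring

/-- The path moments and the products of integrals bound each other. Substituting the second
estimate in the first gives a closed inequality for `incrMixed`, and Grönwall's bound on it is fed
back once. -/
theorem SolvesBirthEquation.exists_lintegral_splitIncr_mul_le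
    (S : SolvesBirthEquation P π X β η M Z) (H : HasMomentBounds P μ π X β M T C)
    (hX : Measurable X) (hη : Measurable η)
    (hA : ∀ t ≤ T, ∫⁻ z : Path, ‖z.1 t‖ₑ ^ 4 ∂π ≤ A) (K : ℝ≥0) :
    ∃ D : ℝ≥0, ∀ h₁ h₂ d : ℝ≥0, IncrementControl (P.map X) π η T K h₁ h₂ d →
      ∀ s, s + h₁ + h₂ ≤ T →
      ∫⁻ ω, splitIncr μ X β M (s + h₁) (s + h₁ + h₂) ω * splitIncr μ X β M s (s + h₁) ω ∂P
        ≤ D * ((h₁ + h₂ : ℝ≥0) * d) := by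
  obtain ⟨D, hD⟩ := exists_gronwall (16 * C) T
  set E : ℝ≥0 := C * ((1 + K * A) + (1 + K) * K + K ^ 4) with hE
  set E' : ℝ≥0 := 8 * (C * (1 + K) * K) + 16 * E with hE'
  refine ⟨E + C * (D * E' * T), fun h₁ h₂ d I s hs => ?_⟩
  have hhT : h₁ + h₂ ≤ T := by
    refine le_trans ?_ hs
    rw [add_assoc]
    exact le_add_self
  have hadd : ∀ t ≤ T - (h₁ + h₂), t + h₁ + h₂ ≤ T := fun t ht => by
    calc t + h₁ + h₂ = t + (h₁ + h₂) := add_assoc _ _ _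
      _ ≤ T - (h₁ + h₂) + (h₁ + h₂) := by gcongr
      _ = T := tsub_add_cancel_of_le hhT
  have hsplit : ∀ t ≤ T - (h₁ + h₂), ∫⁻ ω, splitIncr μ X β M (t + h₁) (t + h₁ + h₂) ω
      * splitIncr μ X β M t (t + h₁) ω ∂P ≤ E * ((h₁ + h₂ : ℝ≥0) * d)
        + C * ∫⁻ r in Iic t, incrMixed π h₁ h₂ (t - r) ∂lebesguePos := by
    intro t ht
    refine (I.lintegral_splitIncr_mul_le H hA (hadd t ht)).trans ?_
    gcongr
    exact le_self_add
  have hs' : s ≤ T - (h₁ + h₂) := le_tsub_of_add_le_right (by rwa [← add_assoc])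
  have hmixed : ∀ t ≤ T - (h₁ + h₂),
      incrMixed π h₁ h₂ t ≤ D * (E' * ((h₁ + h₂ : ℝ≥0) * d)) := by
    refine hD (incrMixed π h₁ h₂) _ _ (K * d ^ 2 + K * d ^ 2) tsub_le_self (fun t ht => ?_)
      fun t ht => ?_
    · refine incrMixed_le_of_incrFourth_le.trans ?_
      push_cast
      exact add_le_add (I.incrFourth_le₂ _ (hadd t ht))
        (I.incrFourth_le₁ _ (le_self_add.trans (hadd t ht)))
    · calc _ ≤ (8 * (C * (1 + K) * K) : ℝ≥0) * ((h₁ + h₂ : ℝ≥0) * d)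
            + 16 * (E * ((h₁ + h₂ : ℝ≥0) * d)
              + C * ∫⁻ r in Iic t, incrMixed π h₁ h₂ (t - r) ∂lebesguePos) := by
            refine (I.incrMixed_le S H hX hη hA (hadd t ht)).trans ?_
            gcongr
            exact hsplit t ht
        _ = _ := by
            rw [hE']
            push_cast
            ring
  calc _ ≤ E * ((h₁ + h₂ : ℝ≥0) * d)
          + C * ∫⁻ r in Iic s, incrMixed π h₁ h₂ (s - r) ∂lebesguePos := hsplit s hs'
    _ ≤ E * ((h₁ + h₂ : ℝ≥0) * d)
          + C * ∫⁻ _ in Iic s, D * (E' * ((h₁ + h₂ : ℝ≥0) * d)) ∂lebesguePos := by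
        gcongr with r
        exact hmixed _ (tsub_le_self.trans hs')
    _ ≤ E * ((h₁ + h₂ : ℝ≥0) * d) + C * ((D * (E' * ((h₁ + h₂ : ℝ≥0) * d))) * T) := by
        rw [setLIntegral_const, lebesguePos_Iic]
        gcongr
        exact hs'.trans tsub_le_self
    _ = _ := by
        push_cast
        ring

/-- Second moments of increments, and mixed moments of successive increments, of the integrals over
the birth events. -/
theorem SolvesBirthEquation.exists_increment_bounds [IsProbabilityMeasure P]
    (S : SolvesBirthEquation P π X β η M Z) (H : HasMomentBounds P μ π X β M T C)
    (hX : Measurable X) (hη : Measurable η)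
    (hA : ∀ t ≤ T, ∫⁻ z : Path, ‖z.1 t‖ₑ ^ 4 ∂π ≤ A) (K : ℝ≥0) :
    ∃ D : ℝ≥0, (∀ s t, s ≤ t → t ≤ T → ∫⁻ ω, splitIncr μ X β M s t ω ∂P ≤ D * (t - s : ℝ≥0)) ∧
      ∀ s v t d, s ≤ v → v ≤ t → t ≤ T → d ≤ K → t - s ≤ K * d ^ 2 →
      (∀ u w, u ≤ w → w ≤ T → w - u ≤ t - s →
        P.map X (lifetimeIn η u w) ≤ K * (d : ℝ≥0∞) ^ 2) →
      ∫⁻ ω, splitIncr μ X β M v t ω * splitIncr μ X β M s v ω ∂P ≤ D * ((t - s : ℝ≥0) * d) := by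
  obtain ⟨D₄, h₄⟩ := S.exists_incrFourth_le H hX hη hA K
  obtain ⟨D₂, h₂⟩ := S.exists_lintegral_sqMoment_le H hX hη hA
  obtain ⟨D, hD⟩ := S.exists_lintegral_splitIncr_mul_le H hX hη hA (K + D₄ + D₂)
  refine ⟨D + C * D₂, fun s t hst ht => ?_, fun s v t d hsv hvt ht hdK hlen hlife => ?_⟩
  · obtain ⟨h, rfl⟩ := exists_add_of_le hst
    rw [add_tsub_cancel_left]
    calc _ ≤ C * (D₂ * (h : ℝ≥0∞)) :=
          (H.lintegral_splitSq_le hX.aemeasurable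
            (isAdmissible_shiftIncr hA hst ht)).trans (mul_le_mul' le_rfl (h₂ h s ht))
      _ ≤ _ := by
          rw [← mul_assoc]
          push_cast
          exact mul_le_mul' le_add_self le_rfl
  · obtain ⟨k₁, rfl⟩ := exists_add_of_le hsv
    obtain ⟨k₂, rfl⟩ := exists_add_of_le hvt
    rw [add_assoc, add_tsub_cancel_left] at hlen hlife
    have hK1 : K ≤ K + D₄ + D₂ := le_self_add.trans le_self_add
    have hK2 : D₄ ≤ K + D₄ + D₂ := le_add_self.trans le_self_add
    have hK3 : D₂ ≤ K + D₄ + D₂ := le_add_self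
    -- The modulus d belongs to the total length, so every bound passes to both subintervals with
    -- the same d.
    have hL : ∀ k ≤ k₁ + k₂, k ≤ K * d ^ 2 := fun k hk => hk.trans hlen
    have hP : ∀ k ≤ k₁ + k₂, ∀ s, s + k ≤ T →
        P.map X (lifetimeIn η s (s + k)) ≤ K * (d : ℝ≥0∞) ^ 2 := fun k hk s hs =>
      hlife s (s + k) le_self_add hs (by rwa [add_tsub_cancel_left])
    have hF : ∀ k ≤ k₁ + k₂, ∀ s, s + k ≤ T → incrFourth π k s ≤ D₄ * (d : ℝ≥0∞) ^ 2 :=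
      fun k hk => h₄ k d (hL k hk) (hP k hk)
    have I : IncrementControl (P.map X) π η T (K + D₄ + D₂) k₁ k₂ d :=
      { measure_le₁ := fun s hs => (hP k₁ le_self_add s hs).trans (by gcongr)
        measure_le₂ := fun s hs => (hP k₂ le_add_self s hs).trans (by gcongr)
        length_le₂ := (hL k₂ le_add_self).trans (by gcongr)
        modulus_le := hdK.trans hK1
        incrFourth_le₁ := fun s hs => (hF k₁ le_self_add s hs).trans (by gcongr)
        incrFourth_le₂ := fun s hs => (hF k₂ le_add_self s hs).trans (by gcongr)
        lintegral_sqMoment_le₁ := fun s hs => (h₂ k₁ s hs).trans (by gcongr)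
        lintegral_sqMoment_le₂ := fun s hs => (h₂ k₂ s hs).trans (by gcongr) }
    have htsub : s + k₁ + k₂ - s = k₁ + k₂ := by rw [add_assoc, add_tsub_cancel_left]
    rw [htsub]
    refine (hD k₁ k₂ d I s ht).trans (mul_le_mul' ?_ le_rfl)
    exact_mod_cast le_self_add

end

/-! ### The compensated integral -/

theorem integrable_and_integral_le_of_lintegral_le {Ω : Type*} [MeasurableSpace Ω] {P : Measure Ω}
    {f : Ω → ℝ} (hf : AEStronglyMeasurable f P) (h0 : ∀ ω, 0 ≤ f ω) {c : ℝ≥0}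
    (h : ∫⁻ ω, ENNReal.ofReal (f ω) ∂P ≤ c) : Integrable f P ∧ ∫ ω, f ω ∂P ≤ c := by
  have hae : 0 ≤ᵐ[P] f := ae_of_all _ h0
  refine ⟨(lintegral_ofReal_ne_top_iff_integrable hf hae).1 (h.trans_lt ENNReal.coe_lt_top).ne, ?_⟩
  rw [integral_eq_lintegral_of_nonneg_ae hae hf]
  exact ENNReal.toReal_le_of_le_ofReal c.2 (h.trans (by simp))

theorem ofReal_abs_sq (x : ℝ) : ENNReal.ofReal (|x| ^ 2) = ‖x‖ₑ ^ 2 := by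
  rw [enorm_sq_eq_ofReal, sq_abs]

theorem measure_lifetimeIn_eq {Ω : Type*} [MeasurableSpace Ω] (P : Measure Ω)
    [IsProbabilityMeasure P] {η : Ω → ℝ≥0} (hη : Measurable η) {u w : ℝ≥0} (huw : u ≤ w) :
    P (lifetimeIn η u w) = ENNReal.ofReal (lifetimeCDF P η w - lifetimeCDF P η u) := by
  have hu : MeasurableSet {ω | η ω ≤ u} := (measurableSet_Iic : MeasurableSet (Iic u)).preimage hη
  have hsub : {ω | η ω ≤ u} ⊆ {ω | η ω ≤ w} := fun ω hω => le_trans hω huw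
  have hdiff : lifetimeIn η u w = {ω | η ω ≤ w} \ {ω | η ω ≤ u} := by
    ext ω
    simp [lifetimeIn, and_comm]
  rw [lifetimeCDF, lifetimeCDF, ← measureReal_sdiff hsub hu, hdiff, measureReal_def,
    ENNReal.ofReal_toReal (measure_ne_top _ _)]

/-- A modulus that controls the probability that the lifetime ends in a short interval. -/
theorem HolderUpTo.exists_modulus {Ω : Type*} [MeasurableSpace Ω] {P : Measure Ω}
    [IsProbabilityMeasure P] {η : Ω → ℝ≥0} (hη : Measurable η) {T : ℝ≥0} {α : ℝ} (hα0 : 0 < α)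
    (hα1 : α ≤ 1) (hF : HolderUpTo (lifetimeCDF P η) T α) :
    ∃ K : ℝ≥0, ∀ h ≤ T, 0 < h → h ^ (α / 2) ≤ K ∧ h ≤ K * (h ^ (α / 2)) ^ 2 ∧
      ∀ u w, u ≤ w → w ≤ T → w - u ≤ h →
        P (lifetimeIn η u w) ≤ K * ((h ^ (α / 2) : ℝ≥0) : ℝ≥0∞) ^ 2 := by
  obtain ⟨C, hC, hF⟩ := hF
  have hsq : ∀ h : ℝ≥0, (h ^ (α / 2)) ^ 2 = h ^ α := fun h => by
    rw [← NNReal.rpow_mul_natCast]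
    norm_num
  -- One summand per requirement: the Hölder constant for the death probability, h = h^(1-α) h^α for
  -- the length, and h^(α/2) ≤ T^(α/2) for the modulus itself.
  refine ⟨C.toNNReal + T ^ (1 - α) + T ^ (α / 2), fun h hT h0 => ⟨?_, ?_, ?_⟩⟩
  · exact (NNReal.rpow_le_rpow hT (by positivity)).trans le_add_self
  · rw [hsq]
    calc h = h ^ (1 - α) * h ^ α := by
          rw [← NNReal.rpow_add h0.ne', sub_add_cancel, NNReal.rpow_one]
      _ ≤ _ := by
          gcongr
          exact (NNReal.rpow_le_rpow hT (by linarith)).trans (le_add_self.trans le_self_add)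
  · intro u w huw hw hwu
    rcases huw.eq_or_lt with rfl | huw'
    · have : lifetimeIn η u u = ∅ := by
        ext ω
        simp [lifetimeIn]
      simp [this]
    · rw [measure_lifetimeIn_eq P hη huw]
      have hle : |(w : ℝ) - u| ^ α ≤ (h : ℝ) ^ α := by
        rw [abs_of_nonneg (sub_nonneg.2 (by exact_mod_cast huw)), ← NNReal.coe_sub huw]
        exact Real.rpow_le_rpow (NNReal.coe_nonneg _) (by exact_mod_cast hwu) hα0.le
      calc _ ≤ ENNReal.ofReal (C * (h : ℝ) ^ α) := ENNReal.ofReal_le_ofReal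
            ((hF u w huw' hw).trans (mul_le_mul_of_nonneg_left hle hC.le))
        _ = (C.toNNReal : ℝ≥0∞) * ((h ^ (α / 2) : ℝ≥0) : ℝ≥0∞) ^ 2 := by
            rw [← ENNReal.coe_pow, hsq, ENNReal.ofReal_mul hC.le, ← NNReal.coe_rpow,
              ENNReal.ofReal_coe_nnreal]
            rfl
        _ ≤ _ := by
            gcongr
            exact le_self_add.trans le_self_add

theorem FourthMomentCondition.exists_weight_bound {Ω : Type*} [MeasurableSpace Ω] {P : Measure Ω}
    [IsProbabilityMeasure P] {ν : Measure ℕ} {b : Ω → ℝ≥0 → ℝ≥0}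
    (h : FourthMomentCondition P ν b) (T : ℝ≥0) :
    ∃ B : ℝ≥0, ∀ r, 0 < r → r ≤ T →
      ∫⁻ ω, ((b ω r : ℝ≥0∞) + (b ω r : ℝ≥0∞) ^ 2) ^ 2 ∂P ≤ B := by
  -- The supremum is over an open interval, so the horizon is enlarged to include r = T. The point r
  -- = 0 stays excluded.
  have hS := h.2 (T + 1) (by positivity)
  set S := ⨆ t ∈ Ioo 0 (T + 1), ∫⁻ ω, (b ω t : ℝ≥0∞) ^ 4 ∂P
  refine ⟨2 + 4 * S.toNNReal, fun r h0 hr => ?_⟩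
  have hrS : ∫⁻ ω, (b ω r : ℝ≥0∞) ^ 4 ∂P ≤ S :=
    le_iSup₂_of_le r ⟨h0, hr.trans_lt (lt_add_of_pos_right T one_pos)⟩ le_rfl
  calc _ ≤ ∫⁻ ω, (2 + 4 * (b ω r : ℝ≥0∞) ^ 4) ∂P := by
        refine lintegral_mono fun ω => ?_
        calc _ ≤ 2 * ((b ω r : ℝ≥0∞) ^ 2 + ((b ω r : ℝ≥0∞) ^ 2) ^ 2) := ennreal_add_sq_le _ _
          _ ≤ 2 * ((1 + (b ω r : ℝ≥0∞) ^ 4) + ((b ω r : ℝ≥0∞) ^ 2) ^ 2) := by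
              gcongr
              exact ennreal_sq_le_one_add _
          _ = _ := by ring
    _ = 2 + 4 * ∫⁻ ω, (b ω r : ℝ≥0∞) ^ 4 ∂P := by
        rw [lintegral_add_left measurable_const, lintegral_const_mul' _ _ (by simp)]
        simp
    _ ≤ 2 + 4 * S := by gcongr
    _ = _ := by
        push_cast
        rw [ENNReal.coe_toNNReal hS.ne]

theorem compensatedIntegral_increments {Ω Ω' : Type*} [MeasurableSpace Ω] [MeasurableSpace Ω']
    (P : Measure Ω) [IsProbabilityMeasure P] (ν : Measure ℕ) [IsProbabilityMeasure ν]
    (π : Measure Path) [IsProbabilityMeasure π] (X : Ω → Ω') (β : Ω' → ℝ≥0 → ℝ≥0) (η : Ω' → ℝ≥0)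
    (M : Ω → Measure Point) (Z : Ω → Path) (hM : IsPoissonRandomMeasure P (meanMeasure ν π) M) (hX : Measurable X)
    (hXM : IndepFun X M P) (hβ : Measurable (Function.uncurry β)) (hη : Measurable η)
    (S : SolvesBirthEquation P π X β η M Z)
    (h3 : FourthMomentCondition P ν (fun ω => β (X ω))) (T : ℝ≥0) (α : ℝ) (hα0 : 0 < α)
    (hα1 : α ≤ 1) (h4 : HolderUpTo (lifetimeCDF P (fun ω => η (X ω))) T α) (U : ℝ≥0 → Ω → ℝ)
    (hU : U = compensatedIntegral (meanMeasure ν π) (fun ω => β (X ω)) M) :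
    (∀ t : ℝ≥0, t ≤ T → ∀ᵐ ω ∂P, Integrable (birthIntegrand (β (X ω)) t) (M ω) ∧
      Integrable (birthIntegrand (β (X ω)) t) (meanMeasure ν π)) ∧
    ∃ C : ℝ, ∀ s v t : ℝ≥0, s < v → v < t → t ≤ T →
      (Integrable (fun ω => |U t ω - U s ω| ^ 2) P ∧
        ∫ ω, |U t ω - U s ω| ^ 2 ∂P ≤ C * ((t : ℝ) - s)) ∧
      (Integrable (fun ω => |U t ω - U v ω| ^ 2 * |U v ω - U s ω| ^ 2) P ∧
        ∫ ω, |U t ω - U v ω| ^ 2 * |U v ω - U s ω| ^ 2 ∂P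
          ≤ C * ((t : ℝ) - s) ^ (1 + α / 2)) := by
  obtain ⟨B, hB⟩ := h3.exists_weight_bound T
  have hB' : ∀ᵐ r ∂lebesguePos, r ≤ T →
      ∫⁻ x, ((β x r : ℝ≥0∞) + (β x r : ℝ≥0∞) ^ 2) ^ 2 ∂(P.map X) ≤ B := by
    -- The moment condition says nothing at time 0, which is a Lebesgue-null point.
    have h0 : ∀ᵐ r ∂lebesguePos, r ≠ 0 := by
      simpa [ae_iff] using lebesguePos_singleton 0
    filter_upwards [h0] with r hr0 hrT
    have hw : Measurable fun x => ((β x r : ℝ≥0∞) + (β x r : ℝ≥0∞) ^ 2) ^ 2 :=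
      ((measurable_weight hβ).comp measurable_prodMk_right).pow_const 2
    rw [lintegral_map hw hX]
    exact hB r (pos_iff_ne_zero.2 hr0) hrT
  obtain ⟨C, H⟩ := exists_hasMomentBounds hM hX hXM hβ h3.1.ne hB'
  obtain ⟨A, hA⟩ := S.exists_fourth_moment_le H hβ hM.integer_valued
  have hUeq : ∀ t ω, U t ω = compInt (meanMeasure ν π) (M ω)
      (markSum (β (X ω)) (shiftEval t)) := fun t ω => by
    rw [hU, compensatedIntegral, birthIntegrand_eq_markSum]
    rfl
  have hUm : ∀ t ≤ T, AEMeasurable (U t) P := fun t ht =>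
    (H.aemeasurable_compInt _ (isAdmissible_shiftEval hA ht)).congr
      (ae_of_all _ fun ω => (hUeq t ω).symm)
  have hUsub : ∀ s t, s ≤ t → t ≤ T → ∀ᵐ ω ∂P, ENNReal.ofReal (|U t ω - U s ω| ^ 2)
      ≤ splitIncr (meanMeasure ν π) X β M s t ω := by
    intro s t hst ht
    filter_upwards [H.ae_integrable _ (isAdmissible_shiftEval hA ht),
      H.ae_integrable _ (isAdmissible_shiftEval hA (hst.trans ht))] with ω hit his
    have hsub : U t ω - U s ω = compInt (meanMeasure ν π) (M ω)
        (markSum (β (X ω)) (shiftIncr s t)) := by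
      have h1 : markSum (β (X ω)) (shiftIncr s t)
          = fun x => markSum (β (X ω)) (shiftEval t) x - markSum (β (X ω)) (shiftEval s) x :=
        funext fun x => markSum_sub _ _ _ x
      rw [hUeq, hUeq, h1, compInt, compInt, compInt, integral_sub hit.1 his.1,
        integral_sub hit.2 his.2]
      ring
    rw [ofReal_abs_sq, hsub]
    exact enorm_compInt_sq_le_splitSq _ _ _
  have hηX : Measurable fun ω => η (X ω) := hη.comp hX
  obtain ⟨K, hK⟩ := h4.exists_modulus hηX hα0 hα1
  obtain ⟨D, hD1, hD2⟩ := S.exists_increment_bounds H hX hη hA K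
  refine ⟨fun t ht => ?_, D, fun s v t hsv hvt ht => ?_⟩
  · simp only [birthIntegrand_eq_markSum]
    exact H.ae_integrable _ (isAdmissible_shiftEval hA ht)
  have hst : s < t := hsv.trans hvt
  have hm : ∀ s t, s ≤ t → t ≤ T → AEStronglyMeasurable (fun ω => |U t ω - U s ω| ^ 2) P :=
    fun s t hst ht =>
      (((hUm t ht).sub (hUm s (hst.trans ht))).abs.pow_const 2).aestronglyMeasurable
  constructor
  · have h := integrable_and_integral_le_of_lintegral_le (hm s t hst.le ht)
      (fun ω => by positivity) (c := D * (t - s)) ?_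
    · rwa [NNReal.coe_mul, NNReal.coe_sub hst.le] at h
    · rw [ENNReal.coe_mul]
      exact (lintegral_mono_ae (hUsub s t hst.le ht)).trans (hD1 s t hst.le ht)
  -- The modulus is d = (t - s)^(α/2), so (t - s)·d has the required exponent 1 + α/2.
  · obtain ⟨hK1, hK2, hK3⟩ := hK (t - s) (tsub_le_self.trans ht) (tsub_pos_of_lt hst)
    have h := integrable_and_integral_le_of_lintegral_le
      (f := fun ω => |U t ω - U v ω| ^ 2 * |U v ω - U s ω| ^ 2)
      ((hm v t hvt.le ht).mul (hm s v hsv.le (hvt.le.trans ht)))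
      (fun ω => by positivity) (c := D * ((t - s) * (t - s) ^ (α / 2))) ?_
    · have he : ((D * ((t - s) * (t - s) ^ (α / 2)) : ℝ≥0) : ℝ)
          = D * ((t : ℝ) - s) ^ (1 + α / 2) := by
        rw [NNReal.coe_mul, NNReal.coe_mul, NNReal.coe_rpow, NNReal.coe_sub hst.le,
          Real.rpow_add (sub_pos.2 (by exact_mod_cast hst)), Real.rpow_one]
      rwa [he] at h
    · calc _ ≤ ∫⁻ ω, splitIncr (meanMeasure ν π) X β M v t ω
            * splitIncr (meanMeasure ν π) X β M s v ω ∂P := by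
            refine lintegral_mono_ae ?_
            filter_upwards [hUsub v t hvt.le ht, hUsub s v hsv.le (hvt.le.trans ht)] with ω h1 h2
            rw [ENNReal.ofReal_mul (by positivity)]
            exact mul_le_mul' h1 h2
        _ ≤ D * ((t - s : ℝ≥0) * ((t - s) ^ (α / 2) : ℝ≥0)) := by
            refine hD2 s v t _ hsv.le hvt.le ht hK1 hK2 fun u w huw hw hwu => ?_
            rw [Measure.map_apply hX (measurableSet_lifetimeIn hη u w)]
            exact hK3 u w huw hw hwu
        _ = _ := by
            push_cast
            ring

/-- The data of the ancestor factor through a random element that is independent of the Poisson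
random measure. -/
theorem IsCMJProcess.exists_indepFun.{u} {Ω : Type u} [MeasurableSpace Ω] {P : Measure Ω}
    {ν : Measure ℕ} {π : Measure Path} {b : Ω → ℝ≥0 → ℝ≥0} {η : Ω → ℝ≥0} {M : Ω → Measure Point}
    {Z : Ω → Path} (hZ : IsCMJProcess P ν π b η M Z) :
    ∃ (Ω' : Type u) (_ : MeasurableSpace Ω') (X : Ω → Ω') (β : Ω' → ℝ≥0 → ℝ≥0) (η' : Ω' → ℝ≥0),
      Measurable X ∧ IndepFun X M P ∧ Measurable (Function.uncurry β) ∧ Measurable η' ∧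
      b = (fun ω => β (X ω)) ∧ η = fun ω => η' (X ω) := by
  obtain ⟨𝒢, h𝒢, hb, hη, hind⟩ := hZ.independent
  -- The random element is the identity map into Ω equipped with the smaller σ-algebra `𝒢`.
  refine ⟨Ω, 𝒢, fun ω => ω, b, η, fun t ht => h𝒢 t ht, ?_, hb, hη, rfl, rfl⟩
  have hid : MeasurableSpace.comap (fun ω : Ω => ω) 𝒢 = 𝒢 := MeasurableSpace.comap_id
  rw [← hid] at hind
  exact hind

end CMJ

end

theorem mainTheorem4 {Ω : Type*} [MeasurableSpace Ω] (P : Measure Ω) [IsProbabilityMeasure P]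
    (ν : Measure ℕ) [IsProbabilityMeasure ν] (π : Measure CMJ.Path)
    (b : Ω → ℝ≥0 → ℝ≥0) (η : Ω → ℝ≥0) (M : Ω → Measure CMJ.Point) (Z : Ω → CMJ.Path)
    (hZ : CMJ.IsCMJProcess P ν π b η M Z)
    (h3 : CMJ.FourthMomentCondition P ν b)
    (T : ℝ≥0) (hT : 0 < T) (α : ℝ) (hα0 : 0 < α) (hα1 : α ≤ 1)
    (h4 : CMJ.HolderUpTo (CMJ.lifetimeCDF P η) T α)
    (U : ℝ≥0 → Ω → ℝ)
    (hU : U = CMJ.compensatedIntegral (CMJ.meanMeasure ν π) b M) :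
    (∀ t : ℝ≥0, t ≤ T → ∀ᵐ ω ∂P,
      Integrable (CMJ.birthIntegrand (b ω) t) (M ω) ∧
      Integrable (CMJ.birthIntegrand (b ω) t) (CMJ.meanMeasure ν π)) ∧
    ∃ C : ℝ, ∀ s v t : ℝ≥0, s < v → v < t → t ≤ T →
      (Integrable (fun ω => |U t ω - U s ω| ^ 2) P ∧
        ∫ ω, |U t ω - U s ω| ^ 2 ∂P ≤ C * ((t : ℝ) - s)) ∧
      (Integrable (fun ω => |U t ω - U v ω| ^ 2 * |U v ω - U s ω| ^ 2) P ∧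
        ∫ ω, |U t ω - U v ω| ^ 2 * |U v ω - U s ω| ^ 2 ∂P
          ≤ C * ((t : ℝ) - s) ^ (1 + α / 2)) := by
  have hπ : IsProbabilityMeasure π := hZ.law.isProbabilityMeasure_iff.1 inferInstance
  obtain ⟨Ω', _, X, β, η', hX, hXM, hβ, hη, rfl, rfl⟩ := hZ.exists_indepFun
  refine CMJ.compensatedIntegral_increments P ν π X β η' M Z hZ.poisson hX hXM hβ hη
    ⟨hZ.law, fun t => ?_⟩ h3 T α hα0 hα1 h4 U hU
  simpa only [CMJ.birthIntegrand_eq_markSum] using hZ.equation t
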